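/- Let $\mathbb K$ be $\mathbb R$ or $\mathbb C$. Let $\mathcal Q\subset \mathrm{Conf}(\mathbb K^2,4)$ be the space of unordered configurations of four distinct points of $\mathbb K^2$ such that no three of the points are collinear and no two of the lines joining them are parallel. Give $\mathtt Q=\mathcal Q/\mathrm{Aff}(\mathbb K^2)$ the quotient topology, and call a $\mathbb K$-valued function on $\mathtt Q$ $\mathbb K$-analytic at a point if its pull-back to ordered quadruples, an open subset of $(\mathbb K^2)^4$, is $\mathbb K$-analytic at all the quadruples over this point. For a finite linear group $G$ acting on $\mathbb K^2$, a point $z$ of $\mathtt Q$ has local model $\mathbb K^2/G$ if a neighbourhood of $z$ is homeomorphic to $V/G$, with $V$ a $G$-invariant open neighbourhood of $0$ in $\mathbb K^2$ and $z$ corresponding to the class of $0$, in such a way that a function is analytic if and only if its pull-back to $V$ is analytic. A point is called singular if it does not have the local model $\mathbb K^2/\{1\}$. Let $\Delta$ be the triangle with vertices $V_1=(0,0)$, $V_2=(1,0)$, $V_3=(\tfrac12,\tfrac{\sqrt3}2)$, and let $A\subset\mathbb K^2$ be the union of the three lines supporting its sides and of the three parallels to these lines through the opposite vertices. For $j=1,2,3$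 let $g(V_j,\cdot)$ be the map which acts on a line through $V_j$ and a point of the line supporting the opposite side by $t\mapsto 1/t$, in the affine coordinate $t$ equal to $1$ at $V_j$ and to $0$ at the point of the opposite side; in the affine coordinates in which $\Delta$ is $(0,0),(1,0),(0,1)$ these maps are the restrictions of $$\Big(\tfrac{-x}{1-x-y},\tfrac{-y}{1-x-y}\Big),\qquad \Big(\tfrac1x,\tfrac{-y}{x}\Big),\qquad \Big(\tfrac{-x}{y},\tfrac1y\Big),$$ which also define them on lines parallel to the opposite side. 1. The quotient $\mathtt Q$ is a $\mathbb K$-analytic surface, possibly with quotient singularities: it is Hausdorff and second countable, and each of its points has a local model $\mathbb K^2/G$ with $G$ a finite linear group. The configuration $\{V_1,V_2,V_3,v\}$ consists of four distinct points and is generic if and only if $v\notin A$, and every generic configuration is affinely equivalent to such a one. There is a faithful action of $\mathrm{Sym}(4)$ on $\mathbb K^2\setminus A$ by homeomorphisms that are given by rational functions without poles in $\mathbb K^2\setminus A$, in which $\mathrm{Sym}(3)$ (the permutations of the first three indices) acts by the affine symmetries of $\Delta$, the transposition $(j\ 4)$ acts by the birational involution $g(V_j,\cdot)$, and for which the map $$\mathtt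 Q\longrightarrow(\mathbb K^2\setminus A)/\mathrm{Sym}(4),\qquad [\mathcal P]\longmapsto[v]\quad\text{if } T(\mathcal P)=\{V_1,V_2,V_3,v\}\text{ for some } T\in\mathrm{Aff}(\mathbb K^2),$$ is a well defined homeomorphism which identifies the analytic functions on both sides (on the right: those whose pull-back to $\mathbb K^2\setminus A$ is analytic). 2. For $\mathbb K=\mathbb C$, $\mathtt Q$ is connected, and it is a complex manifold of dimension two whose holomorphic functions are the analytic functions above. 3. For $\mathbb K=\mathbb R$, $\mathtt Q$ has exactly two connected components: the classes of the convex configurations (none of the four points lies in the convex hull of the others) and the classes of the non-convex ones. Every singular point of $\mathtt Q$ has local model $\mathbb R^2/\mathbb Z_2$, where $\mathbb Z_2$ is generated by a reflection, or $\mathbb R^2/\mathrm{Sym}(3)$, where $\mathrm{Sym}(3)$ is the group of linear symmetries of a triangle centered at the origin. There are singular points with each of these local models. -/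

import Mathlib

open Set Topology
open scoped Affine Pointwise ContDiff Manifold

noncomputable section

namespace Quadrilaterals

/-! ### Analytic functions on quotients, local models, analytic surfaces -/

section Surfaces

variable {K : Type*} [RCLike K]

/-- Let `q : D → X` be a map from a set `D` (open, in the uses below) in a normed space `E`.  A
function `F` on `X` is analytic at `x`, for the structure that `X` inherits from `D` as a quotient,
when `F ∘ q` is analytic at all the points of `D` over `x`.  (The values of the extension of
`F ∘ q` outside of the open set `D` do not matter.) -/
def DescendsAnalyticAt {E X : Type*} [NormedAddCommGroup E] [NormedSpace K E] {D : Set E}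
    (q : D → X) (F : X → K) (x : X) : Prop :=
  ∀ p : D, q p = x → AnalyticAt K (Function.extend Subtype.val (F ∘ q) 0) (p : E)

variable {X : Type*} [TopologicalSpace X]

/-- The space `X` carries a notion `An F x` of "the function `F` is `K`-analytic at `x`".
It is locally at `x` the quotient `K² / G`, where the group `G` acts linearly on `K²`: there are a
`G`-invariant open neighbourhood `V` of `0` in `K²` and a continuous open map `ψ : V → X` with
`ψ 0 = x` that induces a bijection of `V / G` with the (open) image of `ψ`, such that the analytic
functions on the image are those whose pull-back to `V` is analytic. -/
def HasLocalModel (An : (X → K) → X → Prop) (G : Subgroup ((K × K) ≃ₗ[K] (K × K))) (x : X) :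
    Prop :=
  ∃ (V : Set (K × K)) (ψ : K × K → X),
    IsOpen V ∧ (0 : K × K) ∈ V ∧ (∀ g ∈ G, ∀ v ∈ V, g v ∈ V) ∧
    ContinuousOn ψ V ∧ (∀ W ⊆ V, IsOpen W → IsOpen (ψ '' W)) ∧
    ψ 0 = x ∧
    (∀ v ∈ V, ∀ w ∈ V, ψ v = ψ w ↔ ∃ g ∈ G, g v = w) ∧
    (∀ F : X → K, ∀ v ∈ V, An F (ψ v) ↔ AnalyticAt K (F ∘ ψ) v)

/-- A `K`-analytic surface, quotient singularities being allowed: a Hausdorff second countable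
space which is locally the quotient of `K²` by a finite linear group. -/
def IsAnalyticSurface (An : (X → K) → X → Prop) : Prop :=
  T2Space X ∧ SecondCountableTopology X ∧
    ∀ x : X, ∃ G : Subgroup ((K × K) ≃ₗ[K] (K × K)), Finite G ∧ HasLocalModel An G x

/-- A point is singular when no neighbourhood of it is analytically isomorphic to an open subset
of `K²`. -/
def IsSingularPoint (An : (X → K) → X → Prop) (x : X) : Prop :=
  ¬ HasLocalModel An ⊥ x

variable (K)

/-- The group `ℤ₂` acting on `K²` by the reflection `(x, y) ↦ (y, x)`. -/
def reflectionGroup : Subgroup ((K × K) ≃ₗ[K] (K × K)) :=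
  Subgroup.zpowers (LinearEquiv.prodComm K K K)

/-- The group `Sym(3)` acting on `K²` by the linear symmetries of the triangle with vertices
`(1, 0)`, `(0, 1)`, `(-1, -1)`, whose center is the origin. -/
def triangleGroup : Subgroup ((K × K) ≃ₗ[K] (K × K)) :=
  MulAction.stabilizer ((K × K) ≃ₗ[K] (K × K)) ({(1, 0), (0, 1), (-1, -1)} : Set (K × K))

end Surfaces

section Moduli

variable (K : Type*) [RCLike K]

/-! ### Configurations and their affine classes -/

/-- The group of affine automorphisms of `K²`. -/
abbrev Aff := (K × K) ≃ᵃ[K] (K × K)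

/-- Ordered `n`-tuples of distinct points which differ by a permutation. -/
def permSetoid (n : ℕ) : Setoid {p : Fin n → K × K // Function.Injective p} where
  r p q := ∃ σ : Equiv.Perm (Fin n), q.1 = p.1 ∘ σ
  iseqv :=
    { refl := fun _ => ⟨1, rfl⟩
      symm := by
        rintro p q ⟨σ, h⟩
        exact ⟨σ⁻¹, by rw [h]; ext i <;> simp⟩
      trans := by
        rintro p q r ⟨σ, h⟩ ⟨τ, h'⟩
        exact ⟨σ * τ, by rw [h', h]; rfl⟩ }

/-- The space of unordered configurations of `n` distinct points of `K²`. -/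
def Conf (n : ℕ) := Quotient (permSetoid K n)

instance (n : ℕ) : TopologicalSpace (Conf K n) :=
  inferInstanceAs (TopologicalSpace (Quotient (permSetoid K n)))

variable {K}

/-- The set of the points of a configuration. -/
def Conf.points {n : ℕ} : Conf K n → Set (K × K) :=
  Quotient.lift (fun p => range p.1) (by
    rintro p q ⟨σ, h⟩
    rw [h, σ.surjective.range_comp])

/-- No three of the points are collinear, and no two of the lines that join them are parallel. -/
def IsGeneric (S : Set (K × K)) : Prop :=
  (∀ a ∈ S, ∀ b ∈ S, ∀ c ∈ S, a ≠ b → a ≠ c → b ≠ c → ¬ Collinear K {a, b, c}) ∧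
  (∀ a ∈ S, ∀ b ∈ S, ∀ c ∈ S, ∀ d ∈ S, a ≠ b → a ≠ c → a ≠ d → b ≠ c → b ≠ d → c ≠ d →
    ¬ line[K, a, b] ∥ line[K, c, d])

variable (K)

/-- The space `𝒬` of generic quadrilateral configurations, a subspace of `Conf K 4`. -/
abbrev GenericConf := {P : Conf K 4 // IsGeneric P.points}

/-- Affine equivalence of generic quadrilateral configurations. -/
def affSetoid : Setoid (GenericConf K) where
  r P P' := ∃ T : Aff K, T '' P.1.points = P'.1.points
  iseqv :=
    { refl := fun P => ⟨AffineEquiv.refl K (K × K), by simp⟩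
      symm := by
        rintro P P' ⟨T, h⟩
        exact ⟨T.symm, by rw [← h, image_image]; simp⟩
      trans := by
        rintro P P' P'' ⟨T, h⟩ ⟨T', h'⟩
        exact ⟨T.trans T', by rw [← h', ← h, image_image]; simp⟩ }

/-- The quotient `𝒬 / Aff(K²)`, with the quotient topology. -/
def Moduli := Quotient (affSetoid K)

instance : TopologicalSpace (Moduli K) :=
  inferInstanceAs (TopologicalSpace (Quotient (affSetoid K)))

variable {K}

/-- The projection `𝒬 → 𝒬 / Aff(K²)`. -/
def Moduli.proj (P : GenericConf K) : Moduli K := Quotient.mk (affSetoid K) P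

variable (K)

/-- The set of ordered generic quadruples, an open subset of `(K²)⁴`. -/
def orderedGeneric : Set (Fin 4 → K × K) :=
  {p | Function.Injective p ∧ IsGeneric (range p)}

variable {K}

/-- The affine class of an ordered generic quadruple. -/
def Moduli.ofOrdered (p : orderedGeneric K) : Moduli K :=
  Moduli.proj ⟨Quotient.mk (permSetoid K 4) ⟨p.1, p.2.1⟩, p.2.2⟩

/-- The analytic functions on `𝒬 / Aff(K²)`: those whose pull-back to the ordered quadruples is
analytic. -/
def Moduli.IsAnalyticFunAt (F : Moduli K → K) (z : Moduli K) : Prop :=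
  DescendsAnalyticAt (Moduli.ofOrdered (K := K)) F z

/-! ### The normal form with an equilateral triangle -/

variable (K)

/-- The square root of three, in `K`. -/
def sqrtThree : K := ((Real.sqrt 3 : ℝ) : K)

lemma sqrtThree_ne_zero : sqrtThree K ≠ 0 := by
  simp [sqrtThree]

/-- The vertices `(0, 0)`, `(1, 0)`, `(1/2, √3/2)` of the equilateral triangle `Δ`. -/
def vertex : Fin 3 → K × K := ![(0, 0), (1, 0), (1 / 2, sqrtThree K / 2)]

/-- The linear map which sends the triangle `(0, 0)`, `(1, 0)`, `(0, 1)` to `Δ`, in this order. -/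
def toEquilateral : (K × K) ≃ₗ[K] (K × K) where
  toFun v := (v.1 + v.2 / 2, sqrtThree K / 2 * v.2)
  invFun w := (w.1 - w.2 / sqrtThree K, 2 * w.2 / sqrtThree K)
  map_add' v w := by
    ext <;> simp <;> ring
  map_smul' c v := by
    ext <;> simp <;> ring
  left_inv v := by
    have := sqrtThree_ne_zero K
    ext
    · simp; field_simp; ring
    · simp; field_simp
  right_inv w := by
    have := sqrtThree_ne_zero K
    ext
    · simp; field_simp; ring
    · simp; field_simp

/-- The arrangement of the three lines that support the sides of the triangle `(0, 0)`, `(1, 0)`,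
`(0, 1)` and of their parallels through the opposite vertices. -/
def sixLines : Set (K × K) :=
  {v | v.1 * v.2 * (v.1 + v.2 - 1) * (v.1 + v.2) * (v.1 - 1) * (v.2 - 1) = 0}

/-- The corresponding arrangement of six lines for the triangle `Δ`. -/
def arrangement : Set (K × K) := toEquilateral K '' sixLines K

variable {K}

/-- The three involutions `g(V_j, ·)` for the triangle `V₀ = (0, 0)`, `V₁ = (1, 0)`,
`V₂ = (0, 1)`. On a line through `V_j`, with the coordinate which is `1` at `V_j` and `0` on the
opposite side of the triangle, `g(V_j, ·)` is `t ↦ 1 / t`. -/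
def gaugeStd (j : Fin 3) (v : K × K) : K × K :=
  ![(-v.1 / (1 - v.1 - v.2), -v.2 / (1 - v.1 - v.2)),
    (1 / v.1, -v.2 / v.1),
    (-v.1 / v.2, 1 / v.2)] j

/-- The corresponding involutions for the triangle `Δ`. -/
def gauge (j : Fin 3) (v : K × K) : K × K :=
  toEquilateral K (gaugeStd j ((toEquilateral K).symm v))

/-- The map `f` is given on `D` by rational functions without poles in `D`. -/
def IsRationalOn (D : Set (K × K)) (f : D → K × K) : Prop :=
  ∃ a b c : MvPolynomial (Fin 2) K, ∀ v : D,
    MvPolynomial.eval ![v.1.1, v.1.2] c ≠ 0 ∧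
    f v = (MvPolynomial.eval ![v.1.1, v.1.2] a / MvPolynomial.eval ![v.1.1, v.1.2] c,
           MvPolynomial.eval ![v.1.1, v.1.2] b / MvPolynomial.eval ![v.1.1, v.1.2] c)

/-- The equivalence relation of being in the same orbit, for an action of `Sym(4)` by
homeomorphisms. -/
def orbitSetoid {Y : Type*} [TopologicalSpace Y] (ρ : Equiv.Perm (Fin 4) →* (Y ≃ₜ Y)) :
    Setoid Y where
  r x y := ∃ σ, ρ σ x = y
  iseqv :=
    { refl := fun x => ⟨1, by simp⟩
      symm := by
        rintro x y ⟨σ, rfl⟩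
        exact ⟨σ⁻¹, by rw [← Homeomorph.mul_apply, ← map_mul]; simp⟩
      trans := by
        rintro x y z ⟨σ, rfl⟩ ⟨τ, rfl⟩
        exact ⟨τ * σ, by rw [map_mul, Homeomorph.mul_apply]⟩ }

/-- The representation `ρ` of `Sym(4)` on `K² \ A` (the indices `0`, `1`, `2` are those of the
vertices of `Δ`, the index `3` is that of the fourth point) is the one in which the
permutations of the vertices act by the affine symmetries of `Δ`, and the transposition of a vertex
and the fourth point acts by the involution `g(V_j, ·)`. -/
def IsGaugeAction
    (ρ : Equiv.Perm (Fin 4) →* (((arrangement K)ᶜ : Set (K × K)) ≃ₜ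
      ((arrangement K)ᶜ : Set (K × K)))) : Prop :=
  (∀ (σ : Equiv.Perm (Fin 4)) (τ : Equiv.Perm (Fin 3)),
    (∀ i : Fin 3, σ i.castSucc = (τ i).castSucc) →
      ∃ T : Aff K, (∀ i, T (vertex K i) = vertex K (τ i)) ∧
        ∀ v, (ρ σ v : K × K) = T v) ∧
  (∀ (j : Fin 3) v, (ρ (Equiv.swap j.castSucc (Fin.last 3)) v : K × K) = gauge j v)

/-! ### Convexity -/

/-- The classes of the convex quadrilateral configurations: no point is in the convex hull of the
others. -/
def convexClasses : Set (Moduli ℝ) :=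
  Moduli.proj '' {P | ConvexIndependent ℝ ((↑) : P.1.points → ℝ × ℝ)}

/-- The classes of the non-convex quadrilateral configurations. -/
def nonConvexClasses : Set (Moduli ℝ) :=
  Moduli.proj '' {P | ¬ ConvexIndependent ℝ ((↑) : P.1.points → ℝ × ℝ)}

end Moduli

end Quadrilaterals

end

/-!
# Moduli of generic quadrilateral configurations

The four signed areas `weights p` of an ordered quadruple `p`, that is, the coefficients of its
affine dependency, are multiplied by a common factor under affine maps, and determine the quadruple
up to such maps. Permuting the points permutes the weights, up to sign. The quadruple is generic
when no weight and no sum of two weights is zero; as the sum of all the weights is zero, this says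
that `∏ w i` and `∑ w i ^ 3` do not vanish. So the moduli space is the quotient by `Sym(4)` of an open
part of the projective plane of the lines in `{w | ∑ w i = 0}` (`ofWeights_eq_iff`). The normal form
with the triangle `Δ` is an affine chart of this projective plane (`normalChart`) which contains the
whole generic part, and this gives the homeomorphism with `(K² \ A) / Sym(4)`; the action is
by permutations of the weights, hence rational.

*Local models.* The factor `(∑ w i ^ 3) / ∏ w i` normalizes the weights so that the two symmetric
functions agree, and the normalized weights are well defined up to permutation. Hence a permutation
that fixes the line of `w` fixes `w`, and the isotropy groups of the action on the projective plane
are the groups of the permutations that preserve `w`. Two disjoint pairs of equal weights would be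
opposite to each other, which is excluded; so the weights are distinct, or exactly two are
equal, or exactly three are, with isotropy group trivial, generated by a reflection, or `Sym(3)`
(`hasLocalModel_trichotomy`).

*Invariants.* The sum of squares `a` and the product `b` of the normalized weights are the
coefficients of the quartic polynomial `X ^ 4 - (a / 2) X ^ 2 - (b / 3) X + b` whose roots are the
normalized weights. So they embed the moduli space in `K²` (`isEmbedding_invariants`), which is
therefore Hausdorff. Over the real numbers, the sign of `b` distinguishes the convex classes from
the others, and each of the two parts is the image of a convex set of weights.

*Complex numbers.* The image of the embedding is the set of all `(a, b)` with `b ≠ 0`, an open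
connected set. A function on the moduli space is analytic exactly when it is a holomorphic function
of `(a, b)` (`isAnalyticFunAt_iff_invariants`): off the discriminant curve the roots are holomorphic
functions of the coefficients, and a continuous function which is holomorphic off this curve is
holomorphic, by Cauchy's formula in each of the variables, because the curve meets the lines
parallel to the axes in finite sets (`analyticAt_of_differentiable_off_countable`).

*Real singular points.* If the local group contains a reflection, the point is singular
(`isSingularPoint_of_hasLocalModel`). An invariant nonnegative quadratic form `Q` on `ℝ²`, positive
on the direction which the reflection reverses, would be an analytic function in a smooth chart,
with a minimum, hence a critical point, at the center. The coordinates of the smooth chart are analytic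
functions on the local model, even along this direction, so `Q` would vanish there to the fourth
order.
-/

noncomputable section

namespace Quadrilaterals

/-! ### Weights of ordered quadruples -/

section Weights

variable {K : Type*} [RCLike K]

/-- Twice the signed area of the triangle `a`, `b`, `c`. -/
def cross (a b c : K × K) : K := (b.1 - a.1) * (c.2 - a.2) - (b.2 - a.2) * (c.1 - a.1)

/-- The signed areas of the four triangles in a quadruple `p`: the coefficients `w` of the affine
dependency `∑ w i = 0`, `∑ w i • p i = 0`, with a choice of scale. -/
def weights (p : Fin 4 → K × K) : Fin 4 → K :=
  ![cross (p 1) (p 2) (p 3), -cross (p 0) (p 2) (p 3), cross (p 0) (p 1) (p 3),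
    -cross (p 0) (p 1) (p 2)]

variable (K) in
/-- The weights of the generic quadruples. The conditions are written with symmetric functions, so
that they are visibly invariant under permutations; see `mem_genericWeights_iff`. -/
def genericWeights : Set (Fin 4 → K) :=
  {w | ∑ i, w i = 0 ∧ ∑ i, w i ^ 3 ≠ 0 ∧ ∏ i, w i ≠ 0}

lemma sum_weights (p : Fin 4 → K × K) : ∑ i, weights p i = 0 := by
  simp [Fin.sum_univ_four, weights, cross]; ring

/-- For weights with sum zero, the sum of the cubes vanishes exactly when two weights are opposite to
each other. -/
lemma sum_cube_eq {w : Fin 4 → K} (h : ∑ i, w i = 0) :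
    ∑ i, w i ^ 3 = 3 * ((w 0 + w 1) * (w 0 + w 2) * (w 0 + w 3)) := by
  rw [Fin.sum_univ_four] at h ⊢
  have h3 : w 3 = -(w 0 + w 1 + w 2) := by linear_combination h
  rw [h3]; ring

lemma mem_genericWeights_iff {w : Fin 4 → K} (h : ∑ i, w i = 0) :
    w ∈ genericWeights K ↔ (∀ i, w i ≠ 0) ∧ ∀ i j, i ≠ j → w i + w j ≠ 0 := by
  have hs := h
  rw [Fin.sum_univ_four] at hs
  rw [genericWeights, mem_ofPred_eq, sum_cube_eq h]
  simp only [h, true_and, Finset.prod_ne_zero_iff, Finset.mem_univ, true_imp_iff, mul_ne_zero_iff]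
  rw [and_comm]
  refine and_congr_right fun _ => ⟨?_, fun H => ⟨three_ne_zero, ⟨H _ _ (by decide),
    H _ _ (by decide)⟩, H _ _ (by decide)⟩⟩
  rintro ⟨-, ⟨h1, h2⟩, h3⟩
  have h23 : w 2 + w 3 ≠ 0 := fun e => h1 (by linear_combination hs - e)
  have h13 : w 1 + w 3 ≠ 0 := fun e => h2 (by linear_combination hs - e)
  have h12 : w 1 + w 2 ≠ 0 := fun e => h3 (by linear_combination hs - e)
  intro i j hij
  fin_cases i <;> fin_cases j <;>
    first | exact absurd rfl hij | assumption | (rw [add_comm]; assumption)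

lemma ne_zero_of_mem {w : Fin 4 → K} (h : w ∈ genericWeights K) (i : Fin 4) : w i ≠ 0 :=
  ((mem_genericWeights_iff h.1).1 h).1 i

lemma genericWeights_comp {w : Fin 4 → K} (σ : Equiv.Perm (Fin 4)) :
    w ∘ σ ∈ genericWeights K ↔ w ∈ genericWeights K := by
  simp only [genericWeights, mem_ofPred_eq, Function.comp_apply]
  rw [Equiv.sum_comp σ w, Equiv.sum_comp σ (fun i => w i ^ 3), Equiv.prod_comp σ w]

lemma genericWeights_smul {w : Fin 4 → K} {c : K} (hc : c ≠ 0) :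
    c • w ∈ genericWeights K ↔ w ∈ genericWeights K := by
  simp only [genericWeights, mem_ofPred_eq, Pi.smul_apply, smul_eq_mul, mul_pow, ← Finset.mul_sum,
    Finset.prod_mul_distrib, Finset.prod_const]
  simp [hc]

/-- Permuting the points permutes the weights, up to the sign of the permutation. -/
lemma weights_comp (σ : Equiv.Perm (Fin 4)) :
    ∃ ε : K, ε ≠ 0 ∧ ∀ p : Fin 4 → K × K, weights (p ∘ σ) = ε • (weights p ∘ σ) := by
  induction σ using Equiv.Perm.swap_induction_on with
  | one => exact ⟨1, one_ne_zero, fun p => by simp⟩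
  | swap_mul f x y hxy ih =>
    obtain ⟨ε, hε, ih⟩ := ih
    refine ⟨-ε, neg_ne_zero.2 hε, fun p => ?_⟩
    have key : weights (p ∘ Equiv.swap x y) = -(weights p ∘ Equiv.swap x y) := by
      clear ih
      fin_cases x <;> fin_cases y <;> first | exact absurd rfl hxy | skip
      all_goals
        funext i
        fin_cases i <;> simp [weights, cross, Equiv.swap_apply_def] <;> ring
    have : p ∘ ⇑(Equiv.swap x y * f) = (p ∘ Equiv.swap x y) ∘ f := rfl
    rw [this, ih, key]
    ext i; simp

/-- An affine map multiplies the weights by its determinant. -/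
lemma weights_affine (T : Aff K) : ∃ d : K, d ≠ 0 ∧ ∀ p : Fin 4 → K × K,
    weights (T ∘ p) = d • weights p := by
  set e1 := T.linear (1, 0) with he1
  set e2 := T.linear (0, 1) with he2
  obtain ⟨t, hT⟩ : ∃ t : K × K, ∀ v : K × K, T v = (v.1 * e1.1 + v.2 * e2.1 + t.1,
      v.1 * e1.2 + v.2 * e2.2 + t.2) := by
    refine ⟨T 0, fun v => ?_⟩
    have h1 : T v = T.linear v + T 0 := by
      have := T.map_vadd 0 v
      simpa using this
    have h2 : T.linear v = v.1 • e1 + v.2 • e2 := by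
      rw [he1, he2, ← map_smul, ← map_smul, ← map_add]; simp
    rw [h1, h2]; ext <;> simp
  refine ⟨e1.1 * e2.2 - e1.2 * e2.1, ?_, fun p => ?_⟩
  · intro h
    have hinj := T.linear.injective
    have k1 : T.linear (e2.2, -e1.2) = 0 := by
      have : ((e2.2, -e1.2) : K × K) = e2.2 • (1, 0) + (-e1.2) • (0, 1) := by ext <;> simp
      rw [this, map_add, map_smul, map_smul, ← he1, ← he2]
      ext
      · simp; linear_combination h
      · simp; ring
    have k2 : T.linear (e2.1, -e1.1) = 0 := by
      have : ((e2.1, -e1.1) : K × K) = e2.1 • (1, 0) + (-e1.1) • (0, 1) := by ext <;> simp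
      rw [this, map_add, map_smul, map_smul, ← he1, ← he2]
      ext
      · simp; ring
      · simp; linear_combination -h
    rw [map_eq_zero_iff _ hinj] at k1 k2
    simp only [Prod.mk_eq_zero, neg_eq_zero] at k1 k2
    have : e1 = 0 := Prod.ext k2.2 k1.2
    rw [he1, map_eq_zero_iff _ hinj] at this
    simp at this
  · funext i
    fin_cases i <;> simp [weights, cross, hT] <;> ring

lemma collinear_iff_cross (a b c : K × K) : Collinear K {a, b, c} ↔ cross a b c = 0 := by
  rw [collinear_iff_of_mem (p₀ := a) (by simp)]
  constructor
  · rintro ⟨v, h⟩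
    obtain ⟨r, hr⟩ := h b (by simp)
    obtain ⟨s, hs⟩ := h c (by simp)
    rw [hr, hs]; simp [cross]; ring
  · intro h
    rw [cross] at h
    by_cases h1 : b.1 - a.1 = 0
    · by_cases h2 : b.2 - a.2 = 0
      · have hb : b = a := Prod.ext (by linear_combination h1) (by linear_combination h2)
        refine ⟨c - a, ?_⟩
        simp only [mem_insert_iff, mem_singleton_iff, forall_eq_or_imp, forall_eq]
        exact ⟨⟨0, by simp⟩, ⟨0, by simp [hb]⟩, ⟨1, by simp⟩⟩
      · refine ⟨b - a, ?_⟩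
        simp only [mem_insert_iff, mem_singleton_iff, forall_eq_or_imp, forall_eq]
        refine ⟨⟨0, by simp⟩, ⟨1, by simp⟩, ⟨(c.2 - a.2) / (b.2 - a.2), ?_⟩⟩
        ext
        · simp; field_simp; linear_combination -h
        · simp; field_simp; ring
    · refine ⟨b - a, ?_⟩
      simp only [mem_insert_iff, mem_singleton_iff, forall_eq_or_imp, forall_eq]
      refine ⟨⟨0, by simp⟩, ⟨1, by simp⟩, ⟨(c.1 - a.1) / (b.1 - a.1), ?_⟩⟩
      ext
      · simp; field_simp; ring
      · simp; field_simp; linear_combination h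

lemma parallel_iff_cross {a b c d : K × K} (hab : a ≠ b) (hcd : c ≠ d) :
    line[K, a, b] ∥ line[K, c, d] ↔
      (b.1 - a.1) * (d.2 - c.2) - (b.2 - a.2) * (d.1 - c.1) = 0 := by
  rw [AffineSubspace.affineSpan_pair_parallel_iff_vectorSpan_eq, vectorSpan_pair_rev,
    vectorSpan_pair_rev, Submodule.span_singleton_eq_span_singleton]
  constructor
  · rintro ⟨z, hz⟩
    have h1 := congrArg Prod.fst hz
    have h2 := congrArg Prod.snd hz
    simp [Units.smul_def] at h1 h2
    rw [← h1, ← h2]; ring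
  · intro h
    by_cases h1 : b.1 - a.1 = 0
    · have h2 : b.2 - a.2 ≠ 0 := fun h2 =>
        hab (Prod.ext (by linear_combination -h1) (by linear_combination -h2))
      have h3 : d.1 - c.1 = 0 := by
        rw [h1] at h; simpa [h2] using h
      have h4 : d.2 - c.2 ≠ 0 := fun h4 =>
        hcd (Prod.ext (by linear_combination -h3) (by linear_combination -h4))
      refine ⟨Units.mk0 ((d.2 - c.2) / (b.2 - a.2)) (div_ne_zero h4 h2), ?_⟩
      ext
      · simp [Units.smul_def, h1, h3]
      · simp [Units.smul_def]; field_simp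
    · have h3 : d.1 - c.1 ≠ 0 := by
        intro h3
        have h4 : d.2 - c.2 = 0 := by
          rw [h3] at h; simpa [h1] using h
        exact hcd (Prod.ext (by linear_combination -h3) (by linear_combination -h4))
      refine ⟨Units.mk0 ((d.1 - c.1) / (b.1 - a.1)) (div_ne_zero h3 h1), ?_⟩
      ext
      · simp [Units.smul_def]; field_simp
      · simp [Units.smul_def]; field_simp; linear_combination -h

lemma cross_ne_zero_iff (p : Fin 4 → K × K) (i j k l : Fin 4) (hij : i ≠ j) (hik : i ≠ k)
    (hil : i ≠ l) (hjk : j ≠ k) (hjl : j ≠ l) (hkl : k ≠ l) :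
    cross (p i) (p j) (p k) = 0 ↔ weights p l = 0 := by
  have key : cross (p i) (p j) (p k) = weights p l ∨ cross (p i) (p j) (p k) = -weights p l := by
    fin_cases i <;> fin_cases j <;> first | exact absurd rfl hij | skip
    all_goals fin_cases k <;> first | exact absurd rfl hik | exact absurd rfl hjk | skip
    all_goals
      fin_cases l <;>
        first | exact absurd rfl hil | exact absurd rfl hjl | exact absurd rfl hkl | skip
    all_goals
      simp only [weights, cross, Fin.mk_zero, Fin.mk_one, Fin.reduceFinMk, Fin.isValue,
        Matrix.cons_val]
      first | (left; trivial) | (left; ring1) | (right; ring1)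
  rcases key with h | h <;> simp [h]

lemma parallel_expr_iff (p : Fin 4 → K × K) (i j k l : Fin 4) (hij : i ≠ j) (hik : i ≠ k)
    (hil : i ≠ l) (hjk : j ≠ k) (hjl : j ≠ l) (hkl : k ≠ l) :
    ((p j).1 - (p i).1) * ((p l).2 - (p k).2) - ((p j).2 - (p i).2) * ((p l).1 - (p k).1) = 0 ↔
      weights p i + weights p j = 0 := by
  have key : ∀ x y : K, x = y ∨ x = - y → (x = 0 ↔ y = 0) := by
    rintro x y (h | h) <;> simp [h]
  apply key
  fin_cases i <;> fin_cases j <;> first | exact absurd rfl hij | skip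
  all_goals fin_cases k <;> first | exact absurd rfl hik | exact absurd rfl hjk | skip
  all_goals
    fin_cases l <;>
      first | exact absurd rfl hil | exact absurd rfl hjl | exact absurd rfl hkl | skip
  all_goals
    simp only [weights, cross, Fin.mk_zero, Fin.mk_one, Fin.reduceFinMk, Fin.isValue,
      Matrix.cons_val]
    first | (left; ring1) | (right; ring1)

lemma exists_other (i j : Fin 4) : ∃ k, i ≠ k ∧ j ≠ k := by
  revert i j; decide

lemma exists_fourth (i j k : Fin 4) : ∃ l, i ≠ l ∧ j ≠ l ∧ k ≠ l := by
  revert i j k; decide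

/-- A quadruple is generic exactly when its weights are. -/
lemma mem_orderedGeneric_iff (p : Fin 4 → K × K) :
    p ∈ orderedGeneric K ↔ weights p ∈ genericWeights K := by
  rw [mem_genericWeights_iff (sum_weights p)]
  constructor
  · rintro ⟨hinj, hc, hp⟩
    constructor
    · have : ∀ i j k l : Fin 4, i ≠ j → i ≠ k → i ≠ l → j ≠ k → j ≠ l → k ≠ l →
          weights p l ≠ 0 := by
        intro i j k l hij hik hil hjk hjl hkl h
        rw [← cross_ne_zero_iff p i j k l hij hik hil hjk hjl hkl, ← collinear_iff_cross] at h
        exact hc _ ⟨i, rfl⟩ _ ⟨j, rfl⟩ _ ⟨k, rfl⟩ (hinj.ne hij) (hinj.ne hik) (hinj.ne hjk) h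
      intro l
      fin_cases l
      exacts [this 1 2 3 0 (by decide) (by decide) (by decide) (by decide) (by decide) (by decide),
        this 0 2 3 1 (by decide) (by decide) (by decide) (by decide) (by decide) (by decide),
        this 0 1 3 2 (by decide) (by decide) (by decide) (by decide) (by decide) (by decide),
        this 0 1 2 3 (by decide) (by decide) (by decide) (by decide) (by decide) (by decide)]
    · intro i j hij h
      obtain ⟨k, hik, hjk⟩ := exists_other i j
      obtain ⟨l, hil, hjl, hkl⟩ := exists_fourth i j k
      rw [← parallel_expr_iff p i j k l hij hik hil hjk hjl hkl,
        ← parallel_iff_cross (hinj.ne hij) (hinj.ne hkl)] at h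
      exact hp _ ⟨i, rfl⟩ _ ⟨j, rfl⟩ _ ⟨k, rfl⟩ _ ⟨l, rfl⟩ (hinj.ne hij) (hinj.ne hik)
        (hinj.ne hil) (hinj.ne hjk) (hinj.ne hjl) (hinj.ne hkl) h
  · rintro ⟨h1, h2⟩
    have hinj : Function.Injective p := by
      intro i j h
      by_contra hij
      obtain ⟨k, hik, hjk⟩ := exists_other i j
      obtain ⟨l, hil, hjl, hkl⟩ := exists_fourth i j k
      refine h1 l ((cross_ne_zero_iff p i j k l hij hik hil hjk hjl hkl).1 ?_)
      rw [h, cross]; ring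
    refine ⟨hinj, ?_, ?_⟩
    · rintro _ ⟨i, rfl⟩ _ ⟨j, rfl⟩ _ ⟨k, rfl⟩ hij hik hjk
      rw [collinear_iff_cross]
      rw [hinj.ne_iff] at hij hik hjk
      obtain ⟨l, hil, hjl, hkl⟩ := exists_fourth i j k
      rw [cross_ne_zero_iff p i j k l hij hik hil hjk hjl hkl]
      exact h1 l
    · rintro _ ⟨i, rfl⟩ _ ⟨j, rfl⟩ _ ⟨k, rfl⟩ _ ⟨l, rfl⟩ hij hik hil hjk hjl hkl
      rw [parallel_iff_cross hij hkl]
      rw [hinj.ne_iff] at hij hik hil hjk hjl hkl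
      rw [parallel_expr_iff p i j k l hij hik hil hjk hjl hkl]
      exact h2 i j hij

end Weights

/-! ### Affine classes and weights -/

section Classes

variable {K : Type*} [RCLike K]

/-- The quadruple formed by the vertices of the equilateral triangle and the point `v`. -/
def normalForm (v : K × K) : Fin 4 → K × K := ![vertex K 0, vertex K 1, vertex K 2, v]

/-- The fourth point of the quadruple in normal form with weights proportional to `w`. -/
def fourthPoint (w : Fin 4 → K) : K × K :=
  (-(w 1 + w 2 / 2) / w 3, -(sqrtThree K / 2 * w 2) / w 3)

lemma toEquilateral_symm_apply (v : K × K) : (toEquilateral K).symm v =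
    (v.1 - v.2 / sqrtThree K, 2 * v.2 / sqrtThree K) := rfl

lemma weights_normalForm (v : K × K) : weights (normalForm v) =
    (sqrtThree K / 2) • ![1 - ((toEquilateral K).symm v).1 - ((toEquilateral K).symm v).2,
      ((toEquilateral K).symm v).1, ((toEquilateral K).symm v).2, -1] := by
  have := sqrtThree_ne_zero K
  funext i
  fin_cases i <;>
    simp [weights, cross, normalForm, vertex, toEquilateral_symm_apply] <;>
    field_simp <;> ring

lemma sqrtThree_half_ne_zero : sqrtThree K / 2 ≠ 0 :=
  div_ne_zero (sqrtThree_ne_zero K) two_ne_zero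

lemma weights_normalForm_fourthPoint {w : Fin 4 → K} (h : ∑ i, w i = 0) (h3 : w 3 ≠ 0) :
    weights (normalForm (fourthPoint w)) = (-(sqrtThree K / 2) / w 3) • w := by
  have := sqrtThree_ne_zero K
  have h0 : w 0 = -(w 1 + w 2 + w 3) := by
    rw [Fin.sum_univ_four] at h; linear_combination h
  funext i
  fin_cases i
  · simp [weights, cross, normalForm, fourthPoint, vertex, h0]; field_simp; ring
  all_goals simp [weights, cross, normalForm, fourthPoint, vertex]; try field_simp; try ring

lemma fourthPoint_weights (v : K × K) : fourthPoint (weights (normalForm v)) = v := by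
  have := sqrtThree_ne_zero K
  ext <;> simp [weights, cross, normalForm, fourthPoint, vertex] <;> field_simp <;> ring

lemma fourthPoint_smul {c : K} (hc : c ≠ 0) (w : Fin 4 → K) :
    fourthPoint (c • w) = fourthPoint w := by
  ext
  · simp only [fourthPoint, Pi.smul_apply, smul_eq_mul]
    rw [show -(c * w 1 + c * w 2 / 2) = c * -(w 1 + w 2 / 2) by ring, mul_div_mul_left _ _ hc]
  · simp only [fourthPoint, Pi.smul_apply, smul_eq_mul]
    rw [show -(sqrtThree K / 2 * (c * w 2)) = c * -(sqrtThree K / 2 * w 2) by ring,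
      mul_div_mul_left _ _ hc]

lemma normalForm_fourthPoint_mem {w : Fin 4 → K} (h : w ∈ genericWeights K) :
    normalForm (fourthPoint w) ∈ orderedGeneric K := by
  have h3 := ne_zero_of_mem h 3
  rw [mem_orderedGeneric_iff, weights_normalForm_fourthPoint h.1 h3, genericWeights_smul]
  · exact h
  · exact div_ne_zero (neg_ne_zero.2 sqrtThree_half_ne_zero) h3

/-- The linear automorphism of `K²` with given columns. -/
def frame (u v : K × K) (h : u.1 * v.2 - u.2 * v.1 ≠ 0) : (K × K) ≃ₗ[K] (K × K) where
  toFun x := (x.1 * u.1 + x.2 * v.1, x.1 * u.2 + x.2 * v.2)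
  invFun y := ((y.1 * v.2 - y.2 * v.1) / (u.1 * v.2 - u.2 * v.1),
    (u.1 * y.2 - u.2 * y.1) / (u.1 * v.2 - u.2 * v.1))
  map_add' x y := by ext <;> simp <;> ring
  map_smul' c x := by ext <;> simp <;> ring
  left_inv x := by ext <;> simp only <;> rw [div_eq_iff h] <;> ring
  right_inv y := by
    ext <;> simp only <;> rw [div_mul_eq_mul_div, div_mul_eq_mul_div, ← add_div, div_eq_iff h] <;>
      ring

lemma exists_frame {p : Fin 4 → K × K} (h : weights p 3 ≠ 0) : ∃ A : Aff K,
    A (0, 0) = p 0 ∧ A (1, 0) = p 1 ∧ A (0, 1) = p 2 ∧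
      A (-weights p 1 / weights p 3, -weights p 2 / weights p 3) = p 3 := by
  have hd : (p 1 - p 0).1 * (p 2 - p 0).2 - (p 1 - p 0).2 * (p 2 - p 0).1 ≠ 0 := by
    intro h0; apply h
    simp only [weights, cross, Matrix.cons_val, Prod.fst_sub, Prod.snd_sub] at h0 ⊢
    linear_combination -h0
  refine ⟨(frame _ _ hd).toAffineEquiv.trans (AffineEquiv.constVAdd K (K × K) (p 0)), ?_⟩
  refine ⟨by ext <;> simp [frame], by ext <;> simp [frame], by ext <;> simp [frame], ?_⟩
  have h3 : weights p 3 = -cross (p 0) (p 1) (p 2) := rfl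
  rw [h3, neg_ne_zero] at h
  rw [h3]
  ext
  · simp [frame]; field_simp; simp only [weights, cross, Matrix.cons_val]; ring
  · simp [frame]; field_simp; simp only [weights, cross, Matrix.cons_val]; ring

/-- Quadruples with proportional weights are affinely equivalent. -/
lemma exists_affine {p p' : Fin 4 → K × K} {c : K} (hc : c ≠ 0) (h : weights p 3 ≠ 0)
    (hw : weights p' = c • weights p) : ∃ T : Aff K, T ∘ p = p' := by
  have h' : weights p' 3 ≠ 0 := by rw [hw]; exact mul_ne_zero hc h
  obtain ⟨A, a0, a1, a2, a3⟩ := exists_frame h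
  obtain ⟨B, b0, b1, b2, b3⟩ := exists_frame h'
  have key : ∀ i, -weights p' i / weights p' 3 = -weights p i / weights p 3 := by
    intro i
    rw [hw]; simp only [Pi.smul_apply, smul_eq_mul, ← mul_neg]
    rw [mul_div_mul_left _ _ hc]
  rw [key, key] at b3
  refine ⟨A.symm.trans B, ?_⟩
  funext i
  fin_cases i
  · simp [← a0, ← b0]
  · simp [← a1, ← b1]
  · simp [← a2, ← b2]
  · simp [← a3, ← b3]

lemma proj_eq_iff (P Q : GenericConf K) :
    Moduli.proj P = Moduli.proj Q ↔ ∃ T : Aff K, T '' P.1.points = Q.1.points :=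
  Quotient.eq (r := affSetoid K)

omit [RCLike K] in
lemma points_mk (p : {p : Fin 4 → K × K // Function.Injective p}) :
    Conf.points (Quotient.mk (permSetoid K 4) p) = range p.1 := rfl

lemma exists_perm_of_range_eq {α β : Type*} {p q : α → β} (hp : Function.Injective p)
    (hq : Function.Injective q) (h : range p = range q) : ∃ σ : Equiv.Perm α, q ∘ σ = p := by
  refine ⟨(Equiv.ofInjective p hp).trans ((Equiv.setCongr h).trans (Equiv.ofInjective q hq).symm),
    ?_⟩
  funext i
  simp only [Function.comp_apply, Equiv.trans_apply]
  rw [Equiv.apply_ofInjective_symm hq]; rfl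

/-- Two ordered quadruples have the same class exactly when their weights agree up to a factor and
a permutation. -/
lemma ofOrdered_eq_iff (p q : orderedGeneric K) : Moduli.ofOrdered p = Moduli.ofOrdered q ↔
    ∃ (σ : Equiv.Perm (Fin 4)) (c : K), c ≠ 0 ∧ weights q.1 = c • (weights p.1 ∘ σ) := by
  rw [Moduli.ofOrdered, Moduli.ofOrdered, proj_eq_iff]
  simp only [points_mk]
  constructor
  · rintro ⟨T, hT⟩
    rw [← range_comp] at hT
    obtain ⟨σ, hσ⟩ := exists_perm_of_range_eq q.2.1 (T.injective.comp p.2.1) hT.symm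
    obtain ⟨d, hd, hT⟩ := weights_affine T
    obtain ⟨ε, hε, he⟩ := weights_comp (K := K) σ
    refine ⟨σ, d * ε, mul_ne_zero hd hε, ?_⟩
    rw [← hσ, Function.comp_assoc, hT, he, smul_smul]
  · rintro ⟨σ, c, hc, h⟩
    obtain ⟨ε, hε, he⟩ := weights_comp (K := K) σ
    have h' : weights q.1 = (c * ε⁻¹) • weights (p.1 ∘ σ) := by
      rw [h, he, smul_smul, mul_assoc, inv_mul_cancel₀ hε, mul_one]
    have h3 : weights (p.1 ∘ σ) 3 ≠ 0 := by
      rw [he]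
      exact mul_ne_zero hε (ne_zero_of_mem ((mem_orderedGeneric_iff _).1 p.2) _)
    obtain ⟨T, hT⟩ := exists_affine (mul_ne_zero hc (inv_ne_zero hε)) h3 h'
    refine ⟨T, ?_⟩
    rw [← hT, range_comp T, σ.surjective.range_comp]

lemma one_mem_genericWeights : (![1, 1, 1, -3] : Fin 4 → K) ∈ genericWeights K := by
  refine ⟨?_, ?_, ?_⟩
  · simp [Fin.sum_univ_four]; norm_num
  · simp [Fin.sum_univ_four]; norm_num
  · simp [Fin.prod_univ_four]

open Classical in
/-- The affine class of the quadruples with given weights. (The value on vectors that are not the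
weights of a generic quadruple does not matter.) -/
def ofWeights (w : Fin 4 → K) : Moduli K :=
  if h : w ∈ genericWeights K then
    Moduli.ofOrdered ⟨normalForm (fourthPoint w), normalForm_fourthPoint_mem h⟩
  else Moduli.ofOrdered ⟨_, normalForm_fourthPoint_mem one_mem_genericWeights⟩

lemma ofWeights_weights (p : orderedGeneric K) : ofWeights (weights p.1) = Moduli.ofOrdered p := by
  have h := (mem_orderedGeneric_iff _).1 p.2
  have h3 := ne_zero_of_mem h 3
  rw [ofWeights, dif_pos h, ofOrdered_eq_iff]
  have hc : -(sqrtThree K / 2) / weights p.1 3 ≠ 0 :=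
    div_ne_zero (neg_ne_zero.2 sqrtThree_half_ne_zero) h3
  refine ⟨1, (-(sqrtThree K / 2) / weights p.1 3)⁻¹, inv_ne_zero hc, ?_⟩
  simp only [Equiv.Perm.coe_one, Function.comp_id]
  rw [weights_normalForm_fourthPoint h.1 h3, smul_smul, inv_mul_cancel₀ hc, one_smul]

lemma ofWeights_eq_iff {w w' : Fin 4 → K} (h : w ∈ genericWeights K) (h' : w' ∈ genericWeights K) :
    ofWeights w = ofWeights w' ↔
      ∃ (σ : Equiv.Perm (Fin 4)) (c : K), c ≠ 0 ∧ w' = c • (w ∘ σ) := by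
  have h3 := ne_zero_of_mem h 3
  have h3' := ne_zero_of_mem h' 3
  have hc : -(sqrtThree K / 2) / w 3 ≠ 0 :=
    div_ne_zero (neg_ne_zero.2 sqrtThree_half_ne_zero) h3
  have hc' : -(sqrtThree K / 2) / w' 3 ≠ 0 :=
    div_ne_zero (neg_ne_zero.2 sqrtThree_half_ne_zero) h3'
  rw [ofWeights, dif_pos h, ofWeights, dif_pos h', ofOrdered_eq_iff]
  simp only
  rw [weights_normalForm_fourthPoint h.1 h3, weights_normalForm_fourthPoint h'.1 h3']
  generalize -(sqrtThree K / 2) / w 3 = a at *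
  generalize -(sqrtThree K / 2) / w' 3 = b at *
  constructor
  · rintro ⟨σ, c, hc0, h⟩
    refine ⟨σ, b⁻¹ * c * a, by simp [*], ?_⟩
    have := congrArg (fun x => b⁻¹ • x) h
    simp only [smul_smul, inv_mul_cancel₀ hc', one_smul] at this
    rw [this]; ext i; simp; ring
  · rintro ⟨σ, c, hc0, h⟩
    refine ⟨σ, b * c * a⁻¹, by simp [*], ?_⟩
    rw [h]; ext i; simp; field_simp

lemma exists_weights (z : Moduli K) : ∃ w ∈ genericWeights K, ofWeights w = z := by
  obtain ⟨⟨P, hP⟩, rfl⟩ := Quotient.exists_rep z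
  obtain ⟨p, rfl⟩ := Quotient.exists_rep P
  exact ⟨_, (mem_orderedGeneric_iff _).1 ⟨p.2, hP⟩, ofWeights_weights ⟨p.1, p.2, hP⟩⟩

lemma ofWeights_smul_comp {w : Fin 4 → K} (h : w ∈ genericWeights K) {c : K} (hc : c ≠ 0)
    (σ : Equiv.Perm (Fin 4)) : ofWeights (c • (w ∘ σ)) = ofWeights w :=
  ((ofWeights_eq_iff h ((genericWeights_smul hc).2 ((genericWeights_comp σ).2 h))).2
    ⟨σ, c, hc, rfl⟩).symm

/-! ### The quotient topology -/

lemma continuous_weights : Continuous (weights : (Fin 4 → K × K) → Fin 4 → K) := by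
  refine continuous_pi fun i => ?_
  fin_cases i <;> simp only [weights, cross, Fin.reduceFinMk, Matrix.cons_val] <;> fun_prop

variable (K) in
lemma exists_open_genericWeights : ∃ O : Set (Fin 4 → K), IsOpen O ∧
    genericWeights K = {w | ∑ i, w i = 0} ∩ O := by
  refine ⟨{w | ∑ i, w i ^ 3 ≠ 0} ∩ {w | ∏ i, w i ≠ 0}, ?_, rfl⟩
  exact (isOpen_ne_fun (by fun_prop) continuous_const).inter
    (isOpen_ne_fun (by fun_prop) continuous_const)

lemma isOpen_orderedGeneric : IsOpen (orderedGeneric K) := by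
  obtain ⟨O, hO, h⟩ := exists_open_genericWeights K
  have : orderedGeneric K = weights ⁻¹' O := by
    ext p
    rw [mem_orderedGeneric_iff, h]
    simp [sum_weights]
  rw [this]
  exact hO.preimage continuous_weights

lemma continuous_ofOrdered : Continuous (Moduli.ofOrdered (K := K)) := by
  refine (continuous_quotient_mk' (s := affSetoid K)).comp (Continuous.subtype_mk ?_ _)
  exact (continuous_quotient_mk' (s := permSetoid K 4)).comp
    (continuous_subtype_val.subtype_mk _)

lemma isOpenQuotientMap_conf :
    IsOpenQuotientMap (Quotient.mk (permSetoid K 4) : _ → Conf K 4) := by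
  refine ⟨Quotient.mk_surjective, continuous_quotient_mk' (s := permSetoid K 4), fun W hW => ?_⟩
  refine isOpen_coinduced.2 ?_
  have : (Quotient.mk (permSetoid K 4)) ⁻¹' (Quotient.mk (permSetoid K 4) '' W) =
      ⋃ σ : Equiv.Perm (Fin 4), (fun p : {p : Fin 4 → K × K // Function.Injective p} =>
        (⟨p.1 ∘ σ, p.2.comp σ.injective⟩ : {p : Fin 4 → K × K // Function.Injective p})) ⁻¹' W := by
    ext p
    simp only [mem_preimage, mem_image, mem_iUnion]
    constructor
    · rintro ⟨q, hq, h⟩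
      obtain ⟨σ, hσ⟩ := Quotient.exact (s := permSetoid K 4) h.symm
      exact ⟨σ, by convert hq; exact hσ.symm⟩
    · rintro ⟨σ, h⟩
      exact ⟨_, h, (Quotient.sound (s := permSetoid K 4) ⟨σ, rfl⟩ : _).symm⟩
  change IsOpen (Quotient.mk (permSetoid K 4) ⁻¹' (Quotient.mk (permSetoid K 4) '' W))
  rw [this]
  refine isOpen_iUnion fun σ => hW.preimage ?_
  refine Continuous.subtype_mk ?_ _
  exact continuous_pi fun i => (continuous_apply (σ i)).comp continuous_subtype_val

lemma isOpen_of_preimage_ofOrdered {O : Set (Moduli K)} (h : IsOpen (Moduli.ofOrdered ⁻¹' O)) :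
    IsOpen O := by
  refine isOpen_coinduced.2 ?_
  have hq := (isOpenQuotientMap_conf (K := K)).restrictPreimage
    {P : Conf K 4 | IsGeneric P.points}
  refine hq.isQuotientMap.isOpen_preimage.1 ?_
  let f : (Quotient.mk (permSetoid K 4) ⁻¹' {P : Conf K 4 | IsGeneric P.points}) →
      orderedGeneric K := fun p => ⟨p.1.1, p.1.2, p.2⟩
  have hf : Continuous f :=
    (continuous_subtype_val.comp continuous_subtype_val).subtype_mk _
  exact h.preimage hf

lemma continuousOn_fourthPoint : ContinuousOn (fourthPoint (K := K)) (genericWeights K) := by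
  intro w hw
  have h3 := ne_zero_of_mem hw 3
  apply ContinuousAt.continuousWithinAt
  unfold fourthPoint
  fun_prop (disch := assumption)

lemma continuous_normalForm : Continuous (normalForm (K := K)) := by
  refine continuous_pi fun i => ?_
  fin_cases i <;> simp only [normalForm, Fin.reduceFinMk, Matrix.cons_val] <;> fun_prop

lemma continuousOn_ofWeights : ContinuousOn (ofWeights (K := K)) (genericWeights K) := by
  rw [continuousOn_iff_continuous_domRestrict]
  have : (genericWeights K).domRestrict ofWeights = fun w : genericWeights K =>
      Moduli.ofOrdered ⟨normalForm (fourthPoint w.1), normalForm_fourthPoint_mem w.2⟩ := by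
    funext w
    rw [domRestrict_apply, ofWeights, dif_pos w.2]
  rw [this]
  refine continuous_ofOrdered.comp (Continuous.subtype_mk ?_ _)
  exact continuous_normalForm.comp
    (continuousOn_iff_continuous_domRestrict.1 continuousOn_fourthPoint)

end Classes

/-! ### Affine charts on the space of weights -/

section Charts

variable {K : Type*} [RCLike K]

lemma extend_ofOrdered_eventuallyEq (F : Moduli K → K) {p : Fin 4 → K × K}
    (hp : p ∈ orderedGeneric K) :
    Function.extend Subtype.val (F ∘ Moduli.ofOrdered) 0 =ᶠ[𝓝 p]
      fun p => F (ofWeights (weights p)) := by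
  filter_upwards [isOpen_orderedGeneric.mem_nhds hp] with q hq
  have := Subtype.val_injective.extend_apply (F ∘ Moduli.ofOrdered) 0 (⟨q, hq⟩ : orderedGeneric K)
  rw [this, Function.comp_apply, ← ofWeights_weights]

lemma isAnalyticFunAt_iff (F : Moduli K → K) (z : Moduli K) :
    Moduli.IsAnalyticFunAt F z ↔ ∀ p ∈ orderedGeneric K, ofWeights (weights p) = z →
      AnalyticAt K (fun p => F (ofWeights (weights p))) p := by
  constructor
  · intro h p hp hz
    rw [← analyticAt_congr (extend_ofOrdered_eventuallyEq F hp)]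
    exact h ⟨p, hp⟩ (by rw [← ofWeights_weights, ← hz])
  · rintro h ⟨p, hp⟩ hz
    rw [analyticAt_congr (extend_ofOrdered_eventuallyEq F hp)]
    exact h p hp (by rw [← hz, ← ofWeights_weights])

lemma analyticAt_fourthPoint {w : Fin 4 → K} (h3 : w 3 ≠ 0) : AnalyticAt K fourthPoint w := by
  have hi : ∀ i, AnalyticAt K (fun w : Fin 4 → K => w i) w := fun i =>
    (ContinuousLinearMap.proj (R := K) (φ := fun _ : Fin 4 => K) i).analyticAt w
  exact ((((hi 1).add ((hi 2).div analyticAt_const two_ne_zero)).neg).div (hi 3) h3).prod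
    (((analyticAt_const.mul (hi 2)).neg).div (hi 3) h3)

lemma analyticAt_normalForm (v : K × K) : AnalyticAt K normalForm v := by
  rw [analyticAt_pi_iff]
  intro i
  fin_cases i
  exacts [analyticAt_const, analyticAt_const, analyticAt_const, analyticAt_id]

lemma analyticAt_weights (p : Fin 4 → K × K) : AnalyticAt K weights p := by
  have h1 : ∀ i, AnalyticAt K (fun p : Fin 4 → K × K => (p i).1) p := fun i =>
    ((ContinuousLinearMap.fst K K K).comp
      (ContinuousLinearMap.proj (R := K) (φ := fun _ : Fin 4 => K × K) i)).analyticAt p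
  have h2 : ∀ i, AnalyticAt K (fun p : Fin 4 → K × K => (p i).2) p := fun i =>
    ((ContinuousLinearMap.snd K K K).comp
      (ContinuousLinearMap.proj (R := K) (φ := fun _ : Fin 4 => K × K) i)).analyticAt p
  have hc : ∀ i j k, AnalyticAt K (fun p : Fin 4 → K × K => cross (p i) (p j) (p k)) p :=
    fun i j k => (((h1 j).sub (h1 i)).mul ((h2 k).sub (h2 i))).sub
      (((h2 j).sub (h2 i)).mul ((h1 k).sub (h1 i)))
  rw [analyticAt_pi_iff]
  intro i
  fin_cases i
  exacts [hc _ _ _, (hc _ _ _).neg, hc _ _ _, (hc _ _ _).neg]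

/-- Analytic functions on the moduli space are analytic along analytic families of weights. -/
lemma IsAnalyticFunAt.comp_ofWeights {E : Type*} [NormedAddCommGroup E] [NormedSpace K E]
    {F : Moduli K → K} {f : E → Fin 4 → K} {x : E} (hf : AnalyticAt K f x)
    (hx : f x ∈ genericWeights K) (hsum : ∀ᶠ y in 𝓝 x, ∑ i, f y i = 0)
    (h : Moduli.IsAnalyticFunAt F (ofWeights (f x))) :
    AnalyticAt K (fun y => F (ofWeights (f y))) x := by
  have hU : ∀ᶠ y in 𝓝 x, f y ∈ genericWeights K := by
    obtain ⟨O, hO, hOU⟩ := exists_open_genericWeights K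
    rw [hOU] at hx ⊢
    filter_upwards [hsum, hf.continuousAt.preimage_mem_nhds (hO.mem_nhds hx.2)] with y h1 h2
    exact ⟨h1, h2⟩
  have key : ∀ w ∈ genericWeights K,
      ofWeights (weights (normalForm (fourthPoint w))) = ofWeights w := by
    intro w hw
    rw [ofWeights_weights ⟨_, normalForm_fourthPoint_mem hw⟩]
    conv_rhs => rw [ofWeights, dif_pos hw]
  rw [isAnalyticFunAt_iff] at h
  have h1 := h _ (normalForm_fourthPoint_mem hx) (key _ hx)
  have h2 : AnalyticAt K (fun y => normalForm (fourthPoint (f y))) x :=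
    (analyticAt_normalForm _).comp
      ((analyticAt_fourthPoint (ne_zero_of_mem hx 3)).comp hf)
  refine (h1.comp_of_eq h2 rfl).congr ?_
  filter_upwards [hU] with y hy
  simp only [Function.comp_apply, key _ hy]

variable (K) in
/-- An affine chart of the projective plane of the lines in `{w | ∑ w i = 0}`: the affine plane
`base + dir (K²)` in this space, with the linear coordinates `coef`, `coord` of the decomposition of
the space as the direct sum of the line spanned by `base` and the image of `dir`. -/
structure WeightChart where
  /-- the origin of the chart -/
  base : Fin 4 → K
  /-- the parametrization of the direction of the plane -/
  dir : (K × K) →ₗ[K] (Fin 4 → K)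
  /-- the coordinate along `base` -/
  coef : (Fin 4 → K) →ₗ[K] K
  /-- the coordinates along the plane -/
  coord : (Fin 4 → K) →ₗ[K] K × K
  sum_base : ∑ i, base i = 0
  sum_dir : ∀ v, ∑ i, dir v i = 0
  coef_base : coef base = 1
  coord_base : coord base = 0
  coef_dir : ∀ v, coef (dir v) = 0
  coord_dir : ∀ v, coord (dir v) = v
  decomp : ∀ w : Fin 4 → K, ∑ i, w i = 0 → w = coef w • base + dir (coord w)

namespace WeightChart

variable (c : WeightChart K)

/-- The point of the affine plane with given coordinates. -/
def point (v : K × K) : Fin 4 → K := c.base + c.dir v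

lemma sum_point (v : K × K) : ∑ i, c.point v i = 0 := by
  simp [point, Finset.sum_add_distrib, c.sum_base, c.sum_dir]

lemma coef_point (v : K × K) : c.coef (c.point v) = 1 := by
  simp [point, c.coef_base, c.coef_dir]

lemma coord_point (v : K × K) : c.coord (c.point v) = v := by
  simp [point, c.coord_base, c.coord_dir]

lemma continuous_point : Continuous c.point :=
  continuous_const.add c.dir.continuous_of_finiteDimensional

lemma analyticAt_point (v : K × K) : AnalyticAt K c.point v :=
  analyticAt_const.add (c.dir.toContinuousLinearMap.analyticAt v)

/-- The generic part of the chart. -/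
def domain : Set (K × K) := c.point ⁻¹' genericWeights K

lemma isOpen_domain : IsOpen c.domain := by
  obtain ⟨O, hO, h⟩ := exists_open_genericWeights K
  have : c.domain = c.point ⁻¹' O := by
    ext v; simp [domain, h, c.sum_point]
  rw [this]
  exact hO.preimage c.continuous_point

/-- The class of the quadruples with the weights `c.point v`. -/
def toModuli (v : K × K) : Moduli K := ofWeights (c.point v)

lemma continuousOn_toModuli : ContinuousOn c.toModuli c.domain :=
  continuousOn_ofWeights.comp c.continuous_point.continuousOn fun _ h => h

/-- Weights with nonzero coordinate along `base` are, up to a factor, in the plane. -/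
lemma point_coord {w : Fin 4 → K} (hw : ∑ i, w i = 0) (h : c.coef w ≠ 0) :
    c.point ((c.coef w)⁻¹ • c.coord w) = (c.coef w)⁻¹ • w := by
  have h1 := congrArg (fun x => (c.coef w)⁻¹ • x) (c.decomp w hw)
  simp only [smul_add, smul_smul, inv_mul_cancel₀ h, one_smul] at h1
  rw [h1, point, map_smul]

lemma exists_of_eq {v : K × K} (hv : v ∈ c.domain) {w : Fin 4 → K} (hw : w ∈ genericWeights K)
    (h : ofWeights w = c.toModuli v) : ∃ σ : Equiv.Perm (Fin 4), c.coef (w ∘ σ) ≠ 0 ∧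
      (c.coef (w ∘ σ))⁻¹ • c.coord (w ∘ σ) = v := by
  obtain ⟨σ, k, hk, hσ⟩ := (ofWeights_eq_iff hw hv).1 h
  have h1 : k * c.coef (w ∘ σ) = 1 := by
    rw [← c.coef_point v, hσ, map_smul, smul_eq_mul]
  have h2 : (c.coef (w ∘ σ))⁻¹ = k := (eq_inv_of_mul_eq_one_left h1).symm
  refine ⟨σ, right_ne_zero_of_mul_eq_one h1, ?_⟩
  rw [h2, ← map_smul, ← hσ, c.coord_point]

lemma toModuli_coord {w : Fin 4 → K} (hw : w ∈ genericWeights K) {σ : Equiv.Perm (Fin 4)}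
    (h : c.coef (w ∘ σ) ≠ 0) :
    c.toModuli ((c.coef (w ∘ σ))⁻¹ • c.coord (w ∘ σ)) = ofWeights w := by
  rw [toModuli, c.point_coord ((genericWeights_comp σ).2 hw).1 h,
    ofWeights_smul_comp hw (inv_ne_zero h)]

lemma isOpen_image {W : Set (K × K)} (hW : W ⊆ c.domain) (ho : IsOpen W) :
    IsOpen (c.toModuli '' W) := by
  refine isOpen_of_preimage_ofOrdered ?_
  have : Moduli.ofOrdered ⁻¹' (c.toModuli '' W) = ⋃ σ : Equiv.Perm (Fin 4),
      {p : orderedGeneric K | c.coef (weights p.1 ∘ σ) ≠ 0 ∧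
        (c.coef (weights p.1 ∘ σ))⁻¹ • c.coord (weights p.1 ∘ σ) ∈ W} := by
    ext p
    have hp := (mem_orderedGeneric_iff _).1 p.2
    simp only [mem_preimage, mem_image, mem_iUnion, mem_ofPred_eq, ← ofWeights_weights]
    constructor
    · rintro ⟨v, hv, h⟩
      obtain ⟨σ, h1, h2⟩ := c.exists_of_eq (hW hv) hp h.symm
      exact ⟨σ, h1, by rwa [h2]⟩
    · rintro ⟨σ, h1, h2⟩
      exact ⟨_, h2, c.toModuli_coord hp h1⟩
  rw [this]
  refine isOpen_iUnion fun σ => ?_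
  have hw : Continuous fun p : orderedGeneric K => weights p.1 ∘ σ :=
    continuous_pi fun i => (continuous_apply (σ i)).comp
      (continuous_weights.comp continuous_subtype_val)
  have h1 : Continuous fun p : orderedGeneric K => c.coef (weights p.1 ∘ σ) :=
    c.coef.continuous_of_finiteDimensional.comp hw
  have h2 : Continuous fun p : orderedGeneric K => c.coord (weights p.1 ∘ σ) :=
    c.coord.continuous_of_finiteDimensional.comp hw
  have h3 : ContinuousOn (fun p : orderedGeneric K =>
      (c.coef (weights p.1 ∘ σ))⁻¹ • c.coord (weights p.1 ∘ σ))
      {p | c.coef (weights p.1 ∘ σ) ≠ 0} :=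
    (h1.continuousOn.inv₀ fun _ h => h).smul h2.continuousOn
  exact h3.isOpen_inter_preimage (isOpen_ne_fun h1 continuous_const) ho

/-- The analytic functions on the moduli space are those which are analytic in the chart. -/
lemma isAnalyticFunAt_iff {v : K × K} (hv : v ∈ c.domain) (F : Moduli K → K) :
    Moduli.IsAnalyticFunAt F (c.toModuli v) ↔ AnalyticAt K (F ∘ c.toModuli) v := by
  constructor
  · intro h
    exact IsAnalyticFunAt.comp_ofWeights (c.analyticAt_point v) hv
      (Filter.Eventually.of_forall fun y => c.sum_point y) h
  · intro h
    rw [Quadrilaterals.isAnalyticFunAt_iff]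
    intro p hp hz
    obtain ⟨σ, h1, h2⟩ := c.exists_of_eq hv ((mem_orderedGeneric_iff p).1 hp) hz
    have hw : AnalyticAt K (fun p : Fin 4 → K × K => weights p ∘ σ) p := by
      rw [analyticAt_pi_iff]
      exact fun i => analyticAt_pi_iff.1 (analyticAt_weights p) (σ i)
    have k1 : AnalyticAt K (fun p : Fin 4 → K × K => c.coef (weights p ∘ σ)) p :=
      (c.coef.toContinuousLinearMap.analyticAt _).comp hw
    have k2 : AnalyticAt K (fun p : Fin 4 → K × K => c.coord (weights p ∘ σ)) p :=
      (c.coord.toContinuousLinearMap.analyticAt _).comp hw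
    refine (h.comp_of_eq ((k1.inv h1).smul k2) h2).congr ?_
    filter_upwards [k1.continuousAt.eventually_ne h1, isOpen_orderedGeneric.mem_nhds hp]
      with q hq1 hq2
    simp only [Function.comp_apply]
    exact congrArg F (c.toModuli_coord ((mem_orderedGeneric_iff q).1 hq2) hq1)

end WeightChart

/-! ### Local models -/

/-- The vector proportional to `w` on which the sum of the cubes is equal to the product of the
coordinates. -/
def normalized (w : Fin 4 → K) : Fin 4 → K := ((∑ i, w i ^ 3) / ∏ i, w i) • w

lemma normalized_smul_comp {w : Fin 4 → K} (hw : w ∈ genericWeights K) {k : K} (hk : k ≠ 0)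
    (σ : Equiv.Perm (Fin 4)) : normalized (k • (w ∘ σ)) = normalized w ∘ σ := by
  have h4 := hw.2.2
  funext i
  simp only [normalized, Pi.smul_apply, smul_eq_mul, mul_pow, Function.comp_apply,
    ← Finset.mul_sum, Finset.prod_mul_distrib, Finset.prod_const, Finset.card_univ,
    Fintype.card_fin]
  rw [Equiv.sum_comp σ (fun i => w i ^ 3), Equiv.prod_comp σ w]
  field_simp

lemma normalized_factor_ne_zero {w : Fin 4 → K} (hw : w ∈ genericWeights K) :
    (∑ i, w i ^ 3) / ∏ i, w i ≠ 0 := div_ne_zero hw.2.1 hw.2.2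

/-- A permutation that fixes the line of a generic weight vector fixes the vector. -/
lemma comp_eq_of_smul_comp_eq {w : Fin 4 → K} (hw : w ∈ genericWeights K) {k : K} (hk : k ≠ 0)
    {σ : Equiv.Perm (Fin 4)} (h : k • (w ∘ σ) = w) : w ∘ σ = w := by
  have h1 := normalized_smul_comp hw hk σ
  rw [h] at h1
  have h2 := normalized_factor_ne_zero hw
  funext i
  have := congrFun h1 i
  simp only [normalized, Pi.smul_apply, smul_eq_mul, Function.comp_apply] at this
  exact (mul_left_cancel₀ h2 this).symm

lemma continuousOn_normalized : ContinuousOn (normalized (K := K)) (genericWeights K) := by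
  intro w hw
  have h4 := hw.2.2
  apply ContinuousAt.continuousWithinAt
  unfold normalized
  fun_prop (disch := assumption)

/-- Charts centered at a point are local models, when the stabilizer of the center acts linearly
in the chart. -/
lemma WeightChart.hasLocalModel (c : WeightChart K) (h0 : c.base ∈ genericWeights K)
    (G : Subgroup ((K × K) ≃ₗ[K] (K × K)))
    (hG : ∀ g ∈ G, ∃ σ : Equiv.Perm (Fin 4), c.base ∘ σ = c.base ∧ ∀ v, c.dir (g v) = c.dir v ∘ σ)
    (hσ : ∀ σ : Equiv.Perm (Fin 4), c.base ∘ σ = c.base →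
      ∃ g ∈ G, ∀ v, c.dir (g v) = c.dir v ∘ σ) :
    HasLocalModel Moduli.IsAnalyticFunAt G (ofWeights c.base) := by
  -- a ball around `normalized c.base` that separates it from its distinct permutations
  obtain ⟨ε, hε, hsep⟩ : ∃ ε > 0, ∀ σ : Equiv.Perm (Fin 4), c.base ∘ σ ≠ c.base →
      2 * ε ≤ dist (normalized c.base ∘ σ) (normalized c.base) := by
    have : ∀ σ : Equiv.Perm (Fin 4), ∃ ε > 0, c.base ∘ σ ≠ c.base →
        2 * ε ≤ dist (normalized c.base ∘ σ) (normalized c.base) := by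
      intro σ
      by_cases h : c.base ∘ σ = c.base
      · exact ⟨1, one_pos, fun h' => absurd h h'⟩
      · refine ⟨dist (normalized c.base ∘ σ) (normalized c.base) / 2, half_pos (dist_pos.2 ?_),
          fun _ => by linarith⟩
        intro h'
        refine h (funext fun i => ?_)
        exact mul_left_cancel₀ (normalized_factor_ne_zero h0) (congrFun h' i)
    choose e he he' using this
    obtain ⟨σ₀, -, h₀⟩ := Finset.exists_min_image Finset.univ e Finset.univ_nonempty
    exact ⟨e σ₀, he σ₀, fun σ h => le_trans (by linarith [h₀ σ (Finset.mem_univ _)]) (he' σ h)⟩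
  have hp0 : c.point 0 = c.base := by simp [WeightChart.point]
  have hgp : ∀ g ∈ G, ∀ v, ∃ σ : Equiv.Perm (Fin 4), c.base ∘ σ = c.base ∧
      c.point (g v) = c.point v ∘ σ := by
    intro g hg v
    obtain ⟨σ, h1, h2⟩ := hG g hg
    refine ⟨σ, h1, ?_⟩
    rw [WeightChart.point, h2, WeightChart.point]
    conv_lhs => rw [← h1]
    rfl
  have hball : ∀ (σ : Equiv.Perm (Fin 4)) (x y : Fin 4 → K), dist (x ∘ σ) (y ∘ σ) = dist x y := by
    intro σ x y
    refine le_antisymm ((dist_pi_le_iff dist_nonneg).2 fun i => dist_le_pi_dist x y (σ i))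
      ((dist_pi_le_iff dist_nonneg).2 fun i => ?_)
    simpa using dist_le_pi_dist (x ∘ σ) (y ∘ σ) (σ.symm i)
  refine ⟨c.domain ∩ {v | normalized (c.point v) ∈ Metric.ball (normalized c.base) ε}, c.toModuli,
    ?_, ?_, ?_, ?_, ?_, ?_, ?_, ?_⟩
  · exact (continuousOn_normalized.comp c.continuous_point.continuousOn
      fun _ h => h).isOpen_inter_preimage c.isOpen_domain Metric.isOpen_ball
  · refine ⟨?_, ?_⟩
    · change c.point 0 ∈ genericWeights K
      rwa [hp0]
    · change normalized (c.point 0) ∈ Metric.ball (normalized c.base) ε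
      rw [hp0]; exact Metric.mem_ball_self hε
  · rintro g hg v ⟨h1, h2⟩
    obtain ⟨σ, h3, h4⟩ := hgp g hg v
    have h1' : c.point v ∈ genericWeights K := h1
    refine ⟨?_, ?_⟩
    · change c.point (g v) ∈ genericWeights K
      rwa [h4, genericWeights_comp]
    · change normalized (c.point (g v)) ∈ Metric.ball (normalized c.base) ε
      have e1 := normalized_smul_comp h1' one_ne_zero σ
      have e2 := normalized_smul_comp h0 one_ne_zero σ
      rw [one_smul] at e1 e2
      rw [h3] at e2
      rw [h4, e1, Metric.mem_ball, e2, hball]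
      exact h2
  · exact c.continuousOn_toModuli.mono inter_subset_left
  · exact fun W hW ho => c.isOpen_image (fun v hv => (hW hv).1) ho
  · rw [WeightChart.toModuli, hp0]
  · rintro v ⟨hv1, hv2⟩ w ⟨hw1, hw2⟩
    have hv1' : c.point v ∈ genericWeights K := hv1
    constructor
    · intro h
      obtain ⟨σ, k, hk, hs⟩ := (ofWeights_eq_iff hv1 hw1).1 h
      have hfix : c.base ∘ σ = c.base := by
        by_contra hne
        have h1 := hsep σ hne
        have e1 : normalized (c.point w) = normalized (c.point v) ∘ σ := by
          rw [hs, normalized_smul_comp hv1' hk]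
        have hv2' : dist (normalized (c.point v)) (normalized c.base) < ε := hv2
        have hw2' : dist (normalized (c.point w)) (normalized c.base) < ε := hw2
        rw [← hball σ, ← e1, dist_comm] at hv2'
        linarith [dist_triangle (normalized c.base ∘ σ) (normalized (c.point w))
          (normalized c.base)]
      obtain ⟨g, hg, hgσ⟩ := hσ σ hfix
      refine ⟨g, hg, ?_⟩
      have e2 : c.point w = k • c.point (g v) := by
        rw [hs, WeightChart.point, WeightChart.point, hgσ]
        conv_rhs => rw [← hfix]
        rfl
      have hk1 : k = 1 := by
        have := c.coef_point w
        rw [e2, map_smul, c.coef_point, smul_eq_mul, mul_one] at this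
        exact this
      rw [hk1, one_smul] at e2
      rw [← c.coord_point (g v), ← e2, c.coord_point]
    · rintro ⟨g, hg, rfl⟩
      obtain ⟨σ, -, h4⟩ := hgp g hg v
      rw [WeightChart.toModuli, WeightChart.toModuli, h4]
      have := ofWeights_smul_comp hv1' one_ne_zero σ
      rw [one_smul] at this
      exact this.symm
  · exact fun F v hv => c.isAnalyticFunAt_iff hv.1 F

end Charts

section Models

variable {K : Type*} [RCLike K]

/-- The chart centered at `w` in which exchanging the first two weights exchanges the
coordinates, when these weights of `w` are equal. -/
def reflectionChart (w : Fin 4 → K) (hs : ∑ i, w i = 0) (h2 : w 2 ≠ 0) : WeightChart K where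
  base := w
  dir :=
    { toFun := fun v => ![v.1, v.2, 0, -v.1 - v.2]
      map_add' := fun v v' => by funext i; fin_cases i <;> simp; ring
      map_smul' := fun k v => by funext i; fin_cases i <;> simp; ring }
  coef :=
    { toFun := fun x => x 2 / w 2
      map_add' := fun x y => by simp; ring
      map_smul' := fun k x => by simp; ring }
  coord :=
    { toFun := fun x => (x 0 - w 0 / w 2 * x 2, x 1 - w 1 / w 2 * x 2)
      map_add' := fun x y => by ext <;> simp <;> ring
      map_smul' := fun k x => by ext <;> simp <;> ring }
  sum_base := hs
  sum_dir v := by simp [Fin.sum_univ_four]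
  coef_base := by simp [h2]
  coord_base := by ext <;> simp [h2]
  coef_dir v := by simp
  coord_dir v := by simp
  decomp x hx := by
    rw [Fin.sum_univ_four] at hx hs
    have e1 : x 3 = -(x 0 + x 1 + x 2) := by linear_combination hx
    have e2 : w 3 = -(w 0 + w 1 + w 2) := by linear_combination hs
    funext i
    fin_cases i
    · simp; field_simp; ring
    · simp; field_simp; ring
    · simp [h2]
    · simp [e1, e2]; field_simp; ring

/-- The chart centered at `w` in which the permutations of the first three weights permute the
points `(1, 0)`, `(0, 1)`, `(-1, -1)`, when these weights of `w` are equal. -/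
def triangleChart (w : Fin 4 → K) (hs : ∑ i, w i = 0) (h3 : w 3 ≠ 0) : WeightChart K where
  base := w
  dir :=
    { toFun := fun v => ![2 * v.1 - v.2, 2 * v.2 - v.1, -v.1 - v.2, 0]
      map_add' := fun v v' => by funext i; fin_cases i <;> simp <;> ring
      map_smul' := fun k v => by funext i; fin_cases i <;> simp <;> ring }
  coef :=
    { toFun := fun x => x 3 / w 3
      map_add' := fun x y => by simp; ring
      map_smul' := fun k x => by simp; ring }
  coord :=
    { toFun := fun x => ((2 * (x 0 - w 0 / w 3 * x 3) + (x 1 - w 1 / w 3 * x 3)) / 3,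
        ((x 0 - w 0 / w 3 * x 3) + 2 * (x 1 - w 1 / w 3 * x 3)) / 3)
      map_add' := fun x y => by ext <;> simp <;> ring
      map_smul' := fun k x => by ext <;> simp <;> ring }
  sum_base := hs
  sum_dir v := by simp [Fin.sum_univ_four]; ring
  coef_base := by simp [h3]
  coord_base := by ext <;> simp [h3]
  coef_dir v := by simp
  coord_dir v := by ext <;> simp <;> ring
  decomp x hx := by
    rw [Fin.sum_univ_four] at hx hs
    have e1 : x 2 = -(x 0 + x 1 + x 3) := by linear_combination hx
    have e2 : w 2 = -(w 0 + w 1 + w 3) := by linear_combination hs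
    funext i
    fin_cases i
    · simp; field_simp; ring
    · simp; field_simp; ring
    · simp [e1, e2]; field_simp; ring
    · simp [h3]

lemma hasLocalModel_bot {w : Fin 4 → K} (hw : w ∈ genericWeights K) (hinj : Function.Injective w) :
    HasLocalModel Moduli.IsAnalyticFunAt ⊥ (ofWeights w) := by
  refine (reflectionChart w hw.1 (ne_zero_of_mem hw 2)).hasLocalModel hw ⊥ ?_ ?_
  · rintro g hg
    rw [Subgroup.mem_bot] at hg
    exact ⟨1, by simp, by simp [hg]⟩
  · intro σ hσ
    have : σ = 1 := Equiv.ext fun i => hinj (congrFun hσ i)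
    exact ⟨1, Subgroup.mem_bot.2 rfl, by simp [this]⟩

lemma mem_reflectionGroup_iff (g : (K × K) ≃ₗ[K] (K × K)) :
    g ∈ reflectionGroup K ↔ g = 1 ∨ g = LinearEquiv.prodComm K K K := by
  have h2 : (LinearEquiv.prodComm K K K : (K × K) ≃ₗ[K] (K × K)) ^ (2 : ℤ) = 1 := by
    rw [zpow_two]; rfl
  constructor
  · rintro ⟨n, rfl⟩
    obtain ⟨m, rfl | rfl⟩ := Int.even_or_odd' n
    · left; simp only [zpow_mul, h2, one_zpow]
    · right; simp only [zpow_add, zpow_mul, h2, one_zpow, one_mul, zpow_one]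
  · rintro (rfl | rfl)
    · exact one_mem _
    · exact Subgroup.mem_zpowers _

instance finite_reflectionGroup : Finite (reflectionGroup K) := by
  refine ((Set.finite_insert.2 (Set.finite_singleton (LinearEquiv.prodComm K K K))).subset
    (s := insert 1 {LinearEquiv.prodComm K K K}) ?_).to_subtype
  intro g hg
  exact (mem_reflectionGroup_iff g).1 hg

lemma hasLocalModel_reflectionGroup {w : Fin 4 → K} (hw : w ∈ genericWeights K) (h01 : w 0 = w 1)
    (h02 : w 0 ≠ w 2) (h03 : w 0 ≠ w 3) (h23 : w 2 ≠ w 3) :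
    HasLocalModel Moduli.IsAnalyticFunAt (reflectionGroup K) (ofWeights w) := by
  have hswap : w ∘ Equiv.swap 0 1 = w := by
    funext i; fin_cases i <;> simp [Equiv.swap_apply_def, h01]
  have hdir : ∀ v : K × K, (reflectionChart w hw.1 (ne_zero_of_mem hw 2)).dir
      (LinearEquiv.prodComm K K K v) =
      (reflectionChart w hw.1 (ne_zero_of_mem hw 2)).dir v ∘ Equiv.swap 0 1 := by
    intro v
    funext i
    fin_cases i <;> simp [reflectionChart, Equiv.swap_apply_def]
    ring
  refine (reflectionChart w hw.1 (ne_zero_of_mem hw 2)).hasLocalModel hw _ ?_ ?_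
  · intro g hg
    rcases (mem_reflectionGroup_iff g).1 hg with rfl | rfl
    · exact ⟨1, by simp, by simp⟩
    · exact ⟨Equiv.swap 0 1, hswap, hdir⟩
  · intro σ hσ
    have hσ' : ∀ i, w (σ i) = w i := congrFun hσ
    have h2 : σ 2 = 2 := by
      have := hσ' 2
      generalize σ 2 = j at this
      fin_cases j
      exacts [absurd this h02, absurd (h01.trans this) h02, rfl, absurd this.symm h23]
    have h3 : σ 3 = 3 := by
      have := hσ' 3
      generalize σ 3 = j at this
      fin_cases j
      exacts [absurd this h03, absurd (h01.trans this) h03, absurd this h23, rfl]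
    have : σ = 1 ∨ σ = Equiv.swap 0 1 := by
      clear hσ hσ'; revert σ; decide
    rcases this with rfl | rfl
    · exact ⟨1, one_mem _, by simp⟩
    · exact ⟨_, (mem_reflectionGroup_iff _).2 (Or.inr rfl), hdir⟩

variable (K) in
/-- The vertices of the triangle whose linear symmetries form `triangleGroup K`. -/
def triangleVertex : Fin 3 → K × K := ![(1, 0), (0, 1), (-1, -1)]

lemma range_triangleVertex :
    range (triangleVertex K) = ({(1, 0), (0, 1), (-1, -1)} : Set (K × K)) := by
  ext v
  simp [triangleVertex]
  tauto

lemma triangleVertex_injective : Function.Injective (triangleVertex K) := by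
  intro i j h
  fin_cases i <;> fin_cases j <;>
    first
      | rfl
      | (exfalso; simp [triangleVertex, eq_neg_iff_add_eq_zero, one_add_one_eq_two] at h)

lemma exists_perm_of_mem_triangleGroup {g : (K × K) ≃ₗ[K] (K × K)} (hg : g ∈ triangleGroup K) :
    ∃ τ : Equiv.Perm (Fin 3), ∀ i, g (triangleVertex K i) = triangleVertex K (τ i) := by
  have h : g • range (triangleVertex K) = range (triangleVertex K) := by
    rw [range_triangleVertex]; exact MulAction.mem_stabilizer_iff.1 hg
  have h' : range (g ∘ triangleVertex K) = range (triangleVertex K) := by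
    rw [range_comp]; exact h
  obtain ⟨τ, hτ⟩ := exists_perm_of_range_eq (g.injective.comp triangleVertex_injective)
    triangleVertex_injective h'
  exact ⟨τ, fun i => (congrFun hτ i).symm⟩

lemma mem_triangleGroup_of_perm {g : (K × K) ≃ₗ[K] (K × K)} {τ : Equiv.Perm (Fin 3)}
    (h : ∀ i, g (triangleVertex K i) = triangleVertex K (τ i)) : g ∈ triangleGroup K := by
  rw [triangleGroup, MulAction.mem_stabilizer_iff, ← range_triangleVertex]
  have : g ∘ triangleVertex K = triangleVertex K ∘ τ := funext h
  change g '' range (triangleVertex K) = _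
  rw [← range_comp, this, τ.surjective.range_comp]

lemma prod_eq_triangleVertex (v : K × K) :
    v = v.1 • triangleVertex K 0 + v.2 • triangleVertex K 1 := by
  ext <;> simp [triangleVertex]

lemma linearEquiv_ext_triangleVertex {g h : (K × K) ≃ₗ[K] (K × K)}
    (H : ∀ i, g (triangleVertex K i) = h (triangleVertex K i)) : g = h := by
  ext1 v
  rw [prod_eq_triangleVertex v]
  simp only [map_add, map_smul, H]

instance finite_triangleGroup : Finite (triangleGroup K) := by
  choose τ hτ using fun g : triangleGroup K => exists_perm_of_mem_triangleGroup g.2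
  refine Finite.of_injective τ fun g h hgh =>
    Subtype.ext (linearEquiv_ext_triangleVertex fun i => ?_)
  rw [hτ, hτ, hgh]

lemma exists_extend_perm (τ : Equiv.Perm (Fin 3)) : ∃ σ : Equiv.Perm (Fin 4), σ 3 = 3 ∧
    ∀ i : Fin 3, σ i.castSucc = (τ i).castSucc := by
  revert τ; decide

lemma exists_restrict_perm (σ : Equiv.Perm (Fin 4)) (h : σ 3 = 3) : ∃ τ : Equiv.Perm (Fin 3),
    ∀ i : Fin 3, σ i.castSucc = (τ i).castSucc := by
  revert σ; decide

lemma exists_mem_triangleGroup (τ : Equiv.Perm (Fin 3)) : ∃ g ∈ triangleGroup K,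
    ∀ i, g (triangleVertex K i) = triangleVertex K (τ i) := by
  have hsum : ∀ τ : Equiv.Perm (Fin 3), ∑ i, triangleVertex K (τ i) = 0 := by
    intro τ
    rw [Equiv.sum_comp τ (triangleVertex K), Fin.sum_univ_three]
    simp [triangleVertex]
  have hd : (triangleVertex K (τ 0)).1 * (triangleVertex K (τ 1)).2 -
      (triangleVertex K (τ 0)).2 * (triangleVertex K (τ 1)).1 ≠ 0 := by
    have : τ 0 ≠ τ 1 := τ.injective.ne (by decide)
    generalize τ 0 = i at *
    generalize τ 1 = j at *
    fin_cases i <;> fin_cases j <;> first | exact absurd rfl this | simp [triangleVertex]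
  have h0 : frame _ _ hd (triangleVertex K 0) = triangleVertex K (τ 0) := by
    ext <;> simp [frame, triangleVertex]
  have h1 : frame _ _ hd (triangleVertex K 1) = triangleVertex K (τ 1) := by
    ext <;> simp [frame, triangleVertex]
  have h2 : frame _ _ hd (triangleVertex K 2) = triangleVertex K (τ 2) := by
    have e1 := hsum 1
    have e2 := hsum τ
    rw [Fin.sum_univ_three] at e1 e2
    rw [← neg_eq_iff_add_eq_zero] at e1 e2
    simp only [Equiv.Perm.coe_one, id] at e1
    rw [← e1, ← e2, map_neg, map_add, h0, h1]
  have H : ∀ i, frame _ _ hd (triangleVertex K i) = triangleVertex K (τ i) := by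
    intro i
    fin_cases i
    exacts [h0, h1, h2]
  exact ⟨_, mem_triangleGroup_of_perm H, H⟩

lemma hasLocalModel_triangleGroup {w : Fin 4 → K} (hw : w ∈ genericWeights K) (h01 : w 0 = w 1)
    (h02 : w 0 = w 2) (h03 : w 0 ≠ w 3) :
    HasLocalModel Moduli.IsAnalyticFunAt (triangleGroup K) (ofWeights w) := by
  set c := triangleChart w hw.1 (ne_zero_of_mem hw 3) with hc
  have hconst : ∀ i : Fin 3, w i.castSucc = w 0 := by
    intro i; fin_cases i
    exacts [rfl, h01.symm, h02.symm]
  have hvert : ∀ i k : Fin 3, c.dir (triangleVertex K i) k.castSucc = if i = k then 2 else -1 := by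
    intro i k
    fin_cases i <;> fin_cases k <;> simp [hc, triangleChart, triangleVertex] <;> norm_num
  have hvert3 : ∀ v : K × K, c.dir v 3 = 0 := fun v => by simp [hc, triangleChart]
  -- a linear symmetry and a permutation which match on the vertices match everywhere
  have hmatch : ∀ (g : (K × K) ≃ₗ[K] (K × K)) (σ : Equiv.Perm (Fin 4)) (τ τ' : Equiv.Perm (Fin 3)),
      τ' = τ⁻¹ → σ 3 = 3 → (∀ i : Fin 3, σ i.castSucc = (τ i).castSucc) →
      (∀ i, g (triangleVertex K i) = triangleVertex K (τ' i)) →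
      ∀ v, c.dir (g v) = c.dir v ∘ σ := by
    intro g σ τ τ' hτ' h3 hστ hg v
    have hv : ∀ i, c.dir (g (triangleVertex K i)) = c.dir (triangleVertex K i) ∘ σ := by
      intro i
      funext k
      refine Fin.lastCases ?_ (fun k => ?_) k
      · have : σ (Fin.last 3) = 3 := h3
        rw [Function.comp_apply, this, hvert3]
        exact hvert3 _
      · rw [hg, Function.comp_apply, hστ, hvert, hvert, hτ']
        simp only [Equiv.Perm.inv_eq_iff_eq]
    rw [prod_eq_triangleVertex v]
    simp only [map_add, map_smul, hv]
    rfl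
  refine c.hasLocalModel hw _ ?_ ?_
  · intro g hg
    obtain ⟨τ, hτ⟩ := exists_perm_of_mem_triangleGroup hg
    obtain ⟨σ, h3, hσ⟩ := exists_extend_perm τ⁻¹
    refine ⟨σ, ?_, hmatch g σ τ⁻¹ τ (inv_inv τ).symm h3 hσ hτ⟩
    change w ∘ σ = w
    funext k
    refine Fin.lastCases ?_ (fun k => ?_) k
    · exact congrArg w h3
    · rw [Function.comp_apply, hσ, hconst, hconst]
  · intro σ hσ
    have h3 : σ 3 = 3 := by
      have h : w (σ 3) = w 3 := congrFun hσ 3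
      generalize σ 3 = j at h
      fin_cases j
      exacts [absurd h h03, absurd (h01.trans h) h03, absurd (h02.trans h) h03, rfl]
    obtain ⟨τ, hτ⟩ := exists_restrict_perm σ h3
    obtain ⟨g, hg, hgτ⟩ := exists_mem_triangleGroup (K := K) τ⁻¹
    exact ⟨g, hg, hmatch g σ τ τ⁻¹ rfl h3 hτ hgτ⟩

lemma exists_perm_zero_one (i j : Fin 4) (h : i ≠ j) : ∃ σ : Equiv.Perm (Fin 4),
    σ 0 = i ∧ σ 1 = j := by
  revert i j; decide

/-- Among generic weights at most three are equal, and they are not equal in pairs. -/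
lemma genericWeights_trichotomy {w : Fin 4 → K} (hw : w ∈ genericWeights K) :
    Function.Injective w ∨ ∃ σ : Equiv.Perm (Fin 4), w (σ 0) = w (σ 1) ∧ w (σ 0) ≠ w (σ 3) ∧
      (w (σ 0) = w (σ 2) ∨ w (σ 0) ≠ w (σ 2) ∧ w (σ 2) ≠ w (σ 3)) := by
  by_cases hinj : Function.Injective w
  · exact Or.inl hinj
  right
  obtain ⟨i, j, hij, hne⟩ : ∃ i j, w i = w j ∧ i ≠ j := by
    simpa [Function.Injective] using hinj
  obtain ⟨σ, rfl, rfl⟩ := exists_perm_zero_one i j hne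
  have hw' := (genericWeights_comp σ).2 hw
  obtain ⟨h0, hp⟩ := (mem_genericWeights_iff hw'.1).1 hw'
  have hs := hw'.1
  rw [Fin.sum_univ_four] at hs
  simp only [Function.comp_apply] at h0 hp hs
  by_cases h2 : w (σ 0) = w (σ 2)
  · refine ⟨σ, hij, fun h3 => h0 0 ?_, Or.inl h2⟩
    rw [← hij, ← h2, ← h3] at hs; linear_combination hs / 4
  · have h23 : w (σ 2) ≠ w (σ 3) := fun h => hp 0 2 (by decide) (by
      rw [← hij, ← h] at hs; linear_combination hs / 2)
    by_cases h3 : w (σ 0) = w (σ 3)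
    · refine ⟨σ * Equiv.swap 2 3, ?_, ?_, Or.inl ?_⟩
      · simpa [Equiv.swap_apply_def] using hij
      · simpa [Equiv.swap_apply_def] using h2
      · simpa [Equiv.swap_apply_def] using h3
    · exact ⟨σ, hij, h3, Or.inr ⟨h2, h23⟩⟩

/-- Each point of the moduli space is smooth, or a quotient singularity for a reflection or for the
symmetries of a triangle. -/
lemma hasLocalModel_trichotomy (z : Moduli K) :
    HasLocalModel Moduli.IsAnalyticFunAt ⊥ z ∨
      HasLocalModel Moduli.IsAnalyticFunAt (reflectionGroup K) z ∨
        HasLocalModel Moduli.IsAnalyticFunAt (triangleGroup K) z := by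
  obtain ⟨w, hw, rfl⟩ := exists_weights z
  rcases genericWeights_trichotomy hw with h | ⟨σ, h01, h03, h⟩
  · exact Or.inl (hasLocalModel_bot hw h)
  · have e := ofWeights_smul_comp hw one_ne_zero σ
    rw [one_smul] at e
    rw [← e]
    have hw' := (genericWeights_comp σ).2 hw
    rcases h with h02 | ⟨h02, h23⟩
    · exact Or.inr (Or.inr (hasLocalModel_triangleGroup hw' h01 h02 h03))
    · exact Or.inr (Or.inl (hasLocalModel_reflectionGroup hw' h01 h02 h03 h23))

end Models

/-! ### The action of `Sym(4)` on normal forms -/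

section Gauge

variable {K : Type*} [RCLike K]

lemma weights_normalForm_mem_iff (v : K × K) :
    weights (normalForm v) ∈ genericWeights K ↔ v ∉ arrangement K := by
  have hmem : v ∈ arrangement K ↔ (toEquilateral K).symm v ∈ sixLines K := by
    rw [arrangement]
    constructor
    · rintro ⟨w, hw, rfl⟩; simpa using hw
    · intro h; exact ⟨_, h, by simp⟩
  rw [hmem, weights_normalForm, genericWeights_smul sqrtThree_half_ne_zero]
  generalize (toEquilateral K).symm v = u
  have hs : ∑ i, (![1 - u.1 - u.2, u.1, u.2, -1] : Fin 4 → K) i = 0 := by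
    simp [Fin.sum_univ_four]; ring
  rw [genericWeights, mem_ofPred_eq, sum_cube_eq hs, sixLines, mem_ofPred_eq]
  simp only [hs, true_and, Fin.prod_univ_four, ← mul_ne_zero_iff]
  simp only [Matrix.cons_val]
  refine not_congr ⟨fun h => ?_, fun h => ?_⟩
  · linear_combination -h / 3
  · linear_combination -3 * h

lemma mem_normalForm_iff (v : K × K) : normalForm v ∈ orderedGeneric K ↔ v ∉ arrangement K := by
  rw [mem_orderedGeneric_iff, weights_normalForm_mem_iff]

variable (K) in
/-- The chart given by the weights of the quadruples in normal form. -/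
def normalChart : WeightChart K where
  base := (sqrtThree K / 2) • ![1, 0, 0, -1]
  dir := (sqrtThree K / 2) •
    ({ toFun := fun u => ![-u.1 - u.2, u.1, u.2, 0]
       map_add' := fun u u' => by funext i; fin_cases i <;> simp; ring
       map_smul' := fun k u => by funext i; fin_cases i <;> simp; ring } :
      (K × K) →ₗ[K] (Fin 4 → K)) ∘ₗ (toEquilateral K).symm.toLinearMap
  coef :=
    { toFun := fun x => -x 3 / (sqrtThree K / 2)
      map_add' := fun x y => by simp; ring
      map_smul' := fun k x => by simp; ring }
  coord := (toEquilateral K).toLinearMap ∘ₗ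
    { toFun := fun x => (x 1 / (sqrtThree K / 2), x 2 / (sqrtThree K / 2))
      map_add' := fun x y => by ext <;> simp <;> ring
      map_smul' := fun k x => by ext <;> simp <;> ring }
  sum_base := by simp [Fin.sum_univ_four]
  sum_dir v := by simp [Fin.sum_univ_four]; ring
  coef_base := by simp [sqrtThree_ne_zero K]
  coord_base := by simp
  coef_dir v := by simp
  coord_dir v := by
    rw [LinearMap.comp_apply, LinearEquiv.coe_coe, ← LinearEquiv.eq_symm_apply]
    have := sqrtThree_ne_zero K
    ext <;> simp <;> field_simp
  decomp w hw := by
    have h := sqrtThree_ne_zero K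
    rw [Fin.sum_univ_four] at hw
    have e : w 0 = -(w 1 + w 2 + w 3) := by linear_combination hw
    simp only [LinearMap.smul_apply, LinearMap.comp_apply, LinearEquiv.coe_coe,
      LinearMap.coe_mk, AddHom.coe_mk, LinearEquiv.symm_apply_apply]
    funext i
    fin_cases i <;> simp [e] <;> field_simp <;> ring

lemma normalChart_point (v : K × K) : (normalChart K).point v = weights (normalForm v) := by
  rw [weights_normalForm, WeightChart.point]
  funext i
  fin_cases i <;> simp [normalChart] <;> ring

lemma mem_domain_normalChart {v : K × K} : v ∈ (normalChart K).domain ↔ v ∉ arrangement K := by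
  rw [← weights_normalForm_mem_iff, ← normalChart_point]; rfl

lemma domain_normalChart : (normalChart K).domain = (arrangement K)ᶜ := by
  ext v; exact mem_domain_normalChart

lemma isOpen_compl_arrangement : IsOpen (arrangement K)ᶜ := by
  rw [← domain_normalChart]; exact (normalChart K).isOpen_domain

lemma fourthPoint_notMem {w : Fin 4 → K} (hw : w ∈ genericWeights K) :
    fourthPoint w ∉ arrangement K := by
  rw [← mem_normalForm_iff]; exact normalForm_fourthPoint_mem hw

/-- Permuting the points of a quadruple in normal form and passing to the normal form: the effect
on the fourth point. -/
def permFourth (σ : Equiv.Perm (Fin 4)) (v : K × K) : K × K :=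
  fourthPoint (weights (normalForm v) ∘ ⇑σ⁻¹)

lemma permFourth_notMem (σ : Equiv.Perm (Fin 4)) {v : K × K} (hv : v ∉ arrangement K) :
    permFourth σ v ∉ arrangement K :=
  fourthPoint_notMem ((genericWeights_comp _).2 ((weights_normalForm_mem_iff v).2 hv))

lemma weights_permFourth (σ : Equiv.Perm (Fin 4)) {v : K × K} (hv : v ∉ arrangement K) :
    ∃ k : K, k ≠ 0 ∧
      weights (normalForm (permFourth σ v)) = k • (weights (normalForm v) ∘ ⇑σ⁻¹) := by
  have h := (genericWeights_comp σ⁻¹).2 ((weights_normalForm_mem_iff v).2 hv)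
  exact ⟨_, div_ne_zero (neg_ne_zero.2 sqrtThree_half_ne_zero) (ne_zero_of_mem h 3),
    weights_normalForm_fourthPoint h.1 (ne_zero_of_mem h 3)⟩

lemma permFourth_mul (σ τ : Equiv.Perm (Fin 4)) {v : K × K} (hv : v ∉ arrangement K) :
    permFourth (σ * τ) v = permFourth σ (permFourth τ v) := by
  obtain ⟨k, hk, h⟩ := weights_permFourth τ hv
  have : (k • (weights (normalForm v) ∘ ⇑τ⁻¹)) ∘ ⇑σ⁻¹ =
      k • (weights (normalForm v) ∘ ⇑(σ * τ)⁻¹) := by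
    rw [mul_inv_rev]; rfl
  conv_rhs => rw [permFourth, h, this, fourthPoint_smul hk]
  rfl

lemma permFourth_one (v : K × K) : permFourth 1 v = v := by
  rw [permFourth, inv_one, Equiv.Perm.coe_one, Function.comp_id, fourthPoint_weights]

lemma continuousOn_permFourth (σ : Equiv.Perm (Fin 4)) :
    ContinuousOn (permFourth (K := K) σ) (arrangement K)ᶜ := by
  refine continuousOn_fourthPoint.comp (Continuous.continuousOn ?_) fun v hv =>
    (genericWeights_comp _).2 ((weights_normalForm_mem_iff v).2 hv)
  exact continuous_pi fun i => (continuous_apply (σ⁻¹ i)).comp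
    (continuous_weights.comp continuous_normalForm)

variable (K) in
/-- The action of `Sym(4)` on the complement of the arrangement. -/
def gaugeAction : Equiv.Perm (Fin 4) →* (((arrangement K)ᶜ : Set (K × K)) ≃ₜ
    ((arrangement K)ᶜ : Set (K × K))) where
  toFun σ :=
    { toFun := fun v => ⟨permFourth σ v.1, permFourth_notMem σ v.2⟩
      invFun := fun v => ⟨permFourth σ⁻¹ v.1, permFourth_notMem σ⁻¹ v.2⟩
      left_inv := fun v => Subtype.ext (by
        simp only [← permFourth_mul _ _ v.2, inv_mul_cancel, permFourth_one])
      right_inv := fun v => Subtype.ext (by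
        simp only [← permFourth_mul _ _ v.2, mul_inv_cancel, permFourth_one])
      continuous_toFun := (continuousOn_iff_continuous_domRestrict.1
        (continuousOn_permFourth σ)).subtype_mk _
      continuous_invFun := (continuousOn_iff_continuous_domRestrict.1
        (continuousOn_permFourth σ⁻¹)).subtype_mk _ }
  map_one' := by
    ext1 v
    exact Subtype.ext (permFourth_one v.1)
  map_mul' σ τ := by
    ext1 v
    exact Subtype.ext (permFourth_mul σ τ v.2)

lemma gaugeAction_apply (σ : Equiv.Perm (Fin 4)) (v : ((arrangement K)ᶜ : Set (K × K))) :
    (gaugeAction K σ v : K × K) = permFourth σ v := rfl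

lemma gaugeAction_injective : Function.Injective (gaugeAction K) := by
  rw [injective_iff_map_eq_one]
  intro σ hσ
  -- the action is free at the weights `1, 2, 4, -7`
  set w : Fin 4 → K := fun i => ((![1, 2, 4, -7] : Fin 4 → ℤ) i : K) with hwdef
  have hinj : Function.Injective w := fun i j h => by
    have h' := Int.cast_injective (α := K) h
    clear_value w
    clear h hσ hwdef w σ
    revert i j; decide
  have hw : w ∈ genericWeights K := by
    refine ⟨?_, ?_, ?_⟩
    · simp only [hwdef, ← Int.cast_sum, Int.cast_eq_zero]; decide
    · simp only [hwdef, ← Int.cast_sum, ← Int.cast_pow, ne_eq, Int.cast_eq_zero]; decide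
    · simp only [hwdef, ← Int.cast_prod, ne_eq, Int.cast_eq_zero]; decide
  have h1 := congrArg (fun g => ((g ⟨fourthPoint w, fourthPoint_notMem hw⟩ :
    ((arrangement K)ᶜ : Set (K × K))) : K × K)) hσ
  simp only [gaugeAction_apply, Homeomorph.one_apply] at h1
  obtain ⟨k, hk, h2⟩ := weights_permFourth σ (fourthPoint_notMem hw)
  have h3 : -(sqrtThree K / 2) / w 3 ≠ 0 :=
    div_ne_zero (neg_ne_zero.2 sqrtThree_half_ne_zero) (ne_zero_of_mem hw 3)
  rw [h1, weights_normalForm_fourthPoint hw.1 (ne_zero_of_mem hw 3)] at h2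
  have h4 : k • (w ∘ ⇑σ⁻¹) = w := by
    funext i
    have := congrFun h2 i
    simp only [Pi.smul_apply, smul_eq_mul, Function.comp_apply] at this ⊢
    refine mul_left_cancel₀ h3 ?_
    rw [this]; ring
  have h5 := comp_eq_of_smul_comp_eq hw hk h4
  rw [← inv_eq_one]
  exact Equiv.ext fun i => hinj (congrFun h5 i)

lemma isRationalOn_gaugeAction (σ : Equiv.Perm (Fin 4)) :
    IsRationalOn (arrangement K)ᶜ (fun v => (gaugeAction K σ v : K × K)) := by
  have hpoly : ∀ i, ∃ W : MvPolynomial (Fin 2) K, ∀ v : K × K,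
      MvPolynomial.eval ![v.1, v.2] W = weights (normalForm v) i := by
    have hcross : ∀ a b : K × K, ∃ W : MvPolynomial (Fin 2) K, ∀ v : K × K,
        MvPolynomial.eval ![v.1, v.2] W = cross a b v := fun a b =>
      ⟨MvPolynomial.C (b.1 - a.1) * (MvPolynomial.X 1 - MvPolynomial.C a.2) -
        MvPolynomial.C (b.2 - a.2) * (MvPolynomial.X 0 - MvPolynomial.C a.1), fun v => by
          simp [cross]⟩
    have hneg : ∀ a b : K × K, ∃ W : MvPolynomial (Fin 2) K, ∀ v : K × K,
        MvPolynomial.eval ![v.1, v.2] W = -cross a b v := fun a b => by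
      obtain ⟨W, hW⟩ := hcross a b
      exact ⟨-W, fun v => by simp [hW]⟩
    intro i
    fin_cases i
    exacts [hcross _ _, hneg _ _, hcross _ _,
      ⟨MvPolynomial.C (-cross (vertex K 0) (vertex K 1) (vertex K 2)), fun v => by
        simp [weights, normalForm]⟩]
  choose W hW using hpoly
  refine ⟨-(W (σ⁻¹ 1) + W (σ⁻¹ 2) * MvPolynomial.C (2⁻¹)),
    -(MvPolynomial.C (sqrtThree K / 2) * W (σ⁻¹ 2)), W (σ⁻¹ 3), fun v => ⟨?_, ?_⟩⟩
  · rw [hW]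
    exact ne_zero_of_mem ((weights_normalForm_mem_iff v.1).2 v.2) _
  · simp only [map_neg, map_add, map_mul, MvPolynomial.eval_C, hW, gaugeAction_apply, permFourth,
      fourthPoint, Function.comp_apply, div_eq_mul_inv]

lemma isGaugeAction_gaugeAction : IsGaugeAction (gaugeAction K) := by
  constructor
  · intro σ τ hστ
    have h3 : σ 3 = 3 := by
      have h : ∀ (σ : Equiv.Perm (Fin 4)) (τ : Equiv.Perm (Fin 3)),
          (∀ i : Fin 3, σ i.castSucc = (τ i).castSucc) → σ 3 = 3 := by decide
      exact h σ τ hστ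
    have hv : ∀ (v : K × K) (i : Fin 3), normalForm v i.castSucc = vertex K i := by
      intro v i; fin_cases i <;> rfl
    have hw3 : ∀ v : K × K, weights (normalForm v) 3 ≠ 0 := by
      intro v
      rw [weights_normalForm]
      simpa using sqrtThree_ne_zero K
    obtain ⟨ε, hε, hε'⟩ := weights_comp (K := K) σ
    obtain ⟨A, a0, a1, a2, -⟩ := exists_frame (hw3 (0 : K × K))
    obtain ⟨B, b0, b1, b2, -⟩ := exists_frame (p := normalForm (0 : K × K) ∘ σ) (by
      rw [hε', Pi.smul_apply, Function.comp_apply, h3]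
      exact mul_ne_zero hε (hw3 _))
    have hB : ∀ i : Fin 3, (normalForm (0 : K × K) ∘ σ) i.castSucc = vertex K (τ i) := by
      intro i
      rw [Function.comp_apply, hστ, hv]
    have hT : ∀ i, (A.symm.trans B) (vertex K i) = vertex K (τ i) := by
      intro i
      rw [← hv 0 i, ← hB, AffineEquiv.trans_apply]
      fin_cases i
      · change B (A.symm (normalForm 0 0)) = _
        rw [← a0, AffineEquiv.symm_apply_apply, b0]; rfl
      · change B (A.symm (normalForm 0 1)) = _
        rw [← a1, AffineEquiv.symm_apply_apply, b1]; rfl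
      · change B (A.symm (normalForm 0 2)) = _
        rw [← a2, AffineEquiv.symm_apply_apply, b2]; rfl
    refine ⟨A.symm.trans B, hT, fun v => ?_⟩
    set T : Aff K := A.symm.trans B
    obtain ⟨d, hd, hd'⟩ := weights_affine T
    -- the image under `T` of the quadruple in normal form is a permuted normal form
    have hTv : T ∘ normalForm v.1 = normalForm (T v.1) ∘ σ := by
      funext k
      refine Fin.lastCases ?_ (fun k => ?_) k
      · have h3' : σ (Fin.last 3) = 3 := h3
        rw [Function.comp_apply, Function.comp_apply, h3']; rfl
      · rw [Function.comp_apply, Function.comp_apply, hστ, hv, hv, hT]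
    have hcomp : weights (normalForm (T v.1)) = (ε⁻¹ * d) • (weights (normalForm v.1) ∘ ⇑σ⁻¹) := by
      have e := hε' (normalForm (T v.1))
      rw [← hTv, hd'] at e
      funext i
      have e' := congrFun e (σ⁻¹ i)
      have hi : σ (σ⁻¹ i) = i := σ.apply_symm_apply i
      simp only [Pi.smul_apply, smul_eq_mul, Function.comp_apply, hi] at e' ⊢
      rw [mul_assoc, e', inv_mul_cancel_left₀ hε]
    rw [gaugeAction_apply, permFourth, ← fourthPoint_smul (mul_ne_zero (inv_ne_zero hε) hd),
      ← hcomp, fourthPoint_weights]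
  · intro j v
    rw [gaugeAction_apply, permFourth, weights_normalForm, gauge, Equiv.swap_inv]
    generalize (toEquilateral K).symm v.1 = u
    have : ∀ (s : K) (x : Fin 4 → K) (σ : Equiv.Perm (Fin 4)), (s • x) ∘ σ = s • (x ∘ σ) :=
      fun _ _ _ => rfl
    rw [this, fourthPoint_smul sqrtThree_half_ne_zero]
    fin_cases j <;>
      (ext <;> simp [fourthPoint, gaugeStd, toEquilateral, Equiv.swap_apply_def] <;> ring)

/-- On a line through a vertex the involution is `t ↦ 1 / t`, for the coordinate which is `1` at
the vertex and `0` on the opposite side. -/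
lemma gauge_apply_line (j : Fin 3) (ℓ : K →ᵃ[K] (K × K)) (t : K) (h1 : ℓ 1 = vertex K j)
    (h0 : ℓ 0 ∈ line[K, vertex K (j + 1), vertex K (j + 2)]) (ht : ℓ t ∉ arrangement K) :
    gauge j (ℓ t) = ℓ (1 / t) := by
  have hℓ : ∀ s, ℓ s = AffineMap.lineMap (ℓ 0) (ℓ 1) s := by
    intro s
    rw [← AffineMap.apply_lineMap]
    simp [AffineMap.lineMap_apply]
  obtain ⟨r, hr⟩ := mem_affineSpan_pair_iff_exists_lineMap_eq.1 h0
  set std : Fin 3 → K × K := ![(0, 0), (1, 0), (0, 1)] with hstd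
  have hvert : ∀ i, vertex K i = toEquilateral K (std i) := by
    intro i
    fin_cases i <;> ext <;> simp [vertex, toEquilateral, std]
  set u : K → K × K := fun s => std (j + 1) + r • (std (j + 2) - std (j + 1)) +
    s • (std j - (std (j + 1) + r • (std (j + 2) - std (j + 1)))) with hu
  have hℓu : ∀ s, ℓ s = toEquilateral K (u s) := by
    intro s
    rw [hℓ, ← hr, h1, hvert, hvert, hvert]
    simp only [AffineMap.lineMap_apply, vsub_eq_sub, vadd_eq_add, hu, map_add, map_sub, map_smul]
    module
  rw [hℓu, gauge, LinearEquiv.symm_apply_apply, hℓu]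
  rw [hℓu] at ht
  have ht0 : t ≠ 0 := by
    rintro rfl
    refine ht ⟨_, ?_, rfl⟩
    rw [sixLines, mem_ofPred_eq]
    fin_cases j <;> simp [hu, hstd]
  congr 1
  fin_cases j
  · have e : 1 - ((1 - r) * (1 - t)) - r * (1 - t) = t := by ring
    have h1 : ∀ s, u s = ((1 - r) * (1 - s), r * (1 - s)) := by
      intro s; ext <;> simp [hu, hstd] <;> ring
    rw [h1, h1]
    ext <;> simp only [gaugeStd, Fin.zero_eta, Matrix.cons_val, e] <;> field_simp <;> ring
  · have h1 : ∀ s, u s = (s, (1 - r) * (1 - s)) := by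
      intro s; ext <;> simp [hu, hstd] <;> ring
    rw [h1, h1]
    ext <;> simp only [gaugeStd, Fin.mk_one, Matrix.cons_val] <;> field_simp <;> ring
  · have h1 : ∀ s, u s = (r * (1 - s), s) := by
      intro s; ext <;> simp [hu, hstd] <;> ring
    rw [h1, h1]
    ext <;> simp only [gaugeStd, Fin.reduceFinMk, Matrix.cons_val] <;> field_simp <;> ring

/-! ### The quotient by `Sym(4)` -/

variable (K) in
/-- The class of the quadruple in normal form with fourth point `v`. -/
def ofFourth (v : ((arrangement K)ᶜ : Set (K × K))) : Moduli K := (normalChart K).toModuli v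

lemma ofFourth_eq (v : ((arrangement K)ᶜ : Set (K × K))) :
    ofFourth K v = Moduli.ofOrdered ⟨normalForm v.1, (mem_normalForm_iff _).2 v.2⟩ := by
  rw [ofFourth, WeightChart.toModuli, normalChart_point,
    ofWeights_weights ⟨normalForm v.1, (mem_normalForm_iff _).2 v.2⟩]

lemma continuous_ofFourth : Continuous (ofFourth K) := by
  refine (normalChart K).continuousOn_toModuli.comp_continuous continuous_subtype_val fun v => ?_
  exact mem_domain_normalChart.2 v.2

lemma isOpenMap_ofFourth : IsOpenMap (ofFourth K) := by
  intro W hW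
  have : ofFourth K '' W = (normalChart K).toModuli '' (Subtype.val '' W) := by
    rw [image_image]; rfl
  rw [this]
  refine (normalChart K).isOpen_image ?_ (isOpen_compl_arrangement.isOpenMap_subtype_val W hW)
  rintro _ ⟨v, -, rfl⟩
  exact mem_domain_normalChart.2 v.2

lemma ofFourth_surjective : Function.Surjective (ofFourth K) := by
  intro z
  obtain ⟨w, hw, rfl⟩ := exists_weights z
  refine ⟨⟨fourthPoint w, fourthPoint_notMem hw⟩, ?_⟩
  rw [ofFourth, WeightChart.toModuli, normalChart_point,
    weights_normalForm_fourthPoint hw.1 (ne_zero_of_mem hw 3)]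
  exact ofWeights_smul_comp hw
    (div_ne_zero (neg_ne_zero.2 sqrtThree_half_ne_zero) (ne_zero_of_mem hw 3)) 1

lemma ofFourth_eq_iff (v v' : ((arrangement K)ᶜ : Set (K × K))) :
    ofFourth K v = ofFourth K v' ↔ ∃ σ, gaugeAction K σ v = v' := by
  have hv := (weights_normalForm_mem_iff v.1).2 v.2
  have hv' := (weights_normalForm_mem_iff v'.1).2 v'.2
  simp only [ofFourth, WeightChart.toModuli, normalChart_point]
  rw [ofWeights_eq_iff hv hv']
  constructor
  · rintro ⟨σ, k, hk, h⟩
    refine ⟨σ⁻¹, Subtype.ext ?_⟩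
    rw [gaugeAction_apply, permFourth, inv_inv, ← fourthPoint_smul hk, ← h, fourthPoint_weights]
  · rintro ⟨σ, rfl⟩
    obtain ⟨k, hk, h⟩ := weights_permFourth σ v.2
    exact ⟨σ⁻¹, k, hk, h⟩

variable (K) in
/-- The bijection of the quotient of the complement of the arrangement with the moduli space. -/
def quotientEquiv : Quotient (orbitSetoid (gaugeAction K)) ≃ Moduli K :=
  Equiv.ofBijective
    (Quotient.lift (ofFourth K) fun v v' h => (ofFourth_eq_iff v v').2 h) (by
      refine ⟨?_, fun z => ?_⟩
      · rintro ⟨v⟩ ⟨v'⟩ h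
        exact Quotient.sound ((ofFourth_eq_iff v v').1 h)
      · obtain ⟨v, rfl⟩ := ofFourth_surjective z
        exact ⟨Quotient.mk _ v, rfl⟩)

lemma quotientEquiv_symm (v : ((arrangement K)ᶜ : Set (K × K))) :
    (quotientEquiv K).symm (ofFourth K v) = Quotient.mk _ v := by
  rw [Equiv.symm_apply_eq]; rfl

variable (K) in
/-- The identification of the quotient of the complement of the arrangement with the moduli
space. -/
def quotientHomeomorph : Quotient (orbitSetoid (gaugeAction K)) ≃ₜ Moduli K where
  toEquiv := quotientEquiv K
  continuous_toFun := continuous_ofFourth.quotient_lift fun v v' h => (ofFourth_eq_iff v v').2 h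
  continuous_invFun := by
    rw [continuous_def]
    intro O hO
    have hO' : IsOpen (Quotient.mk (orbitSetoid (gaugeAction K)) ⁻¹' O) :=
      hO.preimage continuous_quotient_mk'
    convert isOpenMap_ofFourth _ hO' using 1
    ext z
    obtain ⟨v, rfl⟩ := ofFourth_surjective z
    change (quotientEquiv K).symm (ofFourth K v) ∈ O ↔ _
    rw [quotientEquiv_symm]
    constructor
    · intro h; exact ⟨v, h, rfl⟩
    · rintro ⟨v', h, hv⟩
      rw [← quotientEquiv_symm, ← hv, quotientEquiv_symm]; exact h

lemma quotientHomeomorph_mk (v : ((arrangement K)ᶜ : Set (K × K))) :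
    quotientHomeomorph K (Quotient.mk _ v) = ofFourth K v := rfl

lemma quotientHomeomorph_symm (v : ((arrangement K)ᶜ : Set (K × K))) :
    (quotientHomeomorph K).symm (ofFourth K v) = Quotient.mk _ v := by
  rw [← quotientHomeomorph_mk, Homeomorph.symm_apply_apply]

lemma range_normalForm (v : K × K) : range (normalForm v) = insert v (range (vertex K)) := by
  ext x
  simp only [mem_range, mem_insert_iff]
  constructor
  · rintro ⟨i, rfl⟩
    fin_cases i
    exacts [Or.inr ⟨0, rfl⟩, Or.inr ⟨1, rfl⟩, Or.inr ⟨2, rfl⟩, Or.inl rfl]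
  · rintro (rfl | ⟨i, rfl⟩)
    · exact ⟨3, rfl⟩
    · fin_cases i
      exacts [⟨0, rfl⟩, ⟨1, rfl⟩, ⟨2, rfl⟩]

lemma exists_normalForm (P : GenericConf K) : ∃ (T : Aff K) (v : K × K),
    T '' P.1.points = insert v (range (vertex K)) := by
  obtain ⟨P, hP⟩ := P
  obtain ⟨p, rfl⟩ := Quotient.exists_rep P
  have hp := (mem_orderedGeneric_iff p.1).1 ⟨p.2, hP⟩
  have h3 := ne_zero_of_mem hp 3
  obtain ⟨T, hT⟩ := exists_affine
    (div_ne_zero (neg_ne_zero.2 sqrtThree_half_ne_zero) h3) h3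
    (weights_normalForm_fourthPoint hp.1 h3)
  refine ⟨T, fourthPoint (weights p.1), ?_⟩
  rw [← range_normalForm, ← hT, range_comp]
  rfl

lemma injective_of_range_eq {α β : Type*} [Finite α] {p q : α → β} (hp : Function.Injective p)
    (h : range p = range q) : Function.Injective q := by
  have hq : ∀ i, ∃ j, p j = q i := fun i => by
    have : q i ∈ range p := h ▸ mem_range_self i
    exact this
  choose g hg using hq
  have hs : Function.Surjective g := by
    intro j
    obtain ⟨i, hi⟩ : p j ∈ range q := h ▸ mem_range_self j
    exact ⟨i, hp (by rw [hg, hi])⟩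
  have : q = p ∘ g := funext fun i => (hg i).symm
  rw [this]
  exact hp.comp (Finite.injective_iff_surjective.2 hs)

lemma symm_proj_eq (P : GenericConf K) (T : Aff K) (v : K × K)
    (h : T '' P.1.points = insert v (range (vertex K))) : ∃ hv : v ∉ arrangement K,
      (quotientHomeomorph K).symm (Moduli.proj P) =
        Quotient.mk (orbitSetoid (gaugeAction K)) ⟨v, hv⟩ := by
  obtain ⟨P, hP⟩ := P
  obtain ⟨p, rfl⟩ := Quotient.exists_rep P
  have hp := (mem_orderedGeneric_iff p.1).1 ⟨p.2, hP⟩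
  have hr : range (T ∘ p.1) = range (normalForm v) := by
    rw [range_normalForm, ← h, range_comp]; rfl
  have hinj := injective_of_range_eq (T.injective.comp p.2) hr
  obtain ⟨σ, hσ⟩ := exists_perm_of_range_eq (T.injective.comp p.2) hinj hr
  have hv : v ∉ arrangement K := by
    obtain ⟨d, hd, hd'⟩ := weights_affine T
    obtain ⟨ε, hε, hε'⟩ := weights_comp (K := K) σ
    rw [← weights_normalForm_mem_iff, ← genericWeights_comp σ, ← genericWeights_smul hε, ← hε', hσ,
      hd', genericWeights_smul hd]
    exact hp
  refine ⟨hv, ?_⟩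
  rw [← quotientHomeomorph_symm, ofFourth_eq]
  congr 1
  rw [Moduli.ofOrdered, proj_eq_iff]
  refine ⟨T, ?_⟩
  rw [h, points_mk, range_normalForm]

lemma isAnalyticFunAt_quotient (F : Quotient (orbitSetoid (gaugeAction K)) → K) (z : Moduli K) :
    Moduli.IsAnalyticFunAt (F ∘ (quotientHomeomorph K).symm) z ↔
      DescendsAnalyticAt (Quotient.mk (orbitSetoid (gaugeAction K))) F
        ((quotientHomeomorph K).symm z) := by
  have key : ∀ v : ((arrangement K)ᶜ : Set (K × K)),
      Moduli.IsAnalyticFunAt (F ∘ (quotientHomeomorph K).symm) (ofFourth K v) ↔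
        AnalyticAt K (Function.extend Subtype.val
          (F ∘ Quotient.mk (orbitSetoid (gaugeAction K))) 0) (v : K × K) := by
    intro v
    rw [ofFourth, (normalChart K).isAnalyticFunAt_iff (mem_domain_normalChart.2 v.2)]
    refine analyticAt_congr ?_
    filter_upwards [isOpen_compl_arrangement.mem_nhds v.2] with u hu
    have e := Subtype.val_injective.extend_apply
      (F ∘ Quotient.mk (orbitSetoid (gaugeAction K))) 0
      (⟨u, hu⟩ : ((arrangement K)ᶜ : Set (K × K)))
    rw [e]
    exact congrArg F (quotientHomeomorph_symm ⟨u, hu⟩)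
  constructor
  · intro h v hv
    have hz : z = ofFourth K v := by
      rw [← quotientHomeomorph_mk, hv, Homeomorph.apply_symm_apply]
    rw [← key, ← hz]; exact h
  · intro h
    obtain ⟨v, rfl⟩ := ofFourth_surjective z
    rw [key]
    exact h v (quotientHomeomorph_symm v).symm

lemma secondCountableTopology_moduli : SecondCountableTopology (Moduli K) := by
  have h : IsOpenQuotientMap (ofFourth K) :=
    ⟨ofFourth_surjective, continuous_ofFourth, isOpenMap_ofFourth⟩
  exact h.isQuotientMap.secondCountableTopology h.isOpenMap

end Gauge

/-! ### Symmetric functions of the weights -/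

section Invariants

variable {K : Type*} [RCLike K]

/-- The sum of the squares and the product of the coordinates of the normalized weights. -/
def weightInvariants (w : Fin 4 → K) : K × K := (∑ i, normalized w i ^ 2, ∏ i, normalized w i)

lemma weightInvariants_smul_comp {w : Fin 4 → K} (hw : w ∈ genericWeights K) {k : K} (hk : k ≠ 0)
    (σ : Equiv.Perm (Fin 4)) : weightInvariants (k • (w ∘ σ)) = weightInvariants w := by
  rw [weightInvariants, normalized_smul_comp hw hk]
  simp only [Function.comp_apply]
  rw [Equiv.sum_comp σ (fun i => normalized w i ^ 2), Equiv.prod_comp σ (normalized w)]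
  rfl

lemma normalized_mem {w : Fin 4 → K} (hw : w ∈ genericWeights K) :
    normalized w ∈ genericWeights K :=
  (genericWeights_smul (normalized_factor_ne_zero hw)).2 hw

lemma sum_cube_normalized {w : Fin 4 → K} (hw : w ∈ genericWeights K) :
    ∑ i, normalized w i ^ 3 = ∏ i, normalized w i := by
  have h4 := hw.2.2
  simp only [normalized, Pi.smul_apply, smul_eq_mul, mul_pow, ← Finset.mul_sum,
    Finset.prod_mul_distrib, Finset.prod_const, Finset.card_univ, Fintype.card_fin]
  field_simp

lemma normalized_eq_self {w : Fin 4 → K} (hw : w ∈ genericWeights K)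
    (h : ∑ i, w i ^ 3 = ∏ i, w i) : normalized w = w := by
  rw [normalized, h, div_self hw.2.2, one_smul]

lemma ofWeights_normalized {w : Fin 4 → K} (hw : w ∈ genericWeights K) :
    ofWeights (normalized w) = ofWeights w :=
  ofWeights_smul_comp hw (normalized_factor_ne_zero hw) 1

/-- The two numerical invariants of a generic configuration. -/
def invariants (z : Moduli K) : K × K := weightInvariants (exists_weights z).choose

lemma invariants_ofWeights {w : Fin 4 → K} (hw : w ∈ genericWeights K) :
    invariants (ofWeights w) = weightInvariants w := by
  obtain ⟨h1, h2⟩ := (exists_weights (ofWeights w)).choose_spec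
  obtain ⟨σ, k, hk, h⟩ := (ofWeights_eq_iff hw h1).1 h2.symm
  rw [invariants, h, weightInvariants_smul_comp hw hk]

lemma continuousOn_weightInvariants :
    ContinuousOn (weightInvariants (K := K)) (genericWeights K) := by
  have h := fun i => continuousOn_pi.1 (continuousOn_normalized (K := K)) i
  exact (continuousOn_finsetSum _ fun i _ => (h i).pow 2).prodMk
    (continuousOn_finsetProd _ fun i _ => h i)

lemma continuous_invariants : Continuous (invariants (K := K)) := by
  rw [continuous_def]
  intro O hO
  refine isOpen_of_preimage_ofOrdered ?_
  have hc : Continuous fun p : orderedGeneric K => weightInvariants (weights p.1) :=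
    continuousOn_weightInvariants.comp_continuous (continuous_weights.comp continuous_subtype_val)
      fun p => (mem_orderedGeneric_iff _).1 p.2
  convert hO.preimage hc using 1
  ext p
  simp only [mem_preimage, ← ofWeights_weights,
    invariants_ofWeights ((mem_orderedGeneric_iff _).1 p.2)]

open Polynomial in
/-- Newton's identities for four numbers with sum zero. -/
lemma prod_X_sub_C_eq {w : Fin 4 → K} (h : ∑ i, w i = 0) : ∏ i, (X - C (w i)) =
    X ^ 4 - C ((∑ i, w i ^ 2) / 2) * X ^ 2 - C ((∑ i, w i ^ 3) / 3) * X + C (∏ i, w i) := by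
  rw [Fin.sum_univ_four] at h
  have h3 : w 3 = -(w 0 + w 1 + w 2) := by linear_combination h
  have e2 : (∑ i, w i ^ 2) / 2 =
      w 0 * w 0 + w 1 * w 1 + w 2 * w 2 + w 0 * w 1 + w 0 * w 2 + w 1 * w 2 := by
    rw [Fin.sum_univ_four, h3]; ring
  have e3 : (∑ i, w i ^ 3) / 3 = -((w 0 + w 1) * (w 0 + w 2) * (w 1 + w 2)) := by
    rw [Fin.sum_univ_four, h3]; ring
  rw [e2, e3, Fin.prod_univ_four, Fin.prod_univ_four, h3]
  simp only [map_add, map_mul, map_neg]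
  ring

open Polynomial in
lemma exists_perm_of_sums_eq {w w' : Fin 4 → K} (h : ∑ i, w i = 0) (h' : ∑ i, w' i = 0)
    (h2 : ∑ i, w i ^ 2 = ∑ i, w' i ^ 2) (h3 : ∑ i, w i ^ 3 = ∑ i, w' i ^ 3)
    (h4 : ∏ i, w i = ∏ i, w' i) : ∃ σ : Equiv.Perm (Fin 4), w' = w ∘ σ := by
  have hp : ∏ i, (X - C (w i)) = ∏ i, (X - C (w' i)) := by
    rw [prod_X_sub_C_eq h, prod_X_sub_C_eq h', h2, h3, h4]
  have hr := congrArg Polynomial.roots hp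
  rw [Polynomial.roots_prod _ _ (Finset.prod_ne_zero_iff.2 fun i _ => X_sub_C_ne_zero _),
    Polynomial.roots_prod _ _ (Finset.prod_ne_zero_iff.2 fun i _ => X_sub_C_ne_zero _)] at hr
  simp only [roots_X_sub_C, Multiset.bind_singleton] at hr
  classical
  have hc : ∀ a, Fintype.card {i // w' i = a} = Fintype.card {i // w i = a} := by
    intro a
    have := congrArg (Multiset.count a) hr
    rw [Multiset.count_map, Multiset.count_map] at this
    simp only [Fintype.card_subtype, Finset.card_def, Finset.filter_val, eq_comm (b := a)]
    exact this.symm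
  exact ⟨Equiv.ofFiberEquiv fun a => Fintype.equivOfCardEq (hc a),
    funext fun i => (Equiv.ofFiberEquiv_map _ i).symm⟩

lemma invariants_injective : Function.Injective (invariants (K := K)) := by
  intro z z' h
  obtain ⟨w, hw, rfl⟩ := exists_weights z
  obtain ⟨w', hw', rfl⟩ := exists_weights z'
  rw [invariants_ofWeights hw, invariants_ofWeights hw', weightInvariants, weightInvariants,
    Prod.mk.injEq] at h
  obtain ⟨σ, hσ⟩ := exists_perm_of_sums_eq (normalized_mem hw).1 (normalized_mem hw').1 h.1
    (by rw [sum_cube_normalized hw, sum_cube_normalized hw', h.2]) h.2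
  rw [← ofWeights_normalized hw, ← ofWeights_normalized hw', hσ]
  have := ofWeights_smul_comp (normalized_mem hw) one_ne_zero σ
  rw [one_smul] at this
  exact this.symm

lemma invariants_snd_ne_zero (z : Moduli K) : (invariants z).2 ≠ 0 := by
  obtain ⟨w, hw, rfl⟩ := exists_weights z
  rw [invariants_ofWeights hw]
  exact (normalized_mem hw).2.2

instance t2Space_moduli : T2Space (Moduli K) :=
  T2Space.of_injective_continuous invariants_injective continuous_invariants

lemma isAnalyticSurface : IsAnalyticSurface (Moduli.IsAnalyticFunAt (K := K)) := by
  refine ⟨t2Space_moduli, secondCountableTopology_moduli, fun z => ?_⟩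
  rcases hasLocalModel_trichotomy z with h | h | h
  exacts [⟨_, inferInstance, h⟩, ⟨_, finite_reflectionGroup, h⟩, ⟨_, finite_triangleGroup, h⟩]

end Invariants

/-! ### Convex and non-convex configurations -/

section Convexity

lemma sum_weights_smul {K : Type*} [RCLike K] (p : Fin 4 → K × K) :
    ∑ i, weights p i • p i = 0 := by
  rw [Fin.sum_univ_four]
  ext <;> simp [weights, cross] <;> ring

/-- The weights of a quadruple of points span its affine dependencies. -/
lemma dependency_proportional {K : Type*} [RCLike K] {p : Fin 4 → K × K} {μ : Fin 4 → K}
    (h : ∑ i, μ i = 0) (hp : ∑ i, μ i • p i = 0) (i j : Fin 4) :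
    μ i * weights p j = μ j * weights p i := by
  rw [Fin.sum_univ_four] at h hp
  have hx := congrArg Prod.fst hp
  have hy := congrArg Prod.snd hp
  simp only [Prod.fst_add, Prod.snd_add, Prod.smul_fst, Prod.smul_snd, smul_eq_mul, Prod.fst_zero,
    Prod.snd_zero] at hx hy
  have h0 : μ 0 = -(μ 1 + μ 2 + μ 3) := by linear_combination h
  have hX : μ 1 * ((p 1).1 - (p 0).1) + μ 2 * ((p 2).1 - (p 0).1) +
      μ 3 * ((p 3).1 - (p 0).1) = 0 := by linear_combination hx - (p 0).1 * h
  have hY : μ 1 * ((p 1).2 - (p 0).2) + μ 2 * ((p 2).2 - (p 0).2) +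
      μ 3 * ((p 3).2 - (p 0).2) = 0 := by linear_combination hy - (p 0).2 * h
  have w1 : weights p 1 = -cross (p 0) (p 2) (p 3) := rfl
  have w2 : weights p 2 = cross (p 0) (p 1) (p 3) := rfl
  have w3 : weights p 3 = -cross (p 0) (p 1) (p 2) := rfl
  have w0 : weights p 0 = -(weights p 1 + weights p 2 + weights p 3) := by
    have := sum_weights p
    rw [Fin.sum_univ_four] at this
    linear_combination this
  have h12 : μ 1 * weights p 2 = μ 2 * weights p 1 := by
    rw [w1, w2, cross, cross]
    linear_combination ((p 3).2 - (p 0).2) * hX - ((p 3).1 - (p 0).1) * hY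
  have h13 : μ 1 * weights p 3 = μ 3 * weights p 1 := by
    rw [w1, w3, cross, cross]
    linear_combination -((p 2).2 - (p 0).2) * hX + ((p 2).1 - (p 0).1) * hY
  have h23 : μ 2 * weights p 3 = μ 3 * weights p 2 := by
    rw [w2, w3, cross, cross]
    linear_combination ((p 1).2 - (p 0).2) * hX - ((p 1).1 - (p 0).1) * hY
  have h01 : μ 0 * weights p 1 = μ 1 * weights p 0 := by
    rw [h0, w0]; linear_combination h12 + h13
  have h02 : μ 0 * weights p 2 = μ 2 * weights p 0 := by
    rw [h0, w0]; linear_combination -h12 + h23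
  have h03 : μ 0 * weights p 3 = μ 3 * weights p 0 := by
    rw [h0, w0]; linear_combination -h13 - h23
  fin_cases i <;> fin_cases j <;> first | rfl | assumption | (symm; assumption)

lemma prod_neg_iff {w : Fin 4 → ℝ} (h0 : ∀ i, w i ≠ 0) :
    ∏ i, w i < 0 ↔ ∃ i, ∀ j, j ≠ i → w j * w i < 0 := by
  have key : ∀ s : Fin 4 → SignType, (∀ i, s i ≠ 0) →
      (∏ i, s i = -1 ↔ ∃ i, ∀ j, j ≠ i → s j * s i = -1) := by decide
  have h := key (fun i => SignType.sign (w i)) fun i => sign_ne_zero.2 (h0 i)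
  simp only [← sign_mul, sign_eq_neg_one_iff] at h
  rw [← h, ← sign_eq_neg_one_iff]
  exact Eq.congr_left (map_prod signHom w Finset.univ)

/-- Four points in general position are convex exactly when an even number of their weights are
positive. -/
lemma convexIndependent_iff_prod_pos {p : Fin 4 → ℝ × ℝ} (hp : p ∈ orderedGeneric ℝ) :
    ConvexIndependent ℝ ((↑) : range p → ℝ × ℝ) ↔ 0 < ∏ i, weights p i := by
  have hw := (mem_orderedGeneric_iff p).1 hp
  have h0 := ne_zero_of_mem hw
  rw [← not_iff_not, not_lt, le_iff_lt_or_eq, or_iff_left hw.2.2, prod_neg_iff h0,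
    hp.1.convexIndependent_iff_set, convexIndependent_iff_notMem_convexHull_sdiff]
  push Not
  constructor
  · rintro ⟨i, s, h⟩
    have h' : p i ∈ convexHull ℝ (((Finset.univ.erase i).image p : Finset (ℝ × ℝ)) :
        Set (ℝ × ℝ)) := by
      refine convexHull_mono ?_ h
      rintro _ ⟨j, hj, rfl⟩
      exact Finset.mem_coe.2 (Finset.mem_image_of_mem _ (Finset.mem_erase.2 ⟨hj.2, by simp⟩))
    rw [Finset.mem_convexHull'] at h'
    obtain ⟨μ, h1, h2, h3⟩ := h'
    rw [Finset.sum_image hp.1.injOn] at h2 h3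
    refine ⟨i, fun j hj => ?_⟩
    -- the dependency given by the convex combination
    set ν : Fin 4 → ℝ := Function.update (μ ∘ p) i (-1) with hν
    have hνi : ν i = -1 := by simp [hν]
    have hνj : ∀ k ∈ Finset.univ.erase i, ν k = μ (p k) := fun k hk => by
      simp [hν, Finset.ne_of_mem_erase hk]
    have s1 : ∑ k, ν k = 0 := by
      rw [← Finset.add_sum_erase _ _ (Finset.mem_univ i), Finset.sum_congr rfl hνj, h2, hνi]
      norm_num
    have s2 : ∑ k, ν k • p k = 0 := by
      rw [← Finset.add_sum_erase _ _ (Finset.mem_univ i),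
        Finset.sum_congr rfl fun k hk => by rw [hνj k hk], h3, hνi]
      simp
    have s3 := dependency_proportional s1 s2 i j
    have hj' : j ∈ Finset.univ.erase i := Finset.mem_erase.2 ⟨hj, by simp⟩
    rw [hνi, hνj j hj'] at s3
    have hpos := h1 _ (Finset.mem_image_of_mem p hj')
    have h4 : weights p j * weights p i = -(μ (p j) * (weights p i) ^ 2) := by
      linear_combination -(weights p i) * s3
    refine lt_of_le_of_ne ?_ (mul_ne_zero (h0 j) (h0 i))
    rw [h4]
    exact neg_nonpos.2 (mul_nonneg hpos (sq_nonneg _))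
  · rintro ⟨i, hi⟩
    refine ⟨i, univ, ?_⟩
    have e1 := sum_weights p
    have e2 := sum_weights_smul p
    rw [← Finset.add_sum_erase _ _ (Finset.mem_univ i)] at e1 e2
    have hpi : p i = ∑ j ∈ Finset.univ.erase i, (-weights p j / weights p i) • p j := by
      have : ∀ j, (-weights p j / weights p i) • p j =
          (-(weights p i)⁻¹) • (weights p j • p j) := by
        intro j; rw [smul_smul]; congr 1; ring
      simp only [this, ← Finset.smul_sum]
      rw [← neg_eq_iff_add_eq_zero.2 e2]
      simp [smul_smul, h0 i]
    rw [hpi]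
    refine (convex_convexHull ℝ _).sum_mem (fun j hj => ?_) ?_ fun j hj => ?_
    · have := hi j (Finset.ne_of_mem_erase hj)
      have h2 : -weights p j / weights p i = -(weights p j * weights p i) / (weights p i) ^ 2 := by
        have := h0 i
        field_simp
      rw [h2]
      exact div_nonneg (neg_nonneg.2 this.le) (sq_nonneg _)
    · rw [← Finset.sum_div, Finset.sum_neg_distrib, div_eq_one_iff_eq (h0 i)]
      linarith
    · exact subset_convexHull ℝ _ (mem_image_of_mem p ⟨mem_univ _, Finset.ne_of_mem_erase hj⟩)

lemma invariants_snd_pos_iff {w : Fin 4 → ℝ} (hw : w ∈ genericWeights ℝ) :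
    0 < (invariants (ofWeights w)).2 ↔ 0 < ∏ i, w i := by
  have h4 := hw.2.2
  rw [invariants_ofWeights hw]
  simp only [weightInvariants, normalized, Pi.smul_apply, smul_eq_mul, Finset.prod_mul_distrib,
    Finset.prod_const, Finset.card_univ, Fintype.card_fin]
  exact mul_pos_iff_of_pos_left ((even_two_mul 2).pow_pos (normalized_factor_ne_zero hw))

lemma mem_convexClasses_aux (z : Moduli ℝ) :
    (z ∈ convexClasses ↔ 0 < (invariants z).2) ∧ (z ∈ nonConvexClasses ↔ (invariants z).2 < 0) := by
  have key : ∀ P : GenericConf ℝ, ConvexIndependent ℝ ((↑) : P.1.points → ℝ × ℝ) ↔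
      0 < (invariants (Moduli.proj P)).2 := by
    rintro ⟨P, hP⟩
    obtain ⟨p, rfl⟩ := Quotient.exists_rep P
    have hp : p.1 ∈ orderedGeneric ℝ := ⟨p.2, hP⟩
    have := ofWeights_weights ⟨p.1, hp⟩
    rw [Moduli.ofOrdered] at this
    rw [← this, invariants_snd_pos_iff ((mem_orderedGeneric_iff _).1 hp)]
    exact convexIndependent_iff_prod_pos hp
  have hne := invariants_snd_ne_zero z
  obtain ⟨P, rfl⟩ : ∃ P, Moduli.proj P = z := Quotient.exists_rep z
  constructor
  · constructor
    · rintro ⟨Q, hQ, h⟩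
      rw [← h]; exact (key Q).1 hQ
    · intro h
      exact ⟨P, (key P).2 h, rfl⟩
  · constructor
    · rintro ⟨Q, hQ, h⟩
      rw [← h] at hne ⊢
      exact lt_of_le_of_ne (not_lt.1 fun h' => hQ ((key Q).2 h')) hne
    · intro h
      exact ⟨P, fun h' => lt_asymm h ((key P).1 h'), rfl⟩

lemma mem_convexClasses_iff (z : Moduli ℝ) : z ∈ convexClasses ↔ 0 < (invariants z).2 :=
  (mem_convexClasses_aux z).1

lemma mem_nonConvexClasses_iff (z : Moduli ℝ) : z ∈ nonConvexClasses ↔ (invariants z).2 < 0 :=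
  (mem_convexClasses_aux z).2

lemma disjoint_convexClasses : Disjoint convexClasses nonConvexClasses := by
  rw [Set.disjoint_left]
  intro z h h'
  rw [mem_convexClasses_iff] at h
  rw [mem_nonConvexClasses_iff] at h'
  exact lt_asymm h h'

lemma convexClasses_union : convexClasses ∪ nonConvexClasses = univ := by
  ext z
  simp only [mem_union, mem_convexClasses_iff, mem_nonConvexClasses_iff, mem_univ, iff_true]
  exact (invariants_snd_ne_zero z).lt_or_gt.symm

lemma isOpen_convexClasses : IsOpen convexClasses := by
  have : convexClasses = {z | 0 < (invariants z).2} := by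
    ext z; exact mem_convexClasses_iff z
  rw [this]
  exact isOpen_lt continuous_const (continuous_snd.comp continuous_invariants)

lemma isOpen_nonConvexClasses : IsOpen nonConvexClasses := by
  have : nonConvexClasses = {z | (invariants z).2 < 0} := by
    ext z; exact mem_nonConvexClasses_iff z
  rw [this]
  exact isOpen_lt (continuous_snd.comp continuous_invariants) continuous_const

/-- Weights of convex quadrilaterals, ordered so that the first one dominates. -/
def convexWeights : Set (Fin 4 → ℝ) :=
  {w | ∑ i, w i = 0 ∧ 0 < w 1 ∧ w 2 < 0 ∧ w 3 < 0 ∧ 0 < w 0 + w 2 ∧ 0 < w 0 + w 3}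

/-- Weights of the quadruples whose last point is in the interior of the triangle of the others. -/
def nonConvexWeights : Set (Fin 4 → ℝ) :=
  {w | ∑ i, w i = 0 ∧ 0 < w 0 ∧ 0 < w 1 ∧ 0 < w 2}

lemma convex_convexWeights : Convex ℝ convexWeights := by
  rintro x ⟨hx0, hx1, hx2, hx3, hx4, hx5⟩ y ⟨hy0, hy1, hy2, hy3, hy4, hy5⟩ a b ha hb hab
  have hpos : ∀ s t : ℝ, 0 < s → 0 < t → 0 < a * s + b * t := by
    intro s t hs ht
    rcases ha.eq_or_lt with rfl | ha'
    · rw [zero_add] at hab; subst hab; simpa using ht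
    · exact add_pos_of_pos_of_nonneg (mul_pos ha' hs) (mul_nonneg hb ht.le)
  simp only [convexWeights, mem_ofPred_eq, Pi.add_apply, Pi.smul_apply, smul_eq_mul,
    Finset.sum_add_distrib, ← Finset.mul_sum, hx0, hy0]
  refine ⟨by simp, hpos _ _ hx1 hy1, ?_, ?_, ?_, ?_⟩
  · linarith [hpos _ _ (neg_pos.2 hx2) (neg_pos.2 hy2)]
  · linarith [hpos _ _ (neg_pos.2 hx3) (neg_pos.2 hy3)]
  · linarith [hpos _ _ hx4 hy4]
  · linarith [hpos _ _ hx5 hy5]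

lemma convex_nonConvexWeights : Convex ℝ nonConvexWeights := by
  rintro x ⟨hx0, hx1, hx2, hx3⟩ y ⟨hy0, hy1, hy2, hy3⟩ a b ha hb hab
  have hpos : ∀ s t : ℝ, 0 < s → 0 < t → 0 < a * s + b * t := by
    intro s t hs ht
    rcases ha.eq_or_lt with rfl | ha'
    · rw [zero_add] at hab; subst hab; simpa using ht
    · exact add_pos_of_pos_of_nonneg (mul_pos ha' hs) (mul_nonneg hb ht.le)
  simp only [nonConvexWeights, mem_ofPred_eq, Pi.add_apply, Pi.smul_apply, smul_eq_mul,
    Finset.sum_add_distrib, ← Finset.mul_sum, hx0, hy0]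
  exact ⟨by simp, hpos _ _ hx1 hy1, hpos _ _ hx2 hy2, hpos _ _ hx3 hy3⟩

lemma convexWeights_spec {w : Fin 4 → ℝ} (h : w ∈ convexWeights) :
    w ∈ genericWeights ℝ ∧ 0 < ∏ i, w i := by
  obtain ⟨h0, h1, h2, h3, h4, h5⟩ := h
  have hs := h0
  rw [Fin.sum_univ_four] at hs
  have hp : 0 < ∏ i, w i := by
    rw [Fin.prod_univ_four, mul_assoc]
    exact mul_pos (mul_pos (by linarith) h1) (mul_pos_of_neg_of_neg h2 h3)
  refine ⟨⟨h0, ?_, hp.ne'⟩, hp⟩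
  rw [sum_cube_eq h0]
  have : 0 < w 0 + w 1 := by linarith
  positivity

lemma nonConvexWeights_spec {w : Fin 4 → ℝ} (h : w ∈ nonConvexWeights) :
    w ∈ genericWeights ℝ ∧ ∏ i, w i < 0 := by
  obtain ⟨h0, h1, h2, h3⟩ := h
  have hs := h0
  rw [Fin.sum_univ_four] at hs
  have hp : ∏ i, w i < 0 := by
    rw [Fin.prod_univ_four]
    exact mul_neg_of_pos_of_neg (by positivity) (by linarith)
  refine ⟨⟨h0, ?_, hp.ne⟩, hp⟩
  rw [sum_cube_eq h0]
  have : w 0 + w 3 < 0 := by linarith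
  exact mul_ne_zero three_ne_zero (mul_ne_zero (by positivity) this.ne)

lemma sign_prod_four (w : Fin 4 → ℝ) :
    ∏ i, SignType.sign (w i) = SignType.sign (∏ i, w i) :=
  (map_prod signHom w Finset.univ).symm

lemma convexClasses_eq_image : convexClasses = ofWeights '' convexWeights := by
  ext z
  constructor
  · intro hz
    obtain ⟨w, hw, rfl⟩ := exists_weights z
    rw [mem_convexClasses_iff, invariants_snd_pos_iff hw] at hz
    obtain ⟨i, -, hi⟩ := Finset.exists_max_image Finset.univ (fun i => |w i|) Finset.univ_nonempty
    have h0 := ne_zero_of_mem hw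
    -- two weights are positive and two are negative
    have comb : ∀ s : Fin 4 → SignType, (∀ i, s i ≠ 0) → ∏ i, s i = 1 → (∃ j, s j ≠ s 0) →
        ∀ i, ∃ σ : Equiv.Perm (Fin 4), σ 0 = i ∧ s (σ 1) = s i ∧ s (σ 2) = -s i ∧
          s (σ 3) = -s i := by decide +kernel
    obtain ⟨σ, rfl, h1, h2, h3⟩ := comb (fun i => SignType.sign (w i))
      (fun i => sign_ne_zero.2 (h0 i)) ((sign_prod_four w).trans (sign_eq_one_iff.2 hz)) (by
        by_contra hcon
        push Not at hcon
        have hs := hw.1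
        rcases (h0 0).lt_or_gt with hneg | hpos
        · have : ∀ j, w j < 0 := fun j => by
            rw [← sign_eq_neg_one_iff, hcon j, sign_eq_neg_one_iff]; exact hneg
          exact (Finset.sum_neg (fun j _ => this j) Finset.univ_nonempty).ne hs
        · have : ∀ j, 0 < w j := fun j => by
            rw [← sign_eq_one_iff, hcon j, sign_eq_one_iff]; exact hpos
          exact (Finset.sum_pos (fun j _ => this j) Finset.univ_nonempty).ne' hs) i
    have hw' := (genericWeights_comp σ).2 hw
    have hne := ((mem_genericWeights_iff hw'.1).1 hw').2
    simp only [Function.comp_apply] at hne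
    have hm2 := hi (σ 2) (Finset.mem_univ _)
    have hm3 := hi (σ 3) (Finset.mem_univ _)
    rcases (h0 (σ 0)).lt_or_gt with hneg | hpos
    · refine ⟨(-1 : ℝ) • (w ∘ σ), ?_, ofWeights_smul_comp hw (by norm_num) σ⟩
      rw [sign_neg hneg] at h1 h2 h3
      simp only [neg_neg, sign_eq_neg_one_iff, sign_eq_one_iff] at h1 h2 h3
      rw [abs_of_pos h2, abs_of_neg hneg] at hm2
      rw [abs_of_pos h3, abs_of_neg hneg] at hm3
      refine ⟨?_, ?_, ?_, ?_, ?_, ?_⟩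
      · exact ((genericWeights_smul (by norm_num)).2 hw').1
      · simpa using h1
      · simpa using h2
      · simpa using h3
      · have : w (σ 0) + w (σ 2) < 0 := lt_of_le_of_ne (by linarith) (hne 0 2 (by decide))
        simp; linarith
      · have : w (σ 0) + w (σ 3) < 0 := lt_of_le_of_ne (by linarith) (hne 0 3 (by decide))
        simp; linarith
    · refine ⟨(1 : ℝ) • (w ∘ σ), ?_, ofWeights_smul_comp hw one_ne_zero σ⟩
      rw [sign_pos hpos] at h1 h2 h3
      simp only [sign_eq_neg_one_iff, sign_eq_one_iff] at h1 h2 h3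
      rw [abs_of_neg h2, abs_of_pos hpos] at hm2
      rw [abs_of_neg h3, abs_of_pos hpos] at hm3
      rw [one_smul]
      refine ⟨hw'.1, h1, h2, h3, ?_, ?_⟩
      · exact lt_of_le_of_ne (by simp; linarith) (hne 0 2 (by decide)).symm
      · exact lt_of_le_of_ne (by simp; linarith) (hne 0 3 (by decide)).symm
  · rintro ⟨w, hw, rfl⟩
    obtain ⟨h1, h2⟩ := convexWeights_spec hw
    rwa [mem_convexClasses_iff, invariants_snd_pos_iff h1]

lemma nonConvexClasses_eq_image : nonConvexClasses = ofWeights '' nonConvexWeights := by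
  ext z
  constructor
  · intro hz
    obtain ⟨w, hw, rfl⟩ := exists_weights z
    have hz' : ∏ i, w i < 0 := by
      rw [mem_nonConvexClasses_iff] at hz
      refine lt_of_le_of_ne (not_lt.1 fun h => ?_) hw.2.2
      exact lt_asymm hz ((invariants_snd_pos_iff hw).2 h)
    have h0 := ne_zero_of_mem hw
    have comb : ∀ s : Fin 4 → SignType, (∀ i, s i ≠ 0) → ∏ i, s i = -1 →
        ∃ σ : Equiv.Perm (Fin 4), s (σ 1) = s (σ 0) ∧ s (σ 2) = s (σ 0) := by decide +kernel
    obtain ⟨σ, h1, h2⟩ := comb (fun i => SignType.sign (w i))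
      (fun i => sign_ne_zero.2 (h0 i)) ((sign_prod_four w).trans (sign_eq_neg_one_iff.2 hz'))
    have hw' := (genericWeights_comp σ).2 hw
    rcases (h0 (σ 0)).lt_or_gt with hneg | hpos
    · refine ⟨(-1 : ℝ) • (w ∘ σ), ?_, ofWeights_smul_comp hw (by norm_num) σ⟩
      rw [sign_neg hneg] at h1 h2
      simp only [sign_eq_neg_one_iff] at h1 h2
      refine ⟨((genericWeights_smul (by norm_num)).2 hw').1, ?_, ?_, ?_⟩
      · simpa using hneg
      · simpa using h1
      · simpa using h2
    · refine ⟨(1 : ℝ) • (w ∘ σ), ?_, ofWeights_smul_comp hw one_ne_zero σ⟩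
      rw [sign_pos hpos] at h1 h2
      simp only [sign_eq_one_iff] at h1 h2
      rw [one_smul]
      exact ⟨hw'.1, hpos, h1, h2⟩
  · rintro ⟨w, hw, rfl⟩
    obtain ⟨h1, h2⟩ := nonConvexWeights_spec hw
    rw [mem_nonConvexClasses_iff]
    exact lt_of_le_of_ne (not_lt.1 fun h => lt_asymm h2 ((invariants_snd_pos_iff h1).1 h))
      (invariants_snd_ne_zero _)

lemma convexClasses_nonempty : convexClasses.Nonempty := by
  rw [convexClasses_eq_image]
  refine Set.Nonempty.image _ ⟨![3, 1, -2, -2], ?_⟩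
  refine ⟨?_, ?_, ?_, ?_, ?_, ?_⟩ <;> simp [Fin.sum_univ_four] <;> norm_num

lemma nonConvexClasses_nonempty : nonConvexClasses.Nonempty := by
  rw [nonConvexClasses_eq_image]
  refine Set.Nonempty.image _ ⟨![1, 1, 1, -3], ?_⟩
  refine ⟨?_, ?_, ?_, ?_⟩ <;> simp [Fin.sum_univ_four] <;> norm_num

lemma isPreconnected_convexClasses : IsPreconnected convexClasses := by
  rw [convexClasses_eq_image]
  exact convex_convexWeights.isPreconnected.image _
    (continuousOn_ofWeights.mono fun w hw => (convexWeights_spec hw).1)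

lemma isPreconnected_nonConvexClasses : IsPreconnected nonConvexClasses := by
  rw [nonConvexClasses_eq_image]
  exact convex_nonConvexWeights.isPreconnected.image _
    (continuousOn_ofWeights.mono fun w hw => (nonConvexWeights_spec hw).1)

lemma connectedComponent_eq {X : Type*} [TopologicalSpace X] {A B : Set X} (hA : IsOpen A)
    (hB : IsOpen B) (hd : Disjoint A B) (hu : A ∪ B = univ) (hc : IsPreconnected A) {z : X}
    (hz : z ∈ A) : connectedComponent z = A := by
  have hAB : Aᶜ = B := by
    rw [compl_eq_univ_sdiff, ← hu, union_sdiff_left]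
    exact hd.symm.sdiff_eq_left
  have hcl : IsClopen A := ⟨⟨by rwa [hAB]⟩, hA⟩
  exact Subset.antisymm (hcl.connectedComponent_subset hz) (hc.subset_connectedComponent hz)

lemma connectedComponent_convex {z : Moduli ℝ} (hz : z ∈ convexClasses) :
    connectedComponent z = convexClasses :=
  connectedComponent_eq isOpen_convexClasses isOpen_nonConvexClasses disjoint_convexClasses
    convexClasses_union isPreconnected_convexClasses hz

lemma connectedComponent_nonConvex {z : Moduli ℝ} (hz : z ∈ nonConvexClasses) :
    connectedComponent z = nonConvexClasses :=
  connectedComponent_eq isOpen_nonConvexClasses isOpen_convexClasses disjoint_convexClasses.symm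
    (by rw [union_comm, convexClasses_union]) isPreconnected_nonConvexClasses hz

end Convexity

/-! ### Singular points over the real numbers -/

section Singular

open Filter Asymptotics

/-- A `C²` function with a vanishing derivative agrees with its value up to second order. -/
lemma isBigO_sub_of_fderiv_eq_zero {E F : Type*} [NormedAddCommGroup E] [NormedSpace ℝ E]
    [NormedAddCommGroup F] [NormedSpace ℝ F] {f : E → F} {x : E} (hf : AnalyticAt ℝ f x)
    (h : fderiv ℝ f x = 0) : (fun y => f (x + y) - f x) =O[𝓝 0] fun y => ‖y‖ ^ 2 := by
  obtain ⟨p, hp⟩ := hf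
  have h1 := hp.isBigO_sub_partialSum_pow 2
  refine h1.congr_left fun y => ?_
  have h2 : p 1 (fun _ => y) = fderiv ℝ f x y := by
    rw [hp.fderiv_eq]; rfl
  rw [FormalMultilinearSeries.partialSum, Finset.sum_range_succ, Finset.sum_range_one]
  rw [show p 0 (fun _ => y) = f x from hp.coeff_zero _]
  rw [h2, h, zero_apply, add_zero]

/-- A point is singular if it has a local model `ℝ² / G` where `G` contains the reflection
`(x, y) ↦ (y, x)` and fixes a nonnegative analytic function `Q` with `Q (t, -t) = c * t ^ 2`,
`c ≠ 0`. Otherwise, in a smooth chart, the function defined by `Q` has a critical point, and the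
coordinates of the chart are even functions of `t` along the antidiagonal; hence `Q` vanishes there
to the fourth order. -/
lemma isSingularPoint_of_hasLocalModel {X : Type*} [TopologicalSpace X]
    {An : (X → ℝ) → X → Prop} {G : Subgroup ((ℝ × ℝ) ≃ₗ[ℝ] (ℝ × ℝ))} {z : X}
    (hG : HasLocalModel An G z) (hswap : LinearEquiv.prodComm ℝ ℝ ℝ ∈ G) {Q : ℝ × ℝ → ℝ}
    (hQ : ∀ v, AnalyticAt ℝ Q v) (hQG : ∀ g ∈ G, ∀ v, Q (g v) = Q v) (hpos : ∀ v, 0 ≤ Q v)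
    {c : ℝ} (hc : c ≠ 0) (hQc : ∀ t, Q (t, -t) = c * t ^ 2) : IsSingularPoint An z := by
  rintro ⟨V, ψ, hV, hV0, -, hψc, hψo, hψ0, hψi, hψA⟩
  obtain ⟨V', ψ', hV', hV0', hGV', hψc', hψo', hψ0', hψi', hψA'⟩ := hG
  classical
  have hinj : ∀ v ∈ V, ∀ w ∈ V, ψ v = ψ w → v = w := by
    intro v hv w hw h
    obtain ⟨g, hg, hgv⟩ := (hψi v hv w hw).1 h
    rw [Subgroup.mem_bot] at hg
    rw [← hgv, hg]; rfl
  -- the function on `X` defined by `Q`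
  let S : X → ℝ := fun x => if h : ∃ v ∈ V', ψ' v = x then Q h.choose else 0
  have hS : ∀ v ∈ V', S (ψ' v) = Q v := by
    intro v hv
    have h : ∃ u ∈ V', ψ' u = ψ' v := ⟨v, hv, rfl⟩
    obtain ⟨h1, h2⟩ := h.choose_spec
    obtain ⟨g, hg, hgv⟩ := (hψi' _ hv _ h1).1 h2.symm
    simp only [S, dif_pos h]
    rw [← hgv, hQG g hg]
  have hSpos : ∀ x, 0 ≤ S x := by
    intro x
    simp only [S]
    split_ifs
    exacts [hpos _, le_rfl]
  have hQ0 : Q 0 = 0 := by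
    rw [show (0 : ℝ × ℝ) = ((0 : ℝ), -(0 : ℝ)) by ext <;> simp, hQc]; simp
  have hSz : S z = 0 := by rw [← hψ0', hS _ hV0', hQ0]
  have hSan : AnalyticAt ℝ (S ∘ ψ) 0 := by
    rw [← hψA S 0 hV0, hψ0, ← hψ0', hψA' S 0 hV0']
    refine (hQ 0).congr ?_
    filter_upwards [hV'.mem_nhds hV0'] with v hv
    exact (hS v hv).symm
  -- the inverse of the chart `ψ`, read in the local model
  let H : X → ℝ × ℝ := fun x => if h : ∃ v ∈ V, ψ v = x then h.choose else 0
  have hH : ∀ v ∈ V, H (ψ v) = v := by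
    intro v hv
    have h : ∃ u ∈ V, ψ u = ψ v := ⟨v, hv, rfl⟩
    obtain ⟨h1, h2⟩ := h.choose_spec
    simp only [H, dif_pos h]
    exact hinj _ h1 _ hv h2
  have hHan : AnalyticAt ℝ (H ∘ ψ') 0 := by
    have key : ∀ L : ℝ × ℝ → ℝ, AnalyticAt ℝ L 0 → AnalyticAt ℝ ((L ∘ H) ∘ ψ') 0 := by
      intro L hL
      rw [← hψA' (L ∘ H) 0 hV0', hψ0', ← hψ0, hψA (L ∘ H) 0 hV0]
      refine hL.congr ?_
      filter_upwards [hV.mem_nhds hV0] with v hv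
      simp only [Function.comp_apply, hH v hv]
    exact (key Prod.fst analyticAt_fst).prod (key Prod.snd analyticAt_snd)
  have hH0 : (H ∘ ψ') 0 = 0 := by
    rw [Function.comp_apply, hψ0', ← hψ0, hH 0 hV0]
  -- the image of the chart `ψ` is a neighbourhood
  have hnhds : ∀ᶠ v in 𝓝 (0 : ℝ × ℝ), v ∈ V' ∧ S (ψ (H (ψ' v))) = Q v := by
    have h1 : ψ '' V ∈ 𝓝 (ψ' 0) := by
      rw [hψ0', ← hψ0]
      exact (hψo V subset_rfl hV).mem_nhds (mem_image_of_mem ψ hV0)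
    have h2 := (hψc'.continuousAt (hV'.mem_nhds hV0')).preimage_mem_nhds h1
    filter_upwards [h2, hV'.mem_nhds hV0'] with v hv hv'
    obtain ⟨u, hu, huv⟩ := hv
    refine ⟨hv', ?_⟩
    rw [← hS v hv', ← huv, hH u hu]
  have hO1 : (fun v => S (ψ v)) =O[𝓝 0] fun v => ‖v‖ ^ 2 := by
    have hmin : IsLocalMin (S ∘ ψ) 0 := Eventually.of_forall fun v => by
      simp only [Function.comp_apply, hψ0, hSz]; exact hSpos _
    refine (isBigO_sub_of_fderiv_eq_zero hSan hmin.fderiv_eq_zero).congr_left fun v => ?_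
    simp [hψ0, hSz]
  -- the coordinates are even along the antidiagonal
  let γ : ℝ → ℝ × ℝ := fun t => (t, -t)
  have hγ : AnalyticAt ℝ γ 0 := analyticAt_id.prod analyticAt_id.neg
  have hγ0 : γ 0 = 0 := by simp [γ]
  have hγt : Tendsto γ (𝓝 0) (𝓝 0) := by
    have := hγ.continuousAt.tendsto
    rwa [hγ0] at this
  have hk : AnalyticAt ℝ (fun t => H (ψ' (γ t))) 0 := hHan.comp_of_eq hγ hγ0
  have hO2 : (fun t => H (ψ' (γ t))) =O[𝓝 0] fun t : ℝ => t ^ 2 := by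
    have heven : (fun t => H (ψ' (γ (-t)))) =ᶠ[𝓝 (0 : ℝ)] fun t => H (ψ' (γ t)) := by
      filter_upwards [hγt.eventually (hV'.mem_nhds hV0')] with t ht
      have e : γ (-t) = LinearEquiv.prodComm ℝ ℝ ℝ (γ t) := by
        simp [γ]
      congr 1
      exact ((hψi' _ ht _ (by rw [e]; exact hGV' _ hswap _ ht)).2 ⟨_, hswap, e.symm⟩).symm
    have hd : deriv (fun t => H (ψ' (γ t))) 0 = 0 := by
      have h1 := heven.deriv_eq
      have h2 := deriv_comp_neg (fun t => H (ψ' (γ t))) (0 : ℝ)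
      rw [h2, neg_zero] at h1
      exact self_eq_neg.1 h1.symm
    have hfd : fderiv ℝ (fun t => H (ψ' (γ t))) 0 = 0 := by
      ext1
      rw [fderiv_apply_one_eq_deriv, hd]; rfl
    refine ((isBigO_sub_of_fderiv_eq_zero hk hfd).congr_left fun t => ?_).congr_right fun t => ?_
    · have : H (ψ' (γ 0)) = 0 := by rw [hγ0]; exact hH0
      rw [this, zero_add, sub_zero]
    · simp
  have hO3 : (fun t : ℝ => c * t ^ 2) =O[𝓝 0] fun t : ℝ => t ^ 4 := by
    have hkt : Tendsto (fun t => H (ψ' (γ t))) (𝓝 0) (𝓝 0) := by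
      have := hk.continuousAt.tendsto
      rwa [show H (ψ' (γ 0)) = 0 by rw [hγ0]; exact hH0] at this
    have h1 := hO1.comp_tendsto hkt
    have h2 : (fun t => S (ψ (H (ψ' (γ t))))) =O[𝓝 0] fun t : ℝ => t ^ 4 := by
      refine h1.trans ((hO2.norm_left.pow 2).congr_right fun t => ?_)
      ring
    refine h2.congr' ?_ EventuallyEq.rfl
    filter_upwards [hγt.eventually hnhds] with t ht
    rw [ht.2, hQc]
  have hO4 : (fun t : ℝ => t ^ 4) =o[𝓝 0] fun t : ℝ => t ^ 2 :=
    isLittleO_pow_pow (by norm_num)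
  have hO5 := (isLittleO_const_mul_left_iff hc).1 (hO3.trans_isLittleO hO4)
  refine isLittleO_irrefl ?_ hO5
  have : ∃ᶠ t in 𝓝[≠] (0 : ℝ), t ^ 2 ≠ 0 :=
    Eventually.frequently (by
      filter_upwards [self_mem_nhdsWithin] with t ht using pow_ne_zero 2 ht)
  exact this.filter_mono nhdsWithin_le_nhds

lemma exists_reflection_singularity : ∃ z : Moduli ℝ,
    IsSingularPoint Moduli.IsAnalyticFunAt z ∧
      HasLocalModel Moduli.IsAnalyticFunAt (reflectionGroup ℝ) z := by
  have hw : (![1, 1, 2, -4] : Fin 4 → ℝ) ∈ genericWeights ℝ := by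
    refine ⟨?_, ?_, ?_⟩ <;> simp [Fin.sum_univ_four, Fin.prod_univ_four] <;> norm_num
  have hm := hasLocalModel_reflectionGroup hw rfl (by simp) (by simp; norm_num) (by simp; norm_num)
  refine ⟨_, isSingularPoint_of_hasLocalModel hm
    ((mem_reflectionGroup_iff _).2 (Or.inr rfl)) (Q := fun v => (v.1 - v.2) ^ 2)
    (fun v => (analyticAt_fst.sub analyticAt_snd).pow 2) ?_ (fun v => sq_nonneg _)
    (c := 4) (by norm_num) (fun t => by ring), hm⟩
  intro g hg v
  rcases (mem_reflectionGroup_iff g).1 hg with rfl | rfl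
  · rfl
  · simp; ring

lemma exists_triangle_singularity : ∃ z : Moduli ℝ,
    IsSingularPoint Moduli.IsAnalyticFunAt z ∧
      HasLocalModel Moduli.IsAnalyticFunAt (triangleGroup ℝ) z := by
  have hm := hasLocalModel_triangleGroup (one_mem_genericWeights (K := ℝ)) rfl rfl
    (by simp; norm_num)
  have hswap : LinearEquiv.prodComm ℝ ℝ ℝ ∈ triangleGroup ℝ := by
    refine mem_triangleGroup_of_perm (τ := Equiv.swap 0 1) fun i => ?_
    fin_cases i <;> simp [triangleVertex, Equiv.swap_apply_def]
  refine ⟨_, isSingularPoint_of_hasLocalModel hm hswap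
    (Q := fun v => v.1 ^ 2 - v.1 * v.2 + v.2 ^ 2)
    (fun v => ((analyticAt_fst.pow 2).sub (analyticAt_fst.mul analyticAt_snd)).add
      (analyticAt_snd.pow 2)) ?_ (fun v => ?_)
    (c := 3) (by norm_num) (fun t => by ring), hm⟩
  · intro g hg v
    obtain ⟨τ, hτ⟩ := exists_perm_of_mem_triangleGroup hg
    have hv : g v = v.1 • triangleVertex ℝ (τ 0) + v.2 • triangleVertex ℝ (τ 1) := by
      conv_lhs => rw [prod_eq_triangleVertex v]
      rw [map_add, map_smul, map_smul, hτ, hτ]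
    have hne : τ 0 ≠ τ 1 := τ.injective.ne (by decide)
    simp only [hv]
    generalize τ 0 = i at *
    generalize τ 1 = j at *
    fin_cases i <;> fin_cases j <;>
      first | exact absurd rfl hne | (simp [triangleVertex]; done) | (simp [triangleVertex]; ring)
  · nlinarith [sq_nonneg (v.1 - v.2), sq_nonneg (v.1 + v.2)]

end Singular

/-! ### Separately holomorphic functions of two variables -/

section Osgood

open MeasureTheory Metric BoundedContinuousFunction

/-- The uniform measure on the square `(0, 2π] × (0, 2π]`. -/
def torusMeasure : Measure (ℝ × ℝ) :=
  (volume.restrict (Ioc 0 (2 * Real.pi))).prod (volume.restrict (Ioc 0 (2 * Real.pi)))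

instance isFiniteMeasure_torusMeasure : IsFiniteMeasure torusMeasure := by
  unfold torusMeasure; infer_instance

/-- The integral over the torus, as a continuous linear form on the Banach algebra of bounded
continuous functions. -/
def torusIntegralCLM : ((ℝ × ℝ) →ᵇ ℂ) →L[ℂ] ℂ :=
  LinearMap.mkContinuous
    { toFun := fun h => ∫ p, h p ∂torusMeasure
      map_add' := fun g h => integral_add (g.integrable _) (h.integrable _)
      map_smul' := fun c _ => integral_const_mul c _ }
    (torusMeasure.real univ) fun h =>
      BoundedContinuousFunction.norm_integral_le_mul_norm torusMeasure h

lemma torusIntegralCLM_apply (h : (ℝ × ℝ) →ᵇ ℂ) : torusIntegralCLM h =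
    ∫ θ in (0)..2 * Real.pi, ∫ φ in (0)..2 * Real.pi, h (θ, φ) := by
  have h2 : (0 : ℝ) ≤ 2 * Real.pi := by positivity
  change ∫ p, h p ∂torusMeasure = _
  rw [torusMeasure, integral_prod _ (h.integrable torusMeasure)]
  simp only [intervalIntegral.integral_of_le h2]

/-- The function `p ↦ circleMap 0 r (t p)` is a unit of the algebra of bounded continuous functions. -/
lemma exists_unit_circleMap {r : ℝ} (hr : 0 < r) {t : ℝ × ℝ → ℝ} (ht : Continuous t) :
    ∃ u : ((ℝ × ℝ) →ᵇ ℂ)ˣ, ∀ p, (u : (ℝ × ℝ) →ᵇ ℂ) p = circleMap 0 r (t p) := by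
  have hb : ∀ (R : ℝ) (s : ℝ × ℝ → ℝ) (p : ℝ × ℝ), ‖circleMap 0 R (s p)‖ ≤ |R| := by
    intro R s p; simp
  let u1 : (ℝ × ℝ) →ᵇ ℂ := ofNormedAddCommGroup (fun p => circleMap 0 r (t p))
    ((continuous_circleMap 0 r).comp ht) _ (hb r t)
  let u2 : (ℝ × ℝ) →ᵇ ℂ := ofNormedAddCommGroup (fun p => circleMap 0 r⁻¹ (-t p))
    ((continuous_circleMap 0 r⁻¹).comp ht.neg) _ (hb r⁻¹ fun p => -t p)
  have h12 : ∀ p, u1 p * u2 p = 1 := by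
    intro p
    change circleMap 0 r (t p) * circleMap 0 r⁻¹ (-t p) = 1
    have hr' : (r : ℂ) ≠ 0 := by exact_mod_cast hr.ne'
    rw [circleMap_zero, circleMap_zero, mul_mul_mul_comm, ← Complex.exp_add]
    push_cast
    rw [mul_inv_cancel₀ hr', ← add_mul, add_neg_cancel, zero_mul, Complex.exp_zero, one_mul]
  refine ⟨⟨u1, u2, ?_, ?_⟩, fun p => rfl⟩
  · ext p; exact h12 p
  · ext p; exact (mul_comm _ _).trans (h12 p)

lemma inverse_apply {u : (ℝ × ℝ) →ᵇ ℂ} (hu : IsUnit u) (p : ℝ × ℝ) :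
    Ring.inverse u p = (u p)⁻¹ := by
  have h := congrArg (fun v : (ℝ × ℝ) →ᵇ ℂ => v p) (Ring.inverse_mul_cancel u hu)
  exact eq_inv_of_mul_eq_one_left h

/-- A Cauchy integral over a torus is an analytic function of two variables: it is a continuous
linear form on a Banach algebra, applied to products of resolvents. -/
lemma analyticAt_torusIntegral {a b : ℂ} {r : ℝ} (hr : 0 < r) {g : ℝ × ℝ → ℂ} (hg : Continuous g)
    {C : ℝ} (hC : ∀ p, ‖g p‖ ≤ C) :
    AnalyticAt ℂ (fun z : ℂ × ℂ => ∫ θ in (0)..2 * Real.pi, ∫ φ in (0)..2 * Real.pi,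
      (circleMap a r θ - z.1)⁻¹ * (circleMap b r φ - z.2)⁻¹ * g (θ, φ)) (a, b) := by
  obtain ⟨u, hu⟩ := exists_unit_circleMap hr (t := Prod.fst) continuous_fst
  obtain ⟨v, hv⟩ := exists_unit_circleMap hr (t := Prod.snd) continuous_snd
  let G : (ℝ × ℝ) →ᵇ ℂ := ofNormedAddCommGroup g hg C hC
  let U : ℂ × ℂ → (ℝ × ℝ) →ᵇ ℂ := fun z => u - (z.1 - a) • 1
  let V : ℂ × ℂ → (ℝ × ℝ) →ᵇ ℂ := fun z => v - (z.2 - b) • 1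
  have hU : AnalyticAt ℂ U (a, b) :=
    analyticAt_const.sub ((analyticAt_fst.sub analyticAt_const).smul analyticAt_const)
  have hV : AnalyticAt ℂ V (a, b) :=
    analyticAt_const.sub ((analyticAt_snd.sub analyticAt_const).smul analyticAt_const)
  have hU0 : U (a, b) = u := by simp [U]
  have hV0 : V (a, b) = v := by simp [V]
  have hΨ : AnalyticAt ℂ (fun z => Ring.inverse (U z) * Ring.inverse (V z) * G) (a, b) :=
    (((analyticAt_inverse u).comp_of_eq hU hU0).mul
      ((analyticAt_inverse v).comp_of_eq hV hV0)).mul analyticAt_const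
  refine ((torusIntegralCLM.analyticAt _).comp hΨ).congr ?_
  have hUu : ∀ᶠ z in 𝓝 (a, b), IsUnit (U z) :=
    hU.continuousAt.eventually (Units.isOpen.mem_nhds (by rw [hU0]; exact u.isUnit))
  have hVu : ∀ᶠ z in 𝓝 (a, b), IsUnit (V z) :=
    hV.continuousAt.eventually (Units.isOpen.mem_nhds (by rw [hV0]; exact v.isUnit))
  filter_upwards [hUu, hVu] with z h1 h2
  rw [Function.comp_apply, torusIntegralCLM_apply]
  have e1 : ∀ θ φ, U z (θ, φ) = circleMap a r θ - z.1 := by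
    intro θ φ
    change (u : (ℝ × ℝ) →ᵇ ℂ) (θ, φ) - (z.1 - a) • 1 = _
    rw [hu]
    simp [circleMap]; ring
  have e2 : ∀ θ φ, V z (θ, φ) = circleMap b r φ - z.2 := by
    intro θ φ
    change (v : (ℝ × ℝ) →ᵇ ℂ) (θ, φ) - (z.2 - b) • 1 = _
    rw [hv]
    simp [circleMap]; ring
  have e3 : ∀ θ φ, (Ring.inverse (U z) * Ring.inverse (V z) * G) (θ, φ) =
      (circleMap a r θ - z.1)⁻¹ * (circleMap b r φ - z.2)⁻¹ * g (θ, φ) := by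
    intro θ φ
    rw [← e1 θ φ, ← e2 θ φ, ← inverse_apply h1, ← inverse_apply h2]; rfl
  simp only [e3]

/-- A continuous function of two complex variables is analytic if it is differentiable outside of a
set that meets the horizontal and the vertical lines in countable sets. -/
lemma analyticAt_of_differentiable_off_countable {f : ℂ × ℂ → ℂ} {a b : ℂ} {r : ℝ} (hr : 0 < r)
    (hc : ContinuousOn f (closedBall a r ×ˢ closedBall b r)) {S : Set (ℂ × ℂ)}
    (hd : ∀ z ∈ closedBall a r ×ˢ closedBall b r, z ∉ S → DifferentiableAt ℂ f z)
    (h1 : ∀ x ∈ closedBall a r, {y | y ∈ closedBall b r ∧ (x, y) ∈ S}.Countable)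
    (h2 : ∀ y ∈ closedBall b r, {x | x ∈ closedBall a r ∧ (x, y) ∈ S}.Countable) :
    AnalyticAt ℂ f (a, b) := by
  have hsa : ∀ θ, circleMap a r θ ∈ closedBall a r := circleMap_mem_closedBall a hr.le
  have hsb : ∀ θ, circleMap b r θ ∈ closedBall b r := circleMap_mem_closedBall b hr.le
  -- the boundary values, with the densities of the two contour integrals
  let g : ℝ × ℝ → ℂ := fun p => deriv (circleMap a r) p.1 * (deriv (circleMap b r) p.2 *
    f (circleMap a r p.1, circleMap b r p.2))
  have hfc : Continuous fun p : ℝ × ℝ => f (circleMap a r p.1, circleMap b r p.2) :=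
    hc.comp_continuous (((continuous_circleMap a r).comp continuous_fst).prodMk
      ((continuous_circleMap b r).comp continuous_snd)) fun p => ⟨hsa _, hsb _⟩
  have hg : Continuous g := by
    simp only [g, deriv_circleMap]
    have k1 := continuous_circleMap 0 r
    exact ((k1.comp continuous_fst).mul continuous_const).mul
      (((k1.comp continuous_snd).mul continuous_const).mul hfc)
  obtain ⟨C, hC⟩ : ∃ C, ∀ z ∈ closedBall a r ×ˢ closedBall b r, ‖f z‖ ≤ C :=
    ((isCompact_closedBall a r).prod (isCompact_closedBall b r)).exists_bound_of_continuousOn hc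
  have hgC : ∀ p, ‖g p‖ ≤ r * (r * C) := by
    intro p
    simp only [g, deriv_circleMap, norm_mul, norm_circleMap_zero, Complex.norm_I, mul_one,
      abs_of_pos hr]
    gcongr
    exact hC _ ⟨hsa _, hsb _⟩
  have han := (analyticAt_torusIntegral (a := a) (b := b) hr hg hgC).const_smul
    (c := (2 * (Real.pi : ℂ) * Complex.I)⁻¹ * (2 * (Real.pi : ℂ) * Complex.I)⁻¹)
  refine han.congr ?_
  have hnhds : ball a r ×ˢ ball b r ∈ 𝓝 (a, b) :=
    prod_mem_nhds (ball_mem_nhds a hr) (ball_mem_nhds b hr)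
  have hI : (2 * (Real.pi : ℂ) * Complex.I) ≠ 0 := Complex.two_pi_I_ne_zero
  filter_upwards [hnhds] with z hz
  have hx : ∀ y ∈ closedBall b r, (∮ ζ in C(a, r), (ζ - z.1)⁻¹ • f (ζ, y)) =
      (2 * (Real.pi : ℂ) * Complex.I) • f (z.1, y) := by
    intro y hy
    refine Complex.circleIntegral_sub_inv_smul_of_differentiable_on_off_countable (h2 y hy) hz.1
      (hc.comp (by fun_prop) fun x hx => ⟨hx, hy⟩) fun x hx => ?_
    have hx' := ball_subset_closedBall hx.1
    exact (hd (x, y) ⟨hx', hy⟩ fun h => hx.2 ⟨hx', h⟩).comp x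
      (differentiableAt_id.prodMk (differentiableAt_const y))
  have hy : ∀ x ∈ closedBall a r, (∮ η in C(b, r), (η - z.2)⁻¹ • f (x, η)) =
      (2 * (Real.pi : ℂ) * Complex.I) • f (x, z.2) := by
    intro x hx
    refine Complex.circleIntegral_sub_inv_smul_of_differentiable_on_off_countable (h1 x hx) hz.2
      (hc.comp (by fun_prop) fun y hy => ⟨hx, hy⟩) fun y hy => ?_
    have hy' := ball_subset_closedBall hy.1
    exact (hd (x, y) ⟨hx, hy'⟩ fun h => hy.2 ⟨hy', h⟩).comp y
      ((differentiableAt_const x).prodMk differentiableAt_id)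
  have key : ∫ θ in (0)..2 * Real.pi, ∫ φ in (0)..2 * Real.pi,
      (circleMap a r θ - z.1)⁻¹ * (circleMap b r φ - z.2)⁻¹ * g (θ, φ) =
      (2 * (Real.pi : ℂ) * Complex.I) * ((2 * (Real.pi : ℂ) * Complex.I) * f z) := by
    have e1 : ∀ θ, ∫ φ in (0)..2 * Real.pi,
        (circleMap a r θ - z.1)⁻¹ * (circleMap b r φ - z.2)⁻¹ * g (θ, φ) =
        (2 * (Real.pi : ℂ) * Complex.I) * (deriv (circleMap a r) θ •
          ((circleMap a r θ - z.1)⁻¹ • f (circleMap a r θ, z.2))) := by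
      intro θ
      have := hy _ (hsa θ)
      rw [circleIntegral] at this
      have e : ∀ φ, (circleMap a r θ - z.1)⁻¹ * (circleMap b r φ - z.2)⁻¹ * g (θ, φ) =
          (circleMap a r θ - z.1)⁻¹ * deriv (circleMap a r) θ * (deriv (circleMap b r) φ •
            ((circleMap b r φ - z.2)⁻¹ • f (circleMap a r θ, circleMap b r φ))) := by
        intro φ; simp only [smul_eq_mul, g]; ring
      simp only [e]
      rw [intervalIntegral.integral_const_mul, this]
      simp only [smul_eq_mul]; ring
    simp only [e1]
    rw [intervalIntegral.integral_const_mul]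
    have := hx z.2 (ball_subset_closedBall hz.2)
    rw [circleIntegral] at this
    rw [this, smul_eq_mul]
  simp only [Pi.smul_apply, smul_eq_mul]
  rw [key]
  field_simp

end Osgood

/-! ### The embedding by the invariants -/

section Complex

open Filter

variable {K : Type*} [RCLike K]

lemma WeightChart.nhds_le_map (c : WeightChart K) {v : K × K} (hv : v ∈ c.domain) :
    𝓝 (c.toModuli v) ≤ map c.toModuli (𝓝 v) := by
  intro s hs
  obtain ⟨W, hWs, hW, hvW⟩ := mem_nhds_iff.1 (inter_mem hs (c.isOpen_domain.mem_nhds hv))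
  refine mem_of_superset ((c.isOpen_image (fun u hu => (hWs hu).2) hW).mem_nhds
    (mem_image_of_mem _ hvW)) ?_
  rintro _ ⟨u, hu, rfl⟩
  exact (hWs hu).1

lemma exists_normalChart (z : Moduli K) : ∃ v ∈ (normalChart K).domain,
    (normalChart K).toModuli v = z := by
  obtain ⟨v, hv⟩ := ofFourth_surjective z
  exact ⟨v, mem_domain_normalChart.2 v.2, hv⟩

lemma IsAnalyticFunAt.eventually {F : Moduli K → K} {z : Moduli K}
    (h : Moduli.IsAnalyticFunAt F z) : ∀ᶠ y in 𝓝 z, Moduli.IsAnalyticFunAt F y := by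
  obtain ⟨v, hv, rfl⟩ := exists_normalChart z
  have h1 := (((normalChart K).isAnalyticFunAt_iff hv F).1 h).eventually_analyticAt
  refine (normalChart K).nhds_le_map hv (mem_map.2 ?_)
  filter_upwards [h1, (normalChart K).isOpen_domain.mem_nhds hv] with u hu hu'
  exact ((normalChart K).isAnalyticFunAt_iff hu' F).2 hu

lemma IsAnalyticFunAt.continuousAt {F : Moduli K → K} {z : Moduli K}
    (h : Moduli.IsAnalyticFunAt F z) : ContinuousAt F z := by
  obtain ⟨v, hv, rfl⟩ := exists_normalChart z
  have h1 := (((normalChart K).isAnalyticFunAt_iff hv F).1 h).continuousAt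
  exact (tendsto_map'_iff.2 h1).mono_left ((normalChart K).nhds_le_map hv)

lemma analyticAt_apply_four (w : Fin 4 → K) (i : Fin 4) :
    AnalyticAt K (fun w : Fin 4 → K => w i) w :=
  (ContinuousLinearMap.proj (R := K) (φ := fun _ : Fin 4 => K) i).analyticAt w

lemma analyticAt_weightInvariants {w : Fin 4 → K} (hw : w ∈ genericWeights K) :
    AnalyticAt K weightInvariants w := by
  have hn : ∀ i, AnalyticAt K (fun w : Fin 4 → K => normalized w i) w := fun i =>
    ((Finset.analyticAt_fun_sum _ fun j _ => (analyticAt_apply_four w j).pow 3).div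
      (Finset.analyticAt_fun_prod _ fun j _ => analyticAt_apply_four w j) hw.2.2).mul
      (analyticAt_apply_four w i)
  exact (Finset.analyticAt_fun_sum _ fun j _ => (hn j).pow 2).prod
    (Finset.analyticAt_fun_prod _ fun j _ => hn j)

lemma weightInvariants_eq {w : Fin 4 → K} (hw : w ∈ genericWeights K)
    (h : ∑ i, w i ^ 3 = ∏ i, w i) : weightInvariants w = (∑ i, w i ^ 2, ∏ i, w i) := by
  rw [weightInvariants, normalized_eq_self hw h]

open Polynomial in
lemma exists_four_roots (a b : ℂ) : ∃ w : Fin 4 → ℂ,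
    ∏ i, (X - C (w i)) = X ^ 4 - C (a / 2) * X ^ 2 - C (b / 3) * X + C b := by
  set p : ℂ[X] := X ^ 4 - C (a / 2) * X ^ 2 - C (b / 3) * X + C b with hp
  have hdeg : p.natDegree = 4 := by rw [hp]; compute_degree!
  have hm : p.Monic := by
    rw [Monic, leadingCoeff, hdeg, hp]
    simp
  have hs := IsAlgClosed.splits p
  have hcard : p.roots.card = 4 := by rw [← hdeg]; exact hs.natDegree_eq_card_roots.symm
  have hprod := hs.eq_prod_roots_of_monic hm
  obtain ⟨l, hl⟩ := Quot.exists_rep p.roots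
  have hl' : p.roots = (l : Multiset ℂ) := hl.symm
  rw [hl'] at hcard hprod
  rw [Multiset.coe_card] at hcard
  obtain ⟨x, y, z, t, rfl⟩ := List.length_eq_four.1 hcard
  refine ⟨![x, y, z, t], ?_⟩
  rw [hprod, Fin.prod_univ_four]
  simp [mul_assoc]

open Polynomial in
/-- Every pair of invariants with a nonzero second entry occurs over the complex numbers. -/
lemma exists_weights_of_invariants (a : ℂ) {b : ℂ} (hb : b ≠ 0) : ∃ w ∈ genericWeights ℂ,
    ∑ i, w i ^ 2 = a ∧ ∑ i, w i ^ 3 = b ∧ ∏ i, w i = b := by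
  obtain ⟨w, hw⟩ := exists_four_roots a b
  have hev : ∀ s : ℂ, (s - w 0) * (s - w 1) * (s - w 2) * (s - w 3) =
      s ^ 4 - a / 2 * s ^ 2 - b / 3 * s + b := by
    intro s
    have := congrArg (Polynomial.eval s) hw
    rw [Fin.prod_univ_four] at this
    simpa using this
  have h0 := hev 0
  have h1 := hev 1
  have h2 := hev (-1)
  have h3 := hev 2
  have e4 : w 0 * w 1 * w 2 * w 3 = b := by linear_combination h0
  have e2 : w 0 * w 1 + w 0 * w 2 + w 0 * w 3 + w 1 * w 2 + w 1 * w 3 + w 2 * w 3 = -a / 2 := by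
    linear_combination (h1 + h2) / 2 - h0
  have e3 : w 0 + w 1 + w 2 + w 3 + (w 0 * w 1 * w 2 + w 0 * w 1 * w 3 + w 0 * w 2 * w 3 +
      w 1 * w 2 * w 3) = b / 3 := by
    linear_combination (h2 - h1) / 2
  have e1 : w 0 + w 1 + w 2 + w 3 = 0 := by
    linear_combination (-1 / 6) * (h3 - 4 * e2 - h0 + 2 * e3)
  have hw3 : w 3 = -(w 0 + w 1 + w 2) := by linear_combination e1
  have e5 : w 0 ^ 3 + w 1 ^ 3 + w 2 ^ 3 + w 3 ^ 3 = b := by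
    rw [hw3] at e3 ⊢
    linear_combination 3 * e3
  refine ⟨w, ⟨?_, ?_, ?_⟩, ?_, ?_, ?_⟩
  · rw [Fin.sum_univ_four, e1]
  · rw [Fin.sum_univ_four, e5]; exact hb
  · rw [Fin.prod_univ_four, e4]; exact hb
  · rw [Fin.sum_univ_four]
    rw [hw3] at e2 ⊢
    linear_combination -2 * e2
  · rw [Fin.sum_univ_four, e5]
  · rw [Fin.prod_univ_four, e4]

lemma exists_normalized_weights (z : Moduli K) : ∃ w ∈ genericWeights K, ofWeights w = z ∧
    ∑ i, w i ^ 2 = (invariants z).1 ∧ ∑ i, w i ^ 3 = (invariants z).2 ∧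
      ∏ i, w i = (invariants z).2 := by
  obtain ⟨w, hw, rfl⟩ := exists_weights z
  refine ⟨normalized w, normalized_mem hw, ofWeights_normalized hw, ?_⟩
  rw [invariants_ofWeights hw, sum_cube_normalized hw]
  exact ⟨rfl, rfl, rfl⟩

lemma invariants_ofWeights_of_eq {w : Fin 4 → K} (hw : w ∈ genericWeights K) {a b : K}
    (h2 : ∑ i, w i ^ 2 = a) (h3 : ∑ i, w i ^ 3 = b) (h4 : ∏ i, w i = b) :
    invariants (ofWeights w) = (a, b) := by
  rw [invariants_ofWeights hw, weightInvariants_eq hw (h3.trans h4.symm), h2, h4]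

lemma range_invariants : range (invariants (K := ℂ)) = {q | q.2 ≠ 0} := by
  ext ⟨a, b⟩
  refine ⟨?_, fun hb => ?_⟩
  · rintro ⟨z, hz⟩
    have := invariants_snd_ne_zero z
    rwa [hz] at this
  · obtain ⟨w, hw, h2, h3, h4⟩ := exists_weights_of_invariants a hb
    exact ⟨ofWeights w, invariants_ofWeights_of_eq hw h2 h3 h4⟩

open Polynomial in
lemma eval_weight {w : Fin 4 → K} (hw : ∑ i, w i = 0) (i : Fin 4) :
    w i ^ 4 - (∑ j, w j ^ 2) / 2 * w i ^ 2 - (∑ j, w j ^ 3) / 3 * w i + ∏ j, w j = 0 := by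
  have h := congrArg (Polynomial.eval (w i)) (prod_X_sub_C_eq hw)
  rw [eval_prod, Finset.prod_eq_zero (Finset.mem_univ i) (by simp)] at h
  simpa [eval_prod] using h.symm

/-- Cauchy's bound: the roots of a polynomial with bounded coefficients are bounded. -/
lemma norm_le_of_root {x a b : K} {R : ℝ} (ha : ‖a‖ ≤ R) (hb : ‖b‖ ≤ R)
    (h : x ^ 4 - a / 2 * x ^ 2 - b / 3 * x + b = 0) : ‖x‖ ≤ 1 + 2 * R := by
  have hR : 0 ≤ R := (norm_nonneg a).trans ha
  by_contra! hx
  have h1 : x ^ 4 = a / 2 * x ^ 2 + b / 3 * x - b := by linear_combination h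
  have h2 : ‖x‖ ^ 4 ≤ R * ‖x‖ ^ 2 + R * ‖x‖ + R := by
    rw [← norm_pow, h1]
    refine (norm_sub_le _ _).trans (add_le_add ((norm_add_le _ _).trans (add_le_add ?_ ?_)) hb)
    · rw [norm_mul, norm_div, norm_pow, RCLike.norm_ofNat]
      gcongr
      linarith
    · rw [norm_mul, norm_div, RCLike.norm_ofNat]
      gcongr
      linarith
  have h3 : 1 ≤ ‖x‖ := by linarith
  have h4 : ‖x‖ ≤ ‖x‖ ^ 2 := by nlinarith
  nlinarith [mul_le_mul_of_nonneg_left h4 hR, sq_nonneg (‖x‖ ^ 2), mul_nonneg hR (sub_nonneg.2 h3)]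

/-- The inverse of the map given by the invariants is continuous, because the normalized weights are
roots of a polynomial with bounded coefficients and so stay in a compact set. -/
lemma isEmbedding_invariants : IsEmbedding (invariants (K := K)) := by
  refine ⟨isInducing_iff_nhds.2 fun z => le_antisymm
    (tendsto_iff_comap.1 continuous_invariants.continuousAt) ?_, invariants_injective⟩
  rw [le_iff_ultrafilter]
  intro U hU
  have hJ : Tendsto invariants (U : Filter (Moduli K)) (𝓝 (invariants z)) :=
    tendsto_iff_comap.2 hU
  choose s hs hsz h2 h3 h4 using exists_normalized_weights (K := K)
  have hbdd : ∀ᶠ y in (U : Filter (Moduli K)), s y ∈ Metric.closedBall (0 : Fin 4 → K)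
      (1 + 2 * (‖invariants z‖ + 1)) := by
    have h := hJ (Metric.closedBall_mem_nhds _ one_pos)
    filter_upwards [h] with y hy
    have hy' : ‖invariants y‖ ≤ ‖invariants z‖ + 1 := by
      have := norm_sub_norm_le (invariants y) (invariants z)
      rw [mem_preimage, mem_closedBall_iff_norm] at hy
      linarith
    have hp := eval_weight (hs y).1
    rw [h2, h3, h4] at hp
    rw [mem_closedBall_zero_iff, pi_norm_le_iff_of_nonneg (by positivity)]
    exact fun i => norm_le_of_root ((norm_fst_le _).trans hy') ((norm_snd_le _).trans hy') (hp i)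
  obtain ⟨w, -, hw⟩ := (isCompact_closedBall (0 : Fin 4 → K)
    (1 + 2 * (‖invariants z‖ + 1))).ultrafilter_le_nhds (U.map s) (le_principal_iff.2 hbdd)
  have hw' : Tendsto s (U : Filter (Moduli K)) (𝓝 w) := hw
  have hlim : ∀ f : (Fin 4 → K) → K, Continuous f → ∀ g : K × K → K, Continuous g →
      (∀ y, f (s y) = g (invariants y)) → f w = g (invariants z) := fun f hf g hg h =>
    tendsto_nhds_unique ((hf.tendsto w).comp hw')
      (((hg.tendsto _).comp hJ).congr fun y => (h y).symm)
  have l1 : ∑ i, w i = 0 := hlim (fun w => ∑ i, w i) (by fun_prop) (fun _ => 0) (by fun_prop)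
    fun y => (hs y).1
  have l2 := hlim (fun w => ∑ i, w i ^ 2) (by fun_prop) Prod.fst (by fun_prop) h2
  have l3 := hlim (fun w => ∑ i, w i ^ 3) (by fun_prop) Prod.snd (by fun_prop) h3
  have l4 := hlim (fun w => ∏ i, w i) (by fun_prop) Prod.snd (by fun_prop) h4
  have hwm : w ∈ genericWeights K :=
    ⟨l1, by rw [l3]; exact invariants_snd_ne_zero z, by rw [l4]; exact invariants_snd_ne_zero z⟩
  have hz : ofWeights w = z := invariants_injective (invariants_ofWeights_of_eq hwm l2 l3 l4)
  have ht : Tendsto (fun y => ofWeights (s y)) (U : Filter (Moduli K)) (𝓝 (ofWeights w)) :=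
    (continuousOn_ofWeights w hwm).tendsto.comp
      (tendsto_nhdsWithin_iff.2 ⟨hw', Eventually.of_forall hs⟩)
  simp only [hsz, hz] at ht
  exact ht

lemma isOpenEmbedding_invariants : IsOpenEmbedding (invariants (K := ℂ)) :=
  ⟨isEmbedding_invariants, by
    rw [range_invariants]
    exact isOpen_ne_fun continuous_snd continuous_const⟩

end Complex

/-! ### The roots of a quartic as analytic functions of its coefficients -/

section Roots

open Filter

variable {K : Type*} [RCLike K]

/-- The symmetric functions of four numbers that determine the polynomial with these roots. -/
def symmetricFunctions (w : Fin 4 → K) : Fin 4 → K :=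
  ![∑ i, w i, ∑ i, w i ^ 2, ∑ i, w i ^ 3, ∏ i, w i]

lemma analyticAt_symmetricFunctions (w : Fin 4 → K) : AnalyticAt K symmetricFunctions w := by
  have h := analyticAt_apply_four w
  have h1 : AnalyticAt K (fun w : Fin 4 → K => ∑ i, w i) w :=
    Finset.analyticAt_fun_sum _ fun j _ => h j
  have h2 : AnalyticAt K (fun w : Fin 4 → K => ∑ i, w i ^ 2) w :=
    Finset.analyticAt_fun_sum _ fun j _ => (h j).pow 2
  have h3 : AnalyticAt K (fun w : Fin 4 → K => ∑ i, w i ^ 3) w :=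
    Finset.analyticAt_fun_sum _ fun j _ => (h j).pow 3
  have h4 : AnalyticAt K (fun w : Fin 4 → K => ∏ i, w i) w :=
    Finset.analyticAt_fun_prod _ fun j _ => h j
  rw [analyticAt_pi_iff]
  intro i
  fin_cases i
  exacts [h1, h2, h3, h4]

/-- A variation of the roots which is killed by the differentials of the symmetric functions
vanishes at the simple roots. -/
lemma variation_eq_zero {x y z t a b c d : K} (hy : x ≠ y) (hz : x ≠ z) (ht : x ≠ t)
    (h1 : a + b + c + d = 0) (h2 : x * a + y * b + z * c + t * d = 0)
    (h3 : x ^ 2 * a + y ^ 2 * b + z ^ 2 * c + t ^ 2 * d = 0)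
    (h4 : a * y * z * t + x * b * z * t + x * y * c * t + x * y * z * d = 0) : a = 0 := by
  have h : a * ((x - y) * (x - z) * (x - t)) = 0 := by
    linear_combination (x ^ 3 - (x + y + z + t) * x ^ 2 +
      (x * y + x * z + x * t + y * z + y * t + z * t) * x) * h1 +
      (x ^ 2 - (x + y + z + t) * x) * h2 + x * h3 - h4
  exact (mul_eq_zero.1 h).resolve_right
    (mul_ne_zero (mul_ne_zero (sub_ne_zero.2 hy) (sub_ne_zero.2 hz)) (sub_ne_zero.2 ht))

lemma fderiv_symmetricFunctions (w h : Fin 4 → K) : fderiv K symmetricFunctions w h =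
    ![∑ i, h i, 2 * ∑ i, w i * h i, 3 * ∑ i, w i ^ 2 * h i,
      h 0 * w 1 * w 2 * w 3 + w 0 * h 1 * w 2 * w 3 + w 0 * w 1 * h 2 * w 3 +
        w 0 * w 1 * w 2 * h 3] := by
  have hl : HasDerivAt (fun s : K => w + s • h) h 0 := by
    simpa using ((hasDerivAt_id (0 : K)).smul_const h).const_add w
  have hi : ∀ i, HasDerivAt (fun s : K => w i + s * h i) (h i) 0 := fun i => by
    simpa using ((hasDerivAt_id (0 : K)).mul_const (h i)).const_add (w i)
  have hd : HasFDerivAt symmetricFunctions (fderiv K symmetricFunctions w) (w + (0 : K) • h) := by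
    rw [zero_smul, add_zero]
    exact (analyticAt_symmetricFunctions w).differentiableAt.hasFDerivAt
  have h1 := hasDerivAt_pi.1 (hd.comp_hasDerivAt (0 : K) hl)
  have e1 : HasDerivAt (fun s : K => ∑ i, (w i + s * h i)) (∑ i, h i) 0 :=
    HasDerivAt.fun_sum fun i _ => hi i
  have e2 : HasDerivAt (fun s : K => ∑ i, (w i + s * h i) ^ 2) (2 * ∑ i, w i * h i) 0 :=
    (HasDerivAt.fun_sum (u := Finset.univ) fun i _ => (hi i).fun_pow 2).congr_deriv
      (by simp [Finset.mul_sum, mul_assoc])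
  have e3 : HasDerivAt (fun s : K => ∑ i, (w i + s * h i) ^ 3) (3 * ∑ i, w i ^ 2 * h i) 0 :=
    (HasDerivAt.fun_sum (u := Finset.univ) fun i _ => (hi i).fun_pow 3).congr_deriv
      (by simp [Finset.mul_sum, mul_assoc])
  have e4 : HasDerivAt (fun s : K => ∏ i, (w i + s * h i))
      (h 0 * w 1 * w 2 * w 3 + w 0 * h 1 * w 2 * w 3 + w 0 * w 1 * h 2 * w 3 +
        w 0 * w 1 * w 2 * h 3) 0 := by
    simp only [Fin.prod_univ_four]
    exact ((((hi 0).fun_mul (hi 1)).fun_mul (hi 2)).fun_mul (hi 3)).congr_deriv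
      (by simp only [zero_mul, add_zero]; ring)
  ext i
  refine (h1 i).unique ?_
  fin_cases i
  exacts [e1, e2, e3, e4]

lemma fderiv_symmetricFunctions_injective {w : Fin 4 → K} (hw : Function.Injective w) :
    Function.Injective (fderiv K symmetricFunctions w) := by
  rw [injective_iff_map_eq_zero]
  intro h hh
  rw [fderiv_symmetricFunctions] at hh
  have e1 := congrFun hh 0
  have e2 := congrFun hh 1
  have e3 := congrFun hh 2
  have e4 := congrFun hh 3
  simp [Fin.sum_univ_four] at e1 e2 e3 e4
  have hne : ∀ i j, i ≠ j → w i ≠ w j := fun i j hij => hw.ne hij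
  have h0 : h 0 = 0 := variation_eq_zero (hne 0 1 (by decide)) (hne 0 2 (by decide))
    (hne 0 3 (by decide)) e1 e2 e3 e4
  have h1 : h 1 = 0 := variation_eq_zero (b := h 0) (c := h 2) (d := h 3) (hne 1 0 (by decide))
    (hne 1 2 (by decide)) (hne 1 3 (by decide)) (by linear_combination e1)
    (by linear_combination e2) (by linear_combination e3) (by linear_combination e4)
  have h2 : h 2 = 0 := variation_eq_zero (b := h 0) (c := h 1) (d := h 3) (hne 2 0 (by decide))
    (hne 2 1 (by decide)) (hne 2 3 (by decide)) (by linear_combination e1)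
    (by linear_combination e2) (by linear_combination e3) (by linear_combination e4)
  have h3 : h 3 = 0 := by rw [h0, h1, h2] at e1; simpa using e1
  ext i
  fin_cases i
  exacts [h0, h1, h2, h3]

/-- Near a polynomial with simple roots, the roots are analytic functions of the coefficients. -/
lemma exists_analytic_roots {w : Fin 4 → K} (hw : Function.Injective w) :
    ∃ S : (Fin 4 → K) → (Fin 4 → K), AnalyticAt K S (symmetricFunctions w) ∧
      S (symmetricFunctions w) = w ∧
      ∀ᶠ y in 𝓝 (symmetricFunctions w), symmetricFunctions (S y) = y := by
  have ha := analyticAt_symmetricFunctions w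
  have hc : ContDiffAt K ω symmetricFunctions w := ha.contDiffAt
  let e : (Fin 4 → K) ≃L[K] (Fin 4 → K) :=
    (LinearEquiv.ofInjectiveEndo (fderiv K symmetricFunctions w).toLinearMap
      (fderiv_symmetricFunctions_injective hw)).toContinuousLinearEquiv
  have he : (e : (Fin 4 → K) →L[K] (Fin 4 → K)) = fderiv K symmetricFunctions w := by
    ext; rfl
  have hf : HasFDerivAt symmetricFunctions (e : (Fin 4 → K) →L[K] (Fin 4 → K)) w := by
    rw [he]; exact ha.differentiableAt.hasFDerivAt
  have hn : (ω : ℕ∞ω) ≠ 0 := by simp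
  exact ⟨hc.localInverse hf hn, (hc.to_localInverse hf hn).analyticAt,
    hc.localInverse_apply_image hf hn, (hc.hasStrictFDerivAt' hf hn).eventually_right_inverse⟩

/-- The pairs `(a, b)` for which the normalized weights with these invariants are not distinct: the
discriminant of the quartic polynomial vanishes. -/
def discriminantCurve (K : Type*) [RCLike K] : Set (K × K) :=
  {q | ∃ x : K, x ^ 4 - q.1 / 2 * x ^ 2 - q.2 / 3 * x + q.2 = 0 ∧
    4 * x ^ 3 - q.1 * x - q.2 / 3 = 0}

open Polynomial in
lemma injective_of_notMem_discriminantCurve {w : Fin 4 → K} (h1 : ∑ i, w i = 0) {a b : K}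
    (h2 : ∑ i, w i ^ 2 = a) (h3 : ∑ i, w i ^ 3 = b) (h4 : ∏ i, w i = b)
    (h : (a, b) ∉ discriminantCurve K) : Function.Injective w := by
  intro i j hij
  by_contra hne
  refine h ⟨w i, ?_, ?_⟩
  · have := eval_weight h1 i
    rwa [h2, h3, h4] at this
  · have hp := prod_X_sub_C_eq h1
    rw [h2, h3, h4] at hp
    rw [← Finset.mul_prod_erase _ _ (Finset.mem_univ i),
      ← Finset.mul_prod_erase _ _ (Finset.mem_erase.2 ⟨Ne.symm hne, Finset.mem_univ j⟩)] at hp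
    have h' := congrArg (fun p => eval (w i) (derivative p)) hp
    simp [← hij] at h'
    linear_combination -h'

open Polynomial in
lemma finite_discriminantCurve_fst (a : K) : {b | (a, b) ∈ discriminantCurve K}.Finite := by
  set p : K[X] := -3 * X ^ 4 + 12 * X ^ 3 + C (a / 2) * X ^ 2 - C (3 * a) * X with hp
  have hp0 : p ≠ 0 := by
    intro h
    have := congrArg (fun p => coeff p 4) h
    simp [hp] at this
  refine ((finite_setOfPred_isRoot hp0).image fun x => 12 * x ^ 3 - 3 * a * x).subset ?_
  rintro b ⟨x, hx, hx'⟩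
  simp only at hx hx'
  have hb : b = 12 * x ^ 3 - 3 * a * x := by linear_combination -3 * hx'
  refine ⟨x, ?_, hb.symm⟩
  simp [hp, IsRoot]
  rw [hb] at hx
  linear_combination hx

open Polynomial in
lemma finite_discriminantCurve_snd {b : K} (hb : b ≠ 0) :
    {a | (a, b) ∈ discriminantCurve K}.Finite := by
  set p : K[X] := -X ^ 4 - C (b / 6) * X + C b with hp
  have hp0 : p ≠ 0 := by
    intro h
    have := congrArg (eval 0) h
    simp [hp, hb] at this
  refine ((finite_setOfPred_isRoot hp0).image fun x => (4 * x ^ 3 - b / 3) / x).subset ?_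
  rintro a ⟨x, hx, hx'⟩
  simp only at hx hx'
  have hx0 : x ≠ 0 := by
    rintro rfl
    apply hb
    linear_combination hx
  refine ⟨x, ?_, ?_⟩
  · simp [hp, IsRoot]
    linear_combination hx - x / 2 * hx'
  · simp only
    rw [div_eq_iff hx0]
    linear_combination hx'

end Roots

/-! ### The complex structure -/

section ComplexStructure

open Filter

variable {K : Type*} [RCLike K]

/-- Off the discriminant curve, the moduli space has local sections by weights which depend
analytically on the invariants. -/
lemma exists_analytic_weights {z : Moduli K} (h : invariants z ∉ discriminantCurve K) :
    ∃ f : K × K → Fin 4 → K, AnalyticAt K f (invariants z) ∧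
      (∀ᶠ q in 𝓝 (invariants z), f q ∈ genericWeights K ∧ invariants (ofWeights (f q)) = q) := by
  obtain ⟨w, hw, hz, h2, h3, h4⟩ := exists_normalized_weights z
  obtain ⟨S, hS, hSw, hev⟩ :=
    exists_analytic_roots (injective_of_notMem_discriminantCurve hw.1 h2 h3 h4 h)
  let l : K × K → Fin 4 → K := fun q => ![0, q.1, q.2, q.2]
  have hl : l (invariants z) = symmetricFunctions w := by
    simp only [l, symmetricFunctions, hw.1, h2, h3, h4]
  have hla : AnalyticAt K l (invariants z) := by
    rw [analyticAt_pi_iff]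
    intro i
    fin_cases i
    exacts [analyticAt_const, analyticAt_fst, analyticAt_snd, analyticAt_snd]
  rw [← hl] at hS hev
  refine ⟨S ∘ l, hS.comp hla, ?_⟩
  filter_upwards [hla.continuousAt.eventually hev,
    (isOpen_ne_fun continuous_snd continuous_const).mem_nhds (invariants_snd_ne_zero z)]
    with q hq (hq0 : q.2 ≠ 0)
  have e1 : ∑ i, S (l q) i = 0 := congrFun hq 0
  have e2 : ∑ i, S (l q) i ^ 2 = q.1 := congrFun hq 1
  have e3 : ∑ i, S (l q) i ^ 3 = q.2 := congrFun hq 2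
  have e4 : ∏ i, S (l q) i = q.2 := congrFun hq 3
  have hm : S (l q) ∈ genericWeights K := ⟨e1, by rw [e3]; exact hq0, by rw [e4]; exact hq0⟩
  exact ⟨hm, invariants_ofWeights_of_eq hm e2 e3 e4⟩

lemma analyticAt_of_notMem_discriminantCurve {F : Moduli K → K} {z : Moduli K}
    (hF : Moduli.IsAnalyticFunAt F z) {g : K × K → Moduli K}
    (hg : Function.LeftInverse g invariants) (h : invariants z ∉ discriminantCurve K) :
    AnalyticAt K (F ∘ g) (invariants z) := by
  obtain ⟨f, hf, hev⟩ := exists_analytic_weights h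
  obtain ⟨hm, hi⟩ := hev.self_of_nhds
  have h1 : AnalyticAt K (fun q => F (ofWeights (f q))) (invariants z) := by
    refine IsAnalyticFunAt.comp_ofWeights hf hm (hev.mono fun q hq => hq.1.1) ?_
    rwa [invariants_injective hi]
  refine h1.congr (hev.mono fun q hq => ?_)
  rw [Function.comp_apply, ← hq.2, hg, hq.2]

/-- Over the complex numbers the invariants are a global holomorphic chart. In one direction, the
function of the invariants is continuous, and it is holomorphic off the discriminant curve, which
meets the lines parallel to the axes in finite sets. -/
lemma isAnalyticFunAt_iff_invariants {F : Moduli ℂ → ℂ} {z : Moduli ℂ} {g : ℂ × ℂ → Moduli ℂ}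
    (hg : Function.LeftInverse g invariants) :
    Moduli.IsAnalyticFunAt F z ↔ AnalyticAt ℂ (F ∘ g) (invariants z) := by
  constructor
  · intro h
    have h1 : ∀ᶠ q in 𝓝 (invariants z), q.2 ≠ 0 ∧
        ∃ y, invariants y = q ∧ Moduli.IsAnalyticFunAt F y := by
      rw [← isOpenEmbedding_invariants.map_nhds_eq, eventually_map]
      exact (IsAnalyticFunAt.eventually h).mono fun y hy => ⟨invariants_snd_ne_zero y, y, rfl, hy⟩
    obtain ⟨r, hr, hball⟩ := Metric.nhds_basis_closedBall.eventually_iff.1 h1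
    rw [← Prod.mk.eta (p := invariants z), ← closedBall_prod_same] at hball
    rw [← Prod.mk.eta (p := invariants z)]
    refine analyticAt_of_differentiable_off_countable hr (S := discriminantCurve ℂ) ?_ ?_ ?_ ?_
    · intro q hq
      obtain ⟨-, y, rfl, hy⟩ := hball hq
      refine ContinuousAt.continuousWithinAt
        (isOpenEmbedding_invariants.continuousAt_iff.1 ?_)
      convert IsAnalyticFunAt.continuousAt hy using 1
      exact funext fun y => congrArg F (hg y)
    · intro q hq hqS
      obtain ⟨-, y, rfl, hy⟩ := hball hq
      exact (analyticAt_of_notMem_discriminantCurve hy hg hqS).differentiableAt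
    · exact fun x _ => ((finite_discriminantCurve_fst x).subset fun y hy => hy.2).countable
    · intro y hy
      have hy0 : y ≠ 0 := (hball (mk_mem_prod (Metric.mem_closedBall_self hr.le) hy)).1
      exact ((finite_discriminantCurve_snd hy0).subset fun x hx => hx.2).countable
  · intro h
    obtain ⟨v, hv, rfl⟩ := exists_normalChart z
    rw [(normalChart ℂ).isAnalyticFunAt_iff hv]
    have hp : AnalyticAt ℂ (fun u => weightInvariants ((normalChart ℂ).point u)) v :=
      (analyticAt_weightInvariants hv).comp ((normalChart ℂ).analyticAt_point v)
    have he : ∀ u ∈ (normalChart ℂ).domain,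
        weightInvariants ((normalChart ℂ).point u) = invariants ((normalChart ℂ).toModuli u) :=
      fun u hu => (invariants_ofWeights hu).symm
    refine (h.comp_of_eq hp (he v hv)).congr ?_
    filter_upwards [(normalChart ℂ).isOpen_domain.mem_nhds hv] with u hu
    rw [Function.comp_apply, Function.comp_apply, he u hu, hg]; rfl

instance nonempty_moduli : Nonempty (Moduli K) := ⟨ofWeights 0⟩

instance connectedSpace_moduli : ConnectedSpace (Moduli ℂ) := by
  have h : IsConnected {q : ℂ × ℂ | q.2 ≠ 0} := by
    have h0 : IsConnected ({0}ᶜ : Set ℂ) :=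
      isConnected_compl_singleton_of_one_lt_rank (by simp) 0
    convert (isConnected_univ (α := ℂ)).prod h0 using 1
    ext q
    simp
  have : PreconnectedSpace (Moduli ℂ) := by
    refine ⟨(isEmbedding_invariants (K := ℂ)).isInducing.isPreconnected_image.1 ?_⟩
    rw [image_univ, range_invariants]
    exact h.isPreconnected
  exact ⟨inferInstance⟩

lemma exists_complexManifold : ∃ _ : ChartedSpace (ℂ × ℂ) (Moduli ℂ),
    IsManifold 𝓘(ℂ, ℂ × ℂ) ω (Moduli ℂ) ∧
    ∀ (F : Moduli ℂ → ℂ) (z : Moduli ℂ),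
      ContMDiffAt 𝓘(ℂ, ℂ × ℂ) 𝓘(ℂ, ℂ) ω F z ↔ Moduli.IsAnalyticFunAt F z := by
  have h := isOpenEmbedding_invariants
  refine ⟨h.singletonChartedSpace, h.isManifold_singleton, fun F z => ?_⟩
  let _ := h.singletonChartedSpace
  set e := h.toOpenPartialHomeomorph invariants with he
  have hg : Function.LeftInverse e.symm invariants := fun y => e.left_inv (by simp [e])
  rw [contMDiffAt_iff, isAnalyticFunAt_iff_invariants hg]
  change ContinuousAt F z ∧ ContDiffWithinAt ℂ ω (F ∘ e.symm) (range id) (invariants z) ↔ _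
  rw [range_id, contDiffWithinAt_univ]
  refine ⟨fun h => h.2.analyticAt, fun h => ⟨?_, h.contDiffAt⟩⟩
  exact IsAnalyticFunAt.continuousAt ((isAnalyticFunAt_iff_invariants hg).2 h)

end ComplexStructure

end Quadrilaterals

end

open Quadrilaterals in
theorem lemma4p5 :
    -- the quotient is a `K`-analytic surface, identified with `(K² \ A) / Sym(4)`
    (∀ (K : Type) [RCLike K],
      IsAnalyticSurface (Moduli.IsAnalyticFunAt (K := K)) ∧
      -- a quadruple in normal form is generic exactly when its fourth point is not in `A`
      (∀ v : K × K, ![vertex K 0, vertex K 1, vertex K 2, v] ∈ orderedGeneric K ↔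
        v ∉ arrangement K) ∧
      -- every generic configuration has a normal form
      (∀ P : GenericConf K, ∃ (T : Aff K) (v : K × K),
        T '' P.1.points = insert v (Set.range (vertex K))) ∧
      -- synthetic description of the involutions
      (∀ (j : Fin 3) (ℓ : K →ᵃ[K] (K × K)) (t : K), ℓ 1 = vertex K j →
        ℓ 0 ∈ line[K, vertex K (j + 1), vertex K (j + 2)] → ℓ t ∉ arrangement K →
          gauge j (ℓ t) = ℓ (1 / t)) ∧
      ∃ ρ : Equiv.Perm (Fin 4) →* (((arrangement K)ᶜ : Set (K × K)) ≃ₜ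
          ((arrangement K)ᶜ : Set (K × K))),
        Function.Injective ρ ∧ IsGaugeAction ρ ∧
        (∀ σ, IsRationalOn (arrangement K)ᶜ (fun v => (ρ σ v : K × K))) ∧
        ∃ Θ : Moduli K ≃ₜ Quotient (orbitSetoid ρ),
          (∀ (P : GenericConf K) (T : Aff K) (v : K × K),
            T '' P.1.points = insert v (Set.range (vertex K)) →
              ∃ hv : v ∉ arrangement K,
                Θ (Moduli.proj P) = Quotient.mk (orbitSetoid ρ) ⟨v, hv⟩) ∧
          (∀ (F : Quotient (orbitSetoid ρ) → K) (z : Moduli K),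
            Moduli.IsAnalyticFunAt (F ∘ Θ) z ↔
              DescendsAnalyticAt (Quotient.mk (orbitSetoid ρ)) F (Θ z))) ∧
    -- over the complex numbers: a connected complex manifold of dimension two
    (ConnectedSpace (Moduli ℂ) ∧
      ∃ _ : ChartedSpace (ℂ × ℂ) (Moduli ℂ),
        IsManifold 𝓘(ℂ, ℂ × ℂ) ω (Moduli ℂ) ∧
        ∀ (F : Moduli ℂ → ℂ) (z : Moduli ℂ),
          ContMDiffAt 𝓘(ℂ, ℂ × ℂ) 𝓘(ℂ, ℂ) ω F z ↔ Moduli.IsAnalyticFunAt F z) ∧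
    -- over the real numbers: the two connected components
    (convexClasses.Nonempty ∧ nonConvexClasses.Nonempty ∧
      Disjoint convexClasses nonConvexClasses ∧
      convexClasses ∪ nonConvexClasses = Set.univ ∧
      (∀ z ∈ convexClasses, connectedComponent z = convexClasses) ∧
      (∀ z ∈ nonConvexClasses, connectedComponent z = nonConvexClasses) ∧
      -- the singular points; both local models occur
      (∀ z : Moduli ℝ, IsSingularPoint Moduli.IsAnalyticFunAt z →
        HasLocalModel Moduli.IsAnalyticFunAt (reflectionGroup ℝ) z ∨
          HasLocalModel Moduli.IsAnalyticFunAt (triangleGroup ℝ) z) ∧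
      (∃ z : Moduli ℝ, IsSingularPoint Moduli.IsAnalyticFunAt z ∧
        HasLocalModel Moduli.IsAnalyticFunAt (reflectionGroup ℝ) z) ∧
      (∃ z : Moduli ℝ, IsSingularPoint Moduli.IsAnalyticFunAt z ∧
        HasLocalModel Moduli.IsAnalyticFunAt (triangleGroup ℝ) z)) := by
  refine ⟨fun K _ => ⟨isAnalyticSurface, mem_normalForm_iff, exists_normalForm,
      gauge_apply_line, gaugeAction K, gaugeAction_injective, isGaugeAction_gaugeAction,
      isRationalOn_gaugeAction, (quotientHomeomorph K).symm, symm_proj_eq,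
      isAnalyticFunAt_quotient⟩,
    ⟨connectedSpace_moduli, exists_complexManifold⟩,
    convexClasses_nonempty, nonConvexClasses_nonempty, disjoint_convexClasses,
    convexClasses_union, fun _ => connectedComponent_convex, fun _ => connectedComponent_nonConvex,
    fun z hz => (hasLocalModel_trichotomy z).resolve_left hz,
    exists_reflection_singularity, exists_triangle_singularity⟩
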